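/- A fair division instance consists of $n \ge 1$ agents, a finite set $M$ of $m$ indivisible items and utilities $v_i(r) \in \mathbb{R}$ for every agent $i$ and item $r$, extended additively to bundles $S \subseteq M$ by $v_i(S) = \sum_{r \in S} v_i(r)$. It is a goods division instance if all $v_i(r) \ge 0$, and a chore division instance if all $v_i(r) \le 0$. A utility function $v_i$ is weakly lexicographic if there is a partition $(L_1,\dots,L_k)$ of $M$ such that $|v_i(r)| = |v_i(r')| > 0$ for all $r, r' \in L_j$ and $|v_i(r)| > \bigl|v_i(L_{j+1} \cup \dots \cup L_k)\bigr|$ for all $r \in L_j$, for each $j$; the instance is weakly lexicographic if every $v_i$ is. The instance is factored bivalued if there are common real numbers $a, b$ with $0 < a < b$ (goods) or $0 > a > b$ (chores) such that $b/a$ is an integer and $v_i(r) \in \{a, b\}$ for all $i, r$. An allocation is a partition $x = (x_1,\dots,x_n)$ of $M$ into (possibly empty) bundles, $x_i$ going to agent $i$. It is maximin share fair (MMS) if, for every agent $i$, $v_i(x_i) \ge \max_{(S_1,\dots,S_n)} \min_{t} v_i(S_t)$, where the maximum is over all partitions of $M$ into $n$ possibly empty bundles. It is Pareto optimal (PO)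 if there is no allocation $y$ with $v_i(y_i) \ge v_i(x_i)$ for all $i$ and with strict inequality for some $i$. Theorem. In every goods division or chore division instance with weakly lexicographic or factored bivalued utilities, an allocation that is both MMS and PO exists and can be computed in polynomial time: there is an algorithm that, given $n$, $m$ and the numbers $v_i(r)$, outputs such an allocation after a number of steps that is bounded by a polynomial in $n$ and $m$, where a step is a memory access, an addition, subtraction or comparison of two numbers (integers or utilities), an assignment or a branch. -/

import Mathlib

/-! ### Fair division instances

The agents are `Fin n`, the items `Fin m`; `v i r` is the utility of agent `i` for item `r`. -/

namespace FairDivision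

/-- Goods division: all utilities are non-negative. -/
def IsGoods {n m : ℕ} (v : Fin n → Fin m → ℝ) : Prop :=
  ∀ i r, 0 ≤ v i r

/-- Chore division: all utilities are non-positive. -/
def IsChores {n m : ℕ} (v : Fin n → Fin m → ℝ) : Prop :=
  ∀ i r, v i r ≤ 0

/-- The additive extension of a utility function to bundles of items. -/
noncomputable def bundleValue {m : ℕ} (u : Fin m → ℝ) (S : Finset (Fin m)) : ℝ :=
  ∑ r ∈ S, u r

/-- `S` is a partition of the items into `k` (possibly empty) labelled bundles. -/
def IsPartition {k m : ℕ} (S : Fin k → Finset (Fin m)) : Prop :=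
  (∀ s t, s ≠ t → Disjoint (S s) (S t)) ∧ ∀ r, ∃ t, r ∈ S t

/-- A weakly lexicographic utility function: there is a partition `L` of the items into classes,
in decreasing order of importance, such that items of one class have the same non-zero absolute
value, and this is larger than the absolute value of all later classes together. -/
def IsWeaklyLexicographic {m : ℕ} (u : Fin m → ℝ) : Prop :=
  ∃ (k : ℕ) (L : Fin k → Finset (Fin m)), IsPartition L ∧
    (∀ i, ∀ r ∈ L i, ∀ r' ∈ L i, |u r| = |u r'| ∧ 0 < |u r'|) ∧
    (∀ i, ∀ r ∈ L i, |bundleValue u ((Finset.Ioi i).biUnion L)| < |u r|)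

/-- Every agent has a weakly lexicographic utility function. -/
def WeaklyLexicographicInstance {n m : ℕ} (v : Fin n → Fin m → ℝ) : Prop :=
  ∀ i, IsWeaklyLexicographic (v i)

/-- Factored bivalued utilities: all utilities lie in `{a, b}` for common `a`, `b` with
`0 < a < b` (goods) or `0 > a > b` (chores), where `b` is an integer multiple of `a`. -/
def FactoredBivaluedInstance {n m : ℕ} (v : Fin n → Fin m → ℝ) : Prop :=
  ∃ a b : ℝ, ((0 < a ∧ a < b) ∨ (a < 0 ∧ b < a)) ∧ (∃ q : ℕ, b = q * a) ∧
    ∀ i r, v i r = a ∨ v i r = b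

/-- An allocation: every item is given to exactly one agent; `x i` is the bundle of agent `i`. -/
def IsAllocation {n m : ℕ} (x : Fin n → Finset (Fin m)) : Prop :=
  IsPartition x

/-- The `k`-maximin share of a utility function: the maximum over all partitions into `k` bundles
of the minimum value of a bundle. For `1 ≤ k` both extrema range over finite non-empty sets. -/
noncomputable def maximinShare {m : ℕ} (k : ℕ) (u : Fin m → ℝ) : ℝ :=
  ⨆ S : {S : Fin k → Finset (Fin m) // IsPartition S}, ⨅ t : Fin k, bundleValue u (S.1 t)

/-- Maximin share fairness. -/
def IsMMS {n m : ℕ} (v : Fin n → Fin m → ℝ) (x : Fin n → Finset (Fin m)) : Prop :=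
  ∀ i, maximinShare n (v i) ≤ bundleValue (v i) (x i)

/-- `x` is Pareto dominated by `y`. -/
def ParetoDominatedBy {n m : ℕ} (v : Fin n → Fin m → ℝ) (x y : Fin n → Finset (Fin m)) : Prop :=
  (∀ i, bundleValue (v i) (x i) ≤ bundleValue (v i) (y i)) ∧
    ∃ i, bundleValue (v i) (x i) < bundleValue (v i) (y i)

/-- Pareto optimality: no allocation Pareto dominates `x`. -/
def IsParetoOptimal {n m : ℕ} (v : Fin n → Fin m → ℝ) (x : Fin n → Finset (Fin m)) : Prop :=
  ∀ y, IsAllocation y → ¬ ParetoDominatedBy v x y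

/-! ### Algorithms and their running time

Programs of a small imperative language with integer variables, integer arrays and arrays of real
numbers. The only arithmetic is addition and subtraction, so that in `T` steps no number grows
beyond a linear combination of the inputs with coefficients of `O(T)` bits: on rational inputs in
binary, a program with a polynomial number of steps is a polynomial-time algorithm in the Turing
machine model too. Every operation, memory access, assignment and test is one step. -/

/-- Integer expressions. -/
inductive IntExpr : Type
  /-- a constant of the program -/
  | const (c : ℕ)
  /-- the integer variable number `x` -/
  | var (x : ℕ)
  /-- the entry with index `e` of the integer array number `a` -/
  | get (a : ℕ) (e : IntExpr)
  | add (e f : IntExpr)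
  /-- truncated subtraction -/
  | sub (e f : IntExpr)

/-- Real expressions. -/
inductive RealExpr : Type
  | zero
  /-- the entry with index `e` of the real array number `a` -/
  | get (a : ℕ) (e : IntExpr)
  | add (e f : RealExpr)
  | sub (e f : RealExpr)

/-- Tests. -/
inductive Test : Type
  | intLt (e f : IntExpr)
  | realLt (e f : RealExpr)
  | not (b : Test)
  | and (b c : Test)

/-- Programs. -/
inductive Program : Type
  | skip
  /-- set integer variable `x` to `e` -/
  | setVar (x : ℕ) (e : IntExpr)
  /-- set the entry with index `e` of integer array `a` to `f` -/
  | setInt (a : ℕ) (e f : IntExpr)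
  /-- set the entry with index `e` of real array `a` to `f` -/
  | setReal (a : ℕ) (e : IntExpr) (f : RealExpr)
  /-- first `p`, then `q` -/
  | seq (p q : Program)
  /-- if `b` then `p` else `q` -/
  | ite (b : Test) (p q : Program)
  /-- as long as `b` holds, do `p` -/
  | loop (b : Test) (p : Program)

/-- The contents of the memory. -/
structure Memory : Type where
  var : ℕ → ℕ
  intArr : ℕ → ℕ → ℕ
  realArr : ℕ → ℕ → ℝ

/-- The value of an integer expression. -/
def IntExpr.eval (s : Memory) : IntExpr → ℕ
  | .const c => c
  | .var x => s.var x
  | .get a e => s.intArr a (e.eval s)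
  | .add e f => e.eval s + f.eval s
  | .sub e f => e.eval s - f.eval s

/-- The number of steps to evaluate an integer expression. -/
def IntExpr.cost : IntExpr → ℕ
  | .const _ => 1
  | .var _ => 1
  | .get _ e => e.cost + 1
  | .add e f => e.cost + f.cost + 1
  | .sub e f => e.cost + f.cost + 1

/-- The value of a real expression. -/
noncomputable def RealExpr.eval (s : Memory) : RealExpr → ℝ
  | .zero => 0
  | .get a e => s.realArr a (e.eval s)
  | .add e f => e.eval s + f.eval s
  | .sub e f => e.eval s - f.eval s

/-- The number of steps to evaluate a real expression. -/
def RealExpr.cost : RealExpr → ℕ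
  | .zero => 1
  | .get _ e => e.cost + 1
  | .add e f => e.cost + f.cost + 1
  | .sub e f => e.cost + f.cost + 1

/-- The truth value of a test. -/
def Test.Holds (s : Memory) : Test → Prop
  | .intLt e f => e.eval s < f.eval s
  | .realLt e f => e.eval s < f.eval s
  | .not b => ¬ b.Holds s
  | .and b c => b.Holds s ∧ c.Holds s

/-- The number of steps to evaluate a test. -/
def Test.cost : Test → ℕ
  | .intLt e f => e.cost + f.cost + 1
  | .realLt e f => e.cost + f.cost + 1
  | .not b => b.cost + 1
  | .and b c => b.cost + c.cost + 1

/-- Overwrite the integer variable `x`. -/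
def Memory.setVar (s : Memory) (x c : ℕ) : Memory :=
  { s with var := Function.update s.var x c }

/-- Overwrite the entry `k` of the integer array `a`. -/
def Memory.setInt (s : Memory) (a k c : ℕ) : Memory :=
  { s with intArr := Function.update s.intArr a (Function.update (s.intArr a) k c) }

/-- Overwrite the entry `k` of the real array `a`. -/
def Memory.setReal (s : Memory) (a k : ℕ) (c : ℝ) : Memory :=
  { s with realArr := Function.update s.realArr a (Function.update (s.realArr a) k c) }

/-- `Exec p s s' t`: started on memory `s`, the program `p` halts after exactly `t` steps with
memory `s'`. If `p` does not halt on `s`, this holds for no `s'` and `t`. -/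
inductive Exec : Program → Memory → Memory → ℕ → Prop
  | skip (s : Memory) : Exec .skip s s 1
  | setVar (s : Memory) (x : ℕ) (e : IntExpr) :
      Exec (.setVar x e) s (s.setVar x (e.eval s)) (e.cost + 1)
  | setInt (s : Memory) (a : ℕ) (e f : IntExpr) :
      Exec (.setInt a e f) s (s.setInt a (e.eval s) (f.eval s)) (e.cost + f.cost + 1)
  | setReal (s : Memory) (a : ℕ) (e : IntExpr) (f : RealExpr) :
      Exec (.setReal a e f) s (s.setReal a (e.eval s) (f.eval s)) (e.cost + f.cost + 1)
  | seq {p q : Program} {s s' s'' : Memory} {t t' : ℕ} :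
      Exec p s s' t → Exec q s' s'' t' → Exec (.seq p q) s s'' (t + t')
  | iteTrue {b : Test} {p q : Program} {s s' : Memory} {t : ℕ} :
      b.Holds s → Exec p s s' t → Exec (.ite b p q) s s' (b.cost + t)
  | iteFalse {b : Test} {p q : Program} {s s' : Memory} {t : ℕ} :
      ¬ b.Holds s → Exec q s s' t → Exec (.ite b p q) s s' (b.cost + t)
  | loopStop {b : Test} {p : Program} {s : Memory} :
      ¬ b.Holds s → Exec (.loop b p) s s b.cost
  | loopStep {b : Test} {p : Program} {s s' s'' : Memory} {t t' : ℕ} :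
      b.Holds s → Exec p s s' t → Exec (.loop b p) s' s'' t' →
        Exec (.loop b p) s s'' (b.cost + t + t')

/-- The input: integer variables `0` and `1` hold the numbers `n` and `m` of agents and items, entry
`i * m + r` of real array `0` holds the utility `v i r`, and everything else is zero. -/
noncomputable def inputMemory {n m : ℕ} (v : Fin n → Fin m → ℝ) : Memory where
  var x := if x = 0 then n else if x = 1 then m else 0
  intArr _ _ := 0
  realArr a k :=
    if h : a = 0 ∧ k < n * m then
      v (finProdFinEquiv.symm ⟨k, h.2⟩).1 (finProdFinEquiv.symm ⟨k, h.2⟩).2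
    else 0

/-- The output is read off integer array `0`: its entry `r` is the agent who receives item `r`. -/
def OutputsAllocation {n m : ℕ} (s : Memory) (x : Fin n → Finset (Fin m)) : Prop :=
  ∀ (i : Fin n) (r : Fin m), r ∈ x i ↔ s.intArr 0 r = i

end FairDivision

/-! For each agent, sort the absolute utilities in decreasing order and call the positions slots.
The maximin share depends only on these sorted weights, and both classes of utilities have one
property in common (`NoOvershoot`): two bundles of earlier items with different weights differ by at
least the weight of the next item. Under this property the greedy rule, which puts each item into a
lightest bundle, produces loads that are majorized by those of any other distribution
(`sum_excess_le`). Hence it maximizes the minimum load and minimizes the maximum load at once, and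
the maximin share of every agent can be computed.

Next the slots, on whose order all agents agree, are divided. While A agents are left, the candidate
bundles consist of every A-th free slot, starting with the first one, up to a cut (`heads`). For
goods the first cut that satisfies some remaining agent is taken, for chores the last one that some
remaining agent tolerates. Each remaining agent keeps an invariant. For lexicographic weights it
says that the free slots can still be divided into A bundles that meet the threshold. The candidate
bundle is the first bundle of a round robin, which is greedy as long as each round consists of equal
weights; in the first round that does not, the first item outweighs the last one and everything
after it, which settles the claim directly (`LexOn.exists_of_robin_lt`, `LexOn.exists_of_lt_robin`).
For two-valued weights the invariant is a pair of linear inequalities between integers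
(`TwoValuedOn.goodsInvariant`, `TwoValuedOn.choresInvariant`).

Slots are turned into items by picking sequences: the owners of the slots take their best remaining
item, from the first slot to the last for goods and in the opposite order for chores. When a slot
has its turn, too few items are gone to exclude one at least as good as the slot
(`exists_good_item`).

Finally items are exchanged along cycles in which nobody loses and somebody gains. This preserves
the maximin shares and increases an integer potential of size at most m * m. When no such cycle is
left, the allocation is Pareto optimal: for two values because it maximizes a weighted sum of
utilities (`NoStrictCycle.isParetoOptimal_of_two_valued`), for lexicographic utilities because every
Pareto improvement contains such a cycle (`exists_strict_cycle`).

The running time comes along with correctness: `Term` bounds the steps by a polynomial, fixed by the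
program text, in a common bound N for the iterations of all loops. -/

namespace FairDivision

/-! ### A total-correctness logic for programs -/

/-- A bound on the number of steps of a program all of whose loops make at most `X` iterations
per run. -/
noncomputable def stat : Program → Polynomial ℕ
  | .skip => 1
  | .setVar _ e => Polynomial.C (e.cost + 1)
  | .setInt _ e f => Polynomial.C (e.cost + f.cost + 1)
  | .setReal _ e f => Polynomial.C (e.cost + f.cost + 1)
  | .seq p q => stat p + stat q
  | .ite b p q => Polynomial.C b.cost + stat p + stat q
  | .loop b p => (Polynomial.X + 1) * (Polynomial.C b.cost + stat p)

/-- The program `p`, started on `s`, halts in a memory satisfying `Q`, after a number of steps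
as if each loop made at most `N` iterations. -/
def Term (N : ℕ) (p : Program) (s : Memory) (Q : Memory → Prop) : Prop :=
  ∃ s' t, Exec p s s' t ∧ t ≤ (stat p).eval N ∧ Q s'

namespace Term
variable {N : ℕ} {s : Memory} {Q : Memory → Prop}

theorem mono {p : Program} {Q' : Memory → Prop} (h : Term N p s Q') (hQ : ∀ s', Q' s' → Q s') :
    Term N p s Q := by
  obtain ⟨s', t, h1, h2, h3⟩ := h
  exact ⟨s', t, h1, h2, hQ _ h3⟩

theorem skip (h : Q s) : Term N .skip s Q := ⟨s, 1, .skip s, by simp [stat], h⟩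

theorem setVar {x : ℕ} {e : IntExpr} (h : Q (s.setVar x (e.eval s))) :
    Term N (.setVar x e) s Q := ⟨_, _, .setVar s x e, by simp [stat], h⟩

theorem setInt {a : ℕ} {e f : IntExpr} (h : Q (s.setInt a (e.eval s) (f.eval s))) :
    Term N (.setInt a e f) s Q := ⟨_, _, .setInt s a e f, by simp [stat], h⟩

theorem setReal {a : ℕ} {e : IntExpr} {f : RealExpr}
    (h : Q (s.setReal a (e.eval s) (f.eval s))) :
    Term N (.setReal a e f) s Q := ⟨_, _, .setReal s a e f, by simp [stat], h⟩

theorem seq {p q : Program} (h : Term N p s fun s' => Term N q s' Q) :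
    Term N (.seq p q) s Q := by
  obtain ⟨s', t, h1, h2, s'', t', h3, h4, h5⟩ := h
  exact ⟨s'', t + t', .seq h1 h3, by simp [stat]; omega, h5⟩

theorem ite {b : Test} {p q : Program} (hp : b.Holds s → Term N p s Q)
    (hq : ¬ b.Holds s → Term N q s Q) : Term N (.ite b p q) s Q := by
  by_cases hb : b.Holds s
  · obtain ⟨s', t, h1, h2, h3⟩ := hp hb
    exact ⟨s', _, .iteTrue hb h1, by simp [stat]; omega, h3⟩
  · obtain ⟨s', t, h1, h2, h3⟩ := hq hb
    exact ⟨s', _, .iteFalse hb h1, by simp [stat]; omega, h3⟩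

/-- The invariant is indexed by the number of completed iterations. The demand i < N whenever the
guard holds replaces a termination measure and bounds the steps at the same time. -/
theorem loop_aux {b : Test} {p : Program} (I : ℕ → Memory → Prop)
    (hb : ∀ i s', I i s' → b.Holds s' → i < N ∧ Term N p s' (I (i + 1)))
    (hQ : ∀ i s', I i s' → ¬ b.Holds s' → Q s') (k i : ℕ) (s : Memory) (hk : N ≤ i + k)
    (h0 : I i s) :
    ∃ s' t, Exec (.loop b p) s s' t ∧ t ≤ k * (b.cost + (stat p).eval N) + b.cost ∧ Q s' := by
  induction k generalizing i s with
  | zero =>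
    have hn : ¬ b.Holds s := fun h => by have := (hb i s h0 h).1; omega
    exact ⟨s, _, .loopStop hn, by simp, hQ _ _ h0 hn⟩
  | succ k ih =>
    by_cases h : b.Holds s
    · obtain ⟨s', t, h1, h2, h3⟩ := (hb i s h0 h).2
      obtain ⟨s'', t', h4, h5, h6⟩ := ih (i + 1) s' (by omega) h3
      refine ⟨s'', _, .loopStep h h1 h4, ?_, h6⟩
      rw [Nat.succ_mul]; omega
    · exact ⟨s, _, .loopStop h, Nat.le_add_left _ _, hQ _ _ h0 h⟩

theorem loop {b : Test} {p : Program} (I : ℕ → Memory → Prop) (h0 : I 0 s)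
    (hb : ∀ i s', I i s' → b.Holds s' → i < N ∧ Term N p s' (I (i + 1)))
    (hQ : ∀ i s', I i s' → ¬ b.Holds s' → Q s') : Term N (.loop b p) s Q := by
  obtain ⟨s', t, h1, h2, h3⟩ := loop_aux I hb hQ N 0 s (by omega) h0
  refine ⟨s', t, h1, ?_, h3⟩
  simp only [stat, Polynomial.eval_mul, Polynomial.eval_add, Polynomial.eval_X,
    Polynomial.eval_one, Polynomial.eval_C]
  nlinarith

end Term

/-- For `x = 0, 1, …` below the value of variable `y` do `p`. -/
def Program.forLoop (x y : ℕ) (p : Program) : Program :=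
  .seq (.setVar x (.const 0)) (.loop (.intLt (.var x) (.var y))
    (.seq p (.setVar x (.add (.var x) (.const 1)))))

/-- The bound in variable y is read anew before each iteration, hence the requirement that the
invariant fixes its value. The body may use the counter but has to leave it at i. -/
theorem Term.forLoop {N : ℕ} {s : Memory} {Q : Memory → Prop} {x y : ℕ} {p : Program} (K : ℕ)
    (hK : K ≤ N) (I : ℕ → Memory → Prop) (h0 : I 0 (s.setVar x 0))
    (hy : ∀ i s', i ≤ K → I i s' → s'.var x = i → s'.var y = K)
    (hb : ∀ i s', i < K → I i s' → s'.var x = i →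
      Term N p s' fun s'' => s''.var x = i ∧ I (i + 1) (s''.setVar x (i + 1)))
    (hQ : ∀ s', I K s' → s'.var x = K → Q s') : Term N (.forLoop x y p) s Q := by
  refine .seq (.setVar (.loop (fun i s' => i ≤ K ∧ I i s' ∧ s'.var x = i) ?_ ?_ ?_))
  · exact ⟨Nat.zero_le _, h0, by simp [Memory.setVar, IntExpr.eval]⟩
  · rintro i s' ⟨hi, hI, hx⟩ h
    simp only [Test.Holds, IntExpr.eval, hx, hy i s' hi hI hx] at h
    refine ⟨by omega, .seq ((hb i s' h hI hx).mono ?_)⟩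
    rintro s'' ⟨hx', hI'⟩
    refine .setVar ?_
    simp only [IntExpr.eval, hx']
    exact ⟨h, hI', by simp [Memory.setVar]⟩
  · rintro i s' ⟨hi, hI, hx⟩ h
    simp only [Test.Holds, IntExpr.eval, hx, hy i s' hi hI hx] at h
    obtain rfl : i = K := by omega
    exact hQ s' hI hx

/-- `s'` agrees with `s` outside of the integer variables from `c` on, the integer arrays in `I`
and the real arrays in `R`. -/
structure Frame (c : ℕ) (I R : Finset ℕ) (s s' : Memory) : Prop where
  var : ∀ y < c, s'.var y = s.var y
  int : ∀ a ∉ I, s'.intArr a = s.intArr a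
  real : ∀ a ∉ R, s'.realArr a = s.realArr a

theorem Frame.refl (c : ℕ) (I R : Finset ℕ) (s : Memory) : Frame c I R s s :=
  ⟨fun _ _ => rfl, fun _ _ => rfl, fun _ _ => rfl⟩

/-- Programs use variables with larger numbers than those of the surrounding loops whose values must
survive. Frames therefore compose with side conditions on numerals only, which `decide` settles. -/
theorem Frame.trans {c c' : ℕ} {I R I' R' : Finset ℕ} {s s' s'' : Memory} (h : Frame c I R s s')
    (h' : Frame c' I' R' s' s'') (hc : c ≤ c' := by decide) (hI : I' ⊆ I := by decide)
    (hR : R' ⊆ R := by decide) : Frame c I R s s'' where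
  var y hy := (h'.var y (hy.trans_le hc)).trans (h.var y hy)
  int a ha := (h'.int a fun h => ha (hI h)).trans (h.int a ha)
  real a ha := (h'.real a fun h => ha (hR h)).trans (h.real a ha)

theorem Frame.setVar {c x k : ℕ} {I R : Finset ℕ} {s s' : Memory} (h : Frame c I R s s')
    (hx : c ≤ x := by decide) : Frame c I R s (s'.setVar x k) where
  var y hy := by
    rw [← h.var y hy]; exact Function.update_of_ne (by omega) _ _
  int := h.int
  real := h.real

theorem Frame.setInt {c a k l : ℕ} {I R : Finset ℕ} {s s' : Memory} (h : Frame c I R s s')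
    (ha : a ∈ I := by decide) : Frame c I R s (s'.setInt a k l) where
  var := h.var
  int b hb := by
    rw [← h.int b hb]; exact Function.update_of_ne (by rintro rfl; exact hb ha) _ _
  real := h.real

theorem Frame.setReal {c a k : ℕ} {l : ℝ} {I R : Finset ℕ} {s s' : Memory}
    (h : Frame c I R s s') (ha : a ∈ R := by decide) : Frame c I R s (s'.setReal a k l) where
  var := h.var
  int := h.int
  real b hb := by
    rw [← h.real b hb]; exact Function.update_of_ne (by rintro rfl; exact hb ha) _ _

/-! ### Reading from an updated memory -/

section access
variable (s : Memory) (x y a b k l c : ℕ) (z : ℝ)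

@[simp] theorem setVar_var : (s.setVar x c).var y = if y = x then c else s.var y := by
  simp [Memory.setVar, Function.update_apply]
@[simp] theorem setVar_intArr : (s.setVar x c).intArr = s.intArr := rfl
@[simp] theorem setVar_realArr : (s.setVar x c).realArr = s.realArr := rfl
@[simp] theorem setInt_var : (s.setInt a k c).var = s.var := rfl
@[simp] theorem setInt_realArr : (s.setInt a k c).realArr = s.realArr := rfl
@[simp] theorem setInt_intArr :
    (s.setInt a k c).intArr b = if b = a then Function.update (s.intArr a) k c else s.intArr b := by
  by_cases h : b = a
  · subst h; simp [Memory.setInt]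
  · simp [Memory.setInt, h]
@[simp] theorem setReal_var : (s.setReal a k z).var = s.var := rfl
@[simp] theorem setReal_intArr : (s.setReal a k z).intArr = s.intArr := rfl
@[simp] theorem setReal_realArr :
    (s.setReal a k z).realArr b =
      if b = a then Function.update (s.realArr a) k z else s.realArr b := by
  by_cases h : b = a
  · subst h; simp [Memory.setReal]
  · simp [Memory.setReal, h]
end access

/-! ### Greedy distribution -/

/-- The load of bundle `t` after the first `j` items, of weights `u`, have been put into the
bundles given by `f`. -/
noncomputable def load (u : ℕ → ℝ) (f : ℕ → ℕ) (j t : ℕ) : ℝ :=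
  ∑ i ∈ Finset.range j with f i = t, u i

/-- Each of the first `N` items goes to a bundle of minimum load. -/
def IsGreedy (u : ℕ → ℝ) (K N : ℕ) (f : ℕ → ℕ) : Prop :=
  ∀ j < N, f j < K ∧ ∀ t < K, load u f j (f j) ≤ load u f j t

/-- If one bundle of earlier items has less weight than another one, then it has still at most
its weight after adding the next item. -/
def NoOvershoot (u : ℕ → ℝ) (N : ℕ) : Prop :=
  ∀ j < N, ∀ X ⊆ Finset.range j, ∀ Y ⊆ Finset.range j,
    ∑ i ∈ X, u i < ∑ i ∈ Y, u i → ∑ i ∈ X, u i + u j ≤ ∑ i ∈ Y, u i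

variable {u : ℕ → ℝ} {f g : ℕ → ℕ} {K N : ℕ}

@[simp] theorem load_zero (t : ℕ) : load u f 0 t = 0 := by simp [load]

theorem load_succ (j t : ℕ) :
    load u f (j + 1) t = load u f j t + if f j = t then u j else 0 := by
  unfold load
  rw [Finset.range_add_one, Finset.filter_insert]
  split_ifs with h
  · rw [Finset.sum_insert (by simp), add_comm]
  · simp

theorem load_congr {u' : ℕ → ℝ} {f' : ℕ → ℕ} {j : ℕ} (hu : ∀ i < j, u' i = u i)
    (h : ∀ i < j, f' i = f i) (t : ℕ) : load u' f' j t = load u f j t := by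
  unfold load
  refine Finset.sum_congr (Finset.filter_congr fun i hi => ?_) fun i hi => ?_
  · rw [h i (Finset.mem_range.1 hi)]
  · exact hu i (Finset.mem_range.1 (Finset.mem_filter.1 hi).1)

theorem sum_load (j : ℕ) (h : ∀ i < j, f i < K) :
    ∑ t ∈ Finset.range K, load u f j t = ∑ i ∈ Finset.range j, u i :=
  Finset.sum_fiberwise_of_maps_to (fun i hi => by simpa using h i (by simpa using hi)) _

theorem load_mono (hu : ∀ i < N, 0 ≤ u i) {j k : ℕ} (hjk : j ≤ k) (hk : k ≤ N) (t : ℕ) :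
    load u f j t ≤ load u f k t := by
  refine Finset.sum_le_sum_of_subset_of_nonneg
    (Finset.filter_subset_filter _ (Finset.range_mono hjk)) fun i hi _ => hu i ?_
  have := Finset.mem_range.1 (Finset.mem_filter.1 hi).1
  omega

/-- The inductive step of `sum_excess_le`, for the loads `a` of the greedy bundles and the loads
`b` of other bundles of the same total weight. -/
theorem sum_excess_step {K : ℕ} {a b : ℕ → ℝ} {w : ℝ} (hw : 0 ≤ w)
    (hab : ∑ t ∈ Finset.range K, a t = ∑ t ∈ Finset.range K, b t)
    (hF : ∀ θ, ∑ t ∈ Finset.range K, max (a t - θ) 0 ≤ ∑ t ∈ Finset.range K, max (b t - θ) 0)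
    {t₀ t₁ : ℕ} (h₁ : t₁ < K) (hmin : ∀ t < K, a t₀ ≤ a t)
    (ha : ∀ t < K, a t₀ < a t → a t₀ + w ≤ a t)
    (hba : ∀ t < K, b t < a t₀ → b t + w ≤ a t₀)
    (hb : ∀ t < K, a t₀ < b t → a t₀ + w ≤ b t) (θ : ℝ) :
    ∑ t ∈ Finset.range K, max (a t - θ) 0 + (max (a t₀ + w - θ) 0 - max (a t₀ - θ) 0) ≤
      ∑ t ∈ Finset.range K, max (b t - θ) 0 + (max (b t₁ + w - θ) 0 - max (b t₁ - θ) 0) := by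
  set α := a t₀
  set β := b t₁
  have hα : α = a t₀ := rfl
  -- If the greedy bundle is no heavier than the other one, convexity of the excess in the load
  -- shows that its increment is no larger.
  rcases le_or_gt α β with h | h
  · have := hF θ
    have : max (α + w - θ) 0 - max (α - θ) 0 ≤ max (β + w - θ) 0 - max (β - θ) 0 := by
      rcases max_cases (α + w - θ) 0 with h1 | h1 <;> rcases max_cases (α - θ) 0 with h2 | h2 <;>
      rcases max_cases (β + w - θ) 0 with h3 | h3 <;> rcases max_cases (β - θ) 0 with h4 | h4 <;>
      linarith
    linarith
  have hβ : β + w ≤ α := hba t₁ h₁ h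
  rcases le_or_gt (α + w) θ with hθ | hθ
  · rw [max_eq_right (by linarith : α + w - θ ≤ 0), max_eq_right (by linarith : α - θ ≤ 0),
      max_eq_right (by linarith : β + w - θ ≤ 0), max_eq_right (by linarith : β - θ ≤ 0)]
    linarith [hF θ]
  -- below the minimum of `a`, the excess of `a` is the difference of the totals
  have key : ∀ θ ≤ α, β ≤ θ → ∑ t ∈ Finset.range K, max (a t - θ) 0 + (θ - β) ≤
      ∑ t ∈ Finset.range K, max (b t - θ) 0 := by
    intro θ hθ hβθ
    have e1 : ∑ t ∈ Finset.range K, max (a t - θ) 0 = ∑ t ∈ Finset.range K, (a t - θ) :=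
      Finset.sum_congr rfl fun t ht => max_eq_left (by
        linarith [hmin t (Finset.mem_range.1 ht)])
    have e2 : ∑ t ∈ Finset.range K, ((b t - θ) + if t = t₁ then θ - β else 0) ≤
        ∑ t ∈ Finset.range K, max (b t - θ) 0 := by
      refine Finset.sum_le_sum fun t _ => ?_
      split_ifs with h
      · subst h; exact (by simp [β] : _ = (0 : ℝ)).le.trans (le_max_right _ _)
      · simp
    rw [Finset.sum_add_distrib, Finset.sum_ite_eq' (Finset.range K) t₁,
      if_pos (Finset.mem_range.2 h₁)] at e2
    rw [e1]
    simp only [Finset.sum_sub_distrib] at e2 ⊢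
    linarith
  rcases le_or_gt θ α with hθα | hθα
  · rw [max_eq_left (by linarith : 0 ≤ α + w - θ), max_eq_left (by linarith : 0 ≤ α - θ)]
    rcases le_or_gt θ β with hθβ | hθβ
    · rw [max_eq_left (by linarith : 0 ≤ β + w - θ), max_eq_left (by linarith : 0 ≤ β - θ)]
      linarith [hF θ]
    · rw [max_eq_right (by linarith : β - θ ≤ 0)]
      rcases le_or_gt w (θ - β) with h' | h'
      · linarith [key θ hθα hθβ.le, le_max_right (β + w - θ) 0]
      · linarith [key θ hθα hθβ.le, le_max_left (β + w - θ) 0]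
  · rw [max_eq_left (by linarith : 0 ≤ α + w - θ), max_eq_right (by linarith : α - θ ≤ 0),
      max_eq_right (by linarith : β + w - θ ≤ 0), max_eq_right (by linarith : β - θ ≤ 0)]
    have hw' : 0 < w := by linarith
    set l := (θ - α) / w with hl
    have hθl : θ = α + l * w := by rw [hl]; field_simp; simp
    have hl0 : 0 ≤ l := by rw [hl]; exact div_nonneg (by linarith) hw
    have hl1 : 0 ≤ 1 - l := by
      rw [hl, sub_nonneg, div_le_one hw']; linarith
    -- No load lies strictly between α and α + w, so the total excess is an affine function of θ on
    -- this interval. The claim is interpolated between `key` at α and `hF` at α + w.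
    have lin : ∀ c : ℕ → ℝ, (∀ t < K, α < c t → α + w ≤ c t) →
        ∑ t ∈ Finset.range K, max (c t - θ) 0 =
          (1 - l) * ∑ t ∈ Finset.range K, max (c t - α) 0 +
            l * ∑ t ∈ Finset.range K, max (c t - (α + w)) 0 := by
      intro c hc
      rw [Finset.mul_sum, Finset.mul_sum, ← Finset.sum_add_distrib]
      refine Finset.sum_congr rfl fun t ht => ?_
      rcases le_or_gt (c t) α with h | h
      · rw [max_eq_right, max_eq_right, max_eq_right] <;> linarith
      · have := hc t (Finset.mem_range.1 ht) h
        rw [max_eq_left (by linarith), max_eq_left (by linarith), max_eq_left (by linarith)]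
        linear_combination -hθl
    rw [lin a ha, lin b hb]
    have k1 := mul_le_mul_of_nonneg_left (key α le_rfl h.le) hl1
    have k2 := mul_le_mul_of_nonneg_left (hF (α + w)) hl0
    have k3 : (1 - l) * w ≤ (1 - l) * (α - β) := mul_le_mul_of_nonneg_left (by linarith) hl1
    rw [mul_add] at k1
    have : α + w - θ = (1 - l) * w := by rw [hθl]; ring
    linarith

theorem sum_max_update {K : ℕ} (a : ℕ → ℝ) (w θ : ℝ) {t₀ : ℕ} (h₀ : t₀ < K) :
    ∑ t ∈ Finset.range K, max (a t + (if t₀ = t then w else 0) - θ) 0 =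
      ∑ t ∈ Finset.range K, max (a t - θ) 0 + (max (a t₀ + w - θ) 0 - max (a t₀ - θ) 0) := by
  have : ∀ t ∈ Finset.range K, max (a t + (if t₀ = t then w else 0) - θ) 0 =
      max (a t - θ) 0 + if t₀ = t then (max (a t₀ + w - θ) 0 - max (a t₀ - θ) 0) else 0 := by
    intro t _
    split_ifs with h
    · subst h; ring
    · simp
  rw [Finset.sum_congr rfl this, Finset.sum_add_distrib, Finset.sum_ite_eq,
    if_pos (Finset.mem_range.2 h₀)]

/-- Greedy loads are majorized by the loads of any other distribution. -/
theorem sum_excess_le (hu : ∀ i < N, 0 ≤ u i) (hno : NoOvershoot u N) (hf : IsGreedy u K N f)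
    (hg : ∀ i < N, g i < K) (θ : ℝ) :
    ∑ t ∈ Finset.range K, max (load u f N t - θ) 0 ≤
      ∑ t ∈ Finset.range K, max (load u g N t - θ) 0 := by
  suffices H : ∀ j ≤ N, ∀ θ, ∑ t ∈ Finset.range K, max (load u f j t - θ) 0 ≤
      ∑ t ∈ Finset.range K, max (load u g j t - θ) 0 from H N le_rfl θ
  intro j
  induction j with
  | zero => intro _ θ; simp
  | succ j ih =>
    intro hj θ
    simp only [load_succ]
    rw [sum_max_update _ _ _ (hf j hj).1, sum_max_update _ _ _ (hg j hj)]
    have no : ∀ f g : ℕ → ℕ, ∀ s t, load u f j s < load u g j t →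
        load u f j s + u j ≤ load u g j t := fun f g s t h =>
      hno j hj _ (Finset.filter_subset _ _) _ (Finset.filter_subset _ _) h
    refine sum_excess_step (hu j hj) ?_ (ih (by omega)) (hg j hj) (hf j hj).2
      (fun t _ => no _ _ _ _) (fun t _ => no _ _ _ _) (fun t _ => no _ _ _ _) θ
    rw [sum_load j fun i hi => (hf i (by omega)).1, sum_load j fun i hi => hg i (by omega)]

/-- A greedy distribution maximizes the minimum load. -/
theorem IsGreedy.le_load (hu : ∀ i < N, 0 ≤ u i) (hno : NoOvershoot u N) (hf : IsGreedy u K N f)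
    (hg : ∀ i < N, g i < K) {μ : ℝ} (hμ : ∀ t < K, μ ≤ load u g N t) :
    ∀ t < K, μ ≤ load u f N t := by
  have h := sum_excess_le hu hno hf hg μ
  have e1 : ∑ t ∈ Finset.range K, max (load u g N t - μ) 0 =
      ∑ t ∈ Finset.range K, (load u g N t - μ) :=
    Finset.sum_congr rfl fun t ht => max_eq_left (by linarith [hμ t (Finset.mem_range.1 ht)])
  have e2 : ∑ t ∈ Finset.range K, (load u g N t - μ) =
      ∑ t ∈ Finset.range K, (load u f N t - μ) := by
    rw [Finset.sum_sub_distrib, Finset.sum_sub_distrib, sum_load N hg,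
      sum_load N fun i hi => (hf i hi).1]
  rw [e1, e2] at h
  intro t ht
  -- The excess of g over μ is the total weight minus K * μ, which is also the sum of all load u f N
  -- t - μ. A load of f below μ would make the excess of f strictly larger than this sum.
  by_contra hc
  refine absurd h (not_le.2 (Finset.sum_lt_sum (fun t _ => le_max_left _ _)
    ⟨t, Finset.mem_range.2 ht, ?_⟩))
  exact lt_of_lt_of_le (by linarith) (le_max_right _ _)

/-- A greedy distribution minimizes the maximum load. -/
theorem IsGreedy.load_le (hu : ∀ i < N, 0 ≤ u i) (hno : NoOvershoot u N) (hf : IsGreedy u K N f)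
    (hg : ∀ i < N, g i < K) {μ : ℝ} (hμ : ∀ t < K, load u g N t ≤ μ) :
    ∀ t < K, load u f N t ≤ μ := by
  have h := sum_excess_le hu hno hf hg μ
  -- Nothing exceeds μ under g, so by majorization nothing does under f.
  rw [Finset.sum_eq_zero (s := Finset.range K) (f := fun t => max (load u g N t - μ) 0) fun t ht =>
    max_eq_right (by linarith [hμ t (Finset.mem_range.1 ht)])] at h
  intro t ht
  have := (Finset.single_le_sum (fun t _ => le_max_right (load u f N t - μ) 0)
    (Finset.mem_range.2 ht)).trans h
  linarith [le_max_left (load u f N t - μ) 0]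

/-- This makes it possible to compare a greedy prefix, such as some rounds of a round robin, with
the optimum for all N items. -/
theorem IsGreedy.exists_extend (hK : 0 < K) {c : ℕ} (hc : c ≤ N) (hf : IsGreedy u K c f) :
    ∃ g, IsGreedy u K N g ∧ ∀ i < c, g i = f i := by
  induction N, hc using Nat.le_induction with
  | base => exact ⟨f, hf, fun _ _ => rfl⟩
  | succ N hN ih =>
    obtain ⟨g, hg, hgf⟩ := ih
    obtain ⟨t, ht, hmin⟩ := (Finset.range K).exists_min_image (load u g N) ⟨0, by simpa using hK⟩
    have hu : ∀ j ≤ N, ∀ t', load u (Function.update g N t) j t' = load u g j t' := fun j hj t' =>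
      load_congr (fun _ _ => rfl) (fun i hi => Function.update_of_ne (by omega) _ _) t'
    refine ⟨Function.update g N t, fun j hj => ?_, fun i hi => ?_⟩
    · rcases Nat.lt_succ_iff_lt_or_eq.1 hj with h | rfl
      · rw [Function.update_of_ne (by omega)]
        refine ⟨(hg j h).1, fun t' ht' => ?_⟩
        rw [hu j h.le, hu j h.le]
        exact (hg j h).2 t' ht'
      · rw [Function.update_self]
        refine ⟨Finset.mem_range.1 ht, fun t' ht' => ?_⟩
        rw [hu j le_rfl, hu j le_rfl]
        exact hmin t' (Finset.mem_range.2 ht')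
    · rw [Function.update_of_ne (by omega), hgf i hi]

/-! ### Lexicographic and two-valued weights -/

/-- Every weight is positive and larger than the sum of all smaller ones. -/
def LexOn (u : ℕ → ℝ) (N : ℕ) : Prop :=
  ∀ j < N, 0 < u j ∧ ∑ i ∈ Finset.range N with u i < u j, u i < u j

/-- The first `N` weights are in decreasing order. -/
def DecreasingOn (u : ℕ → ℝ) (N : ℕ) : Prop := ∀ i j, i ≤ j → j < N → u j ≤ u i

variable {u : ℕ → ℝ} {f g : ℕ → ℕ} {K N : ℕ}

theorem sum_filter_congr_of_card {X Y : Finset ℕ} (p : ℝ → Prop) [DecidablePred p]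
    (h : ∀ ω, p ω → (X.filter fun i => u i = ω).card = (Y.filter fun i => u i = ω).card) :
    ∑ i ∈ X with p (u i), u i = ∑ i ∈ Y with p (u i), u i := by
  have key : ∀ Z ⊆ X ∪ Y, ∑ i ∈ Z with p (u i), u i =
      ∑ ω ∈ ((X ∪ Y).image u).filter p, (Z.filter fun i => u i = ω).card • ω := by
    intro Z hZ
    rw [← Finset.sum_fiberwise_of_maps_to (s := Z.filter fun i => p (u i))
      (t := ((X ∪ Y).image u).filter p) (g := u)]
    · refine Finset.sum_congr rfl fun ω hω => ?_
      rw [← Finset.sum_const, Finset.filter_filter]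
      have : (Z.filter fun i => p (u i) ∧ u i = ω) = Z.filter fun i => u i = ω :=
        Finset.filter_congr fun i _ =>
          ⟨fun h => h.2, fun h => ⟨h ▸ (Finset.mem_filter.1 hω).2, h⟩⟩
      rw [this]
      exact Finset.sum_congr rfl fun i hi => (Finset.mem_filter.1 hi).2
    · intro i hi
      simp only [Finset.mem_filter] at hi ⊢
      exact ⟨Finset.mem_image_of_mem u (hZ hi.1), hi.2⟩
  rw [key X Finset.subset_union_left, key Y Finset.subset_union_right]
  exact Finset.sum_congr rfl fun ω hω => by rw [h ω (Finset.mem_filter.1 hω).2]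

theorem sum_split_value (X : Finset ℕ) (ω : ℝ) :
    ∑ i ∈ X, u i = ∑ i ∈ X with ω < u i, u i + (X.filter fun i => u i = ω).card * ω +
      ∑ i ∈ X with u i < ω, u i := by
  have h1 := Finset.sum_filter_add_sum_filter_not X (fun i => ω < u i) u
  have h2 := Finset.sum_filter_add_sum_filter_not (X.filter fun i => ¬ ω < u i)
    (fun i => u i = ω) u
  have h3 : ∑ i ∈ X with ¬ω < u i ∧ u i = ω, u i = (X.filter fun i => u i = ω).card * ω := by
    rw [← nsmul_eq_mul, ← Finset.sum_const]
    exact Finset.sum_congr (Finset.filter_congr fun i _ =>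
      ⟨fun h => h.2, fun h => ⟨by simp [h], h⟩⟩) fun i hi => (Finset.mem_filter.1 hi).2
  have h4 : ∑ i ∈ X with ¬ω < u i ∧ ¬u i = ω, u i = ∑ i ∈ X with u i < ω, u i :=
    Finset.sum_congr (Finset.filter_congr fun i _ =>
      ⟨fun h => lt_of_le_of_ne (not_lt.1 h.1) h.2, fun h => ⟨h.not_gt, h.ne⟩⟩) fun _ _ => rfl
  rw [Finset.filter_filter, Finset.filter_filter, h3, h4] at h2
  linarith

/-- Compare X and Y at the largest weight that they contain with different multiplicities. Above it
they agree, and below it neither can make up for one copy of that weight, even together with item j.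
So Y has more copies, and enough room for u j. -/
theorem LexOn.noOvershoot (hl : LexOn u N) (hd : DecreasingOn u N) : NoOvershoot u N := by
  intro j hj X hX Y hY hlt
  classical
  have hXj : ∀ i ∈ X ∪ Y, i < j := fun i hi =>
    Finset.mem_range.1 (Finset.union_subset hX hY hi)
  set V := ((X ∪ Y).image u).filter fun ω =>
    (X.filter fun i => u i = ω).card ≠ (Y.filter fun i => u i = ω).card with hV
  have hne : V.Nonempty := by
    by_contra hempty
    refine hlt.ne ?_
    have := sum_filter_congr_of_card (u := u) (X := X) (Y := Y) (fun _ => True) fun ω _ => by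
      by_contra hc
      have h0 : ω ∉ (X ∪ Y).image u := fun hω =>
        hempty ⟨ω, Finset.mem_filter.2 ⟨hω, hc⟩⟩
      refine hc ?_
      rw [Finset.filter_false_of_mem, Finset.filter_false_of_mem]
      · exact fun i hi h => h0 (h ▸ Finset.mem_image_of_mem u (Finset.mem_union_right _ hi))
      · exact fun i hi h => h0 (h ▸ Finset.mem_image_of_mem u (Finset.mem_union_left _ hi))
    simpa using this
  obtain ⟨ω, hω, hmax⟩ := V.exists_max_image id hne
  obtain ⟨hωi, hcard⟩ := Finset.mem_filter.1 hω
  obtain ⟨z, hz, rfl⟩ := Finset.mem_image.1 hωi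
  have hgt : ∑ i ∈ X with u z < u i, u i = ∑ i ∈ Y with u z < u i, u i :=
    sum_filter_congr_of_card (fun ω => u z < ω) fun ω hω' => by
      by_contra hc
      by_cases h0 : ω ∈ (X ∪ Y).image u
      · exact absurd (hmax ω (Finset.mem_filter.2 ⟨h0, hc⟩)) (not_le.2 hω')
      · refine hc ?_
        rw [Finset.filter_false_of_mem, Finset.filter_false_of_mem]
        · exact fun i hi h => h0 (h ▸ Finset.mem_image_of_mem u (Finset.mem_union_right _ hi))
        · exact fun i hi h => h0 (h ▸ Finset.mem_image_of_mem u (Finset.mem_union_left _ hi))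
  have hzj := hXj z hz
  obtain ⟨hz0, hzl⟩ := hl z (hzj.trans hj)
  -- Either u j is itself smaller than u z and enters the sum of the smaller weights, or it equals u
  -- z and, by the decreasing order, nothing before j is smaller.
  have small : ∀ Z ⊆ Finset.range j, 0 ≤ ∑ i ∈ Z with u i < u z, u i ∧
      ∑ i ∈ Z with u i < u z, u i + u j ≤ u z := by
    intro Z hZ
    have hZ' : ∀ i ∈ Z, i < j := fun i hi => Finset.mem_range.1 (hZ hi)
    refine ⟨Finset.sum_nonneg fun i hi =>
      (hl i ((hZ' i (Finset.mem_filter.1 hi).1).trans hj)).1.le, ?_⟩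
    rcases (hd z j hzj.le hj).lt_or_eq with h | h
    · have : insert j (Z.filter fun i => u i < u z) ⊆
          (Finset.range N).filter fun i => u i < u z := by
        intro i hi
        rcases Finset.mem_insert.1 hi with rfl | hi
        · simpa using ⟨hj, h⟩
        · have := hZ' i (Finset.mem_filter.1 hi).1
          simpa using ⟨this.trans hj, (Finset.mem_filter.1 hi).2⟩
      have h2 := Finset.sum_le_sum_of_subset_of_nonneg this
        fun i hi _ => (hl i (Finset.mem_range.1 (Finset.mem_filter.1 hi).1)).1.le
      rw [Finset.sum_insert fun h => (hZ' j (Finset.mem_filter.1 h).1).false] at h2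
      linarith
    · rw [Finset.filter_false_of_mem, h]
      · simp
      · intro i hi h'
        have := hd i j (hZ' i hi).le hj
        linarith
  obtain ⟨hX0, hX1⟩ := small X hX
  obtain ⟨hY0, hY1⟩ := small Y hY
  have sX := sum_split_value (u := u) X (u z)
  have sY := sum_split_value (u := u) Y (u z)
  have hj0 := (hl j hj).1
  rcases lt_or_gt_of_ne hcard with h | h
  · have : ((X.filter fun i => u i = u z).card : ℝ) + 1 ≤ (Y.filter fun i => u i = u z).card := by
      exact_mod_cast h
    nlinarith
  · have : ((Y.filter fun i => u i = u z).card : ℝ) + 1 ≤ (X.filter fun i => u i = u z).card := by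
      exact_mod_cast h
    nlinarith

/-- The weights are `c` and `q` times `c`, where `ω` gives the multiples. -/
structure TwoValuedOn (u : ℕ → ℝ) (N : ℕ) (c : ℝ) (q : ℕ) (ω : ℕ → ℕ) : Prop where
  pos : 0 < c
  one_lt : 1 < q
  eq : ∀ i < N, u i = c * ω i
  values : ∀ i < N, ω i = 1 ∨ ω i = q
  anti : ∀ i j, i ≤ j → j < N → ω j ≤ ω i

/-- If the next weight is the small one, integrality suffices. If it is the large one, then so are
all earlier weights, and the sums differ by a multiple of it. -/
theorem TwoValuedOn.noOvershoot {c : ℝ} {q : ℕ} {ω : ℕ → ℕ} (h : TwoValuedOn u N c q ω) :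
    NoOvershoot u N := by
  intro j hj X hX Y hY hlt
  have hs : ∀ Z ⊆ Finset.range j, ∑ i ∈ Z, u i = c * (∑ i ∈ Z, ω i : ℕ) := fun Z hZ => by
    rw [Nat.cast_sum, Finset.mul_sum]
    exact Finset.sum_congr rfl fun i hi => h.eq i ((Finset.mem_range.1 (hZ hi)).trans hj)
  rw [hs X hX, hs Y hY, h.eq j hj] at *
  have h1 : ∑ i ∈ X, ω i < ∑ i ∈ Y, ω i := by
    exact_mod_cast lt_of_mul_lt_mul_left hlt h.pos.le
  have h2 : ∑ i ∈ X, ω i + ω j ≤ ∑ i ∈ Y, ω i := by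
    rcases h.values j hj with hv | hv
    · omega
    · have hq : ∀ Z ⊆ Finset.range j, ∑ i ∈ Z, ω i = Z.card * q := fun Z hZ => by
        rw [← smul_eq_mul, ← Finset.sum_const]
        refine Finset.sum_congr rfl fun i hi => ?_
        have hi := Finset.mem_range.1 (hZ hi)
        have := h.anti i j hi.le hj
        have := h.one_lt
        rcases h.values i (hi.trans hj) with h' | h' <;> omega
      rw [hq X hX, hq Y hY, hv] at *
      have := Nat.lt_of_mul_lt_mul_right h1
      rw [← Nat.succ_mul]
      exact Nat.mul_le_mul_right _ this
  rw [← mul_add]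
  exact mul_le_mul_of_nonneg_left (by exact_mod_cast h2) h.pos.le

/-! ### Round robin -/

/-- The weight of bundle `t` after `j` items have been dealt out in turn to `K` bundles. -/
noncomputable abbrev robin (u : ℕ → ℝ) (K j t : ℕ) : ℝ := load u (· % K) j t

theorem robin_eq (i : ℕ) {r t : ℕ} (hr : r ≤ K) (ht : t < K) :
    robin u K (i * K + r) t =
      ∑ i' ∈ Finset.range i, u (i' * K + t) + if t < r then u (i * K + t) else 0 := by
  have step : ∀ i, robin u K (i * K) t = ∑ i' ∈ Finset.range i, u (i' * K + t) → ∀ r ≤ K,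
      robin u K (i * K + r) t =
        ∑ i' ∈ Finset.range i, u (i' * K + t) + if t < r then u (i * K + t) else 0 := by
    intro i hi r hr
    induction r with
    | zero => simpa using hi
    | succ r ih =>
      have hm : (i * K + r) % K = r := by
        exact Nat.mul_add_mod_of_lt (by omega)
      rw [robin, ← add_assoc, load_succ, ← robin, ih (by omega), hm, add_assoc]
      congr 1
      by_cases h1 : t < r
      · rw [if_pos h1, if_neg (by omega), if_pos (by omega), add_zero]
      · by_cases h2 : r = t
        · subst h2; simp
        · rw [if_neg h1, if_neg h2, if_neg (by omega), add_zero]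
  refine step i ?_ r hr
  clear hr
  induction i with
  | zero => simp [robin]
  | succ i ih =>
    rw [Nat.succ_mul, step i ih K le_rfl, if_pos ht, Finset.sum_range_succ]

theorem robin_round (i : ℕ) {t : ℕ} (ht : t < K) :
    robin u K ((i + 1) * K) t = ∑ i' ∈ Finset.range i, u (i' * K + t) + u (i * K + t) := by
  rw [Nat.succ_mul, robin_eq i le_rfl ht, if_pos ht]

theorem robin_le_zero (hd : DecreasingOn u N) (hu : ∀ i < N, 0 ≤ u i) (hK : 0 < K) {j t : ℕ}
    (hj : j ≤ N) (ht : t < K) : robin u K j t ≤ robin u K j 0 := by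
  have hjm := Nat.div_add_mod' j K
  have hlt := Nat.mod_lt j hK
  rw [← hjm, robin_eq _ hlt.le ht, robin_eq _ hlt.le hK]
  refine add_le_add (Finset.sum_le_sum fun i hi => hd _ _ (by omega) ?_) ?_
  · have := Nat.mul_le_mul_right K (Finset.mem_range.1 hi)
    rw [Nat.succ_mul] at this
    omega
  · split_ifs with h1 h2 h2
    · exact hd _ _ (by omega) (by omega)
    · omega
    · exact hu _ (by omega)
    · exact le_rfl

/-- Bundle 0 takes the largest item of each round, so it is a heaviest bundle and weighs at least
the average. -/
theorem sum_le_mul_robin (hd : DecreasingOn u N) (hu : ∀ i < N, 0 ≤ u i) (hK : 0 < K) :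
    ∑ i ∈ Finset.range N, u i ≤ K * robin u K N 0 := by
  rw [← sum_load (f := (· % K)) (K := K) N fun i _ => Nat.mod_lt i hK]
  refine (Finset.sum_le_card_nsmul _ _ _ fun t ht =>
    robin_le_zero hd hu hK le_rfl (Finset.mem_range.1 ht)).trans ?_
  simp

/-- Items of one round have the same weight. -/
def LevelRound (u : ℕ → ℝ) (K i : ℕ) : Prop := u (i * K + (K - 1)) = u (i * K)

theorem LevelRound.eq (hd : DecreasingOn u N) {i t : ℕ} (h : LevelRound u K i)
    (hi : (i + 1) * K ≤ N) (ht : t < K) : u (i * K + t) = u (i * K) := by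
  rw [Nat.succ_mul] at hi
  refine le_antisymm (hd _ _ (by omega) (by omega)) ?_
  rw [← h]
  exact hd _ _ (by omega) (by omega)

/-- After level rounds all bundles are equal, and inside a round the next bundle in turn has not yet
received its item. Only rounds that are followed by a further item below c have to be level, hence
the strict inequality in `hlev`. -/
theorem isGreedy_robin (hd : DecreasingOn u N) (hu : ∀ i < N, 0 ≤ u i) (hK : 0 < K) {c : ℕ}
    (hc : c ≤ N) (hlev : ∀ i, (i + 1) * K < c → LevelRound u K i) : IsGreedy u K c (· % K) := by
  intro j hj
  refine ⟨Nat.mod_lt j hK, fun t ht => ?_⟩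
  change robin u K j (j % K) ≤ robin u K j t
  have hjm := Nat.div_add_mod' j K
  have hlt := Nat.mod_lt j hK
  set i := j / K
  set r := j % K
  rw [← hjm, robin_eq _ hlt.le ht, robin_eq _ hlt.le hlt, if_neg (lt_irrefl _), add_zero]
  have : ∀ i' ∈ Finset.range i, ∀ t < K, u (i' * K + t) = u (i' * K) := fun i' hi' t ht => by
    have h' := Nat.mul_le_mul_right K (Finset.mem_range.1 hi')
    exact (hlev i' (by simp only [Nat.succ_eq_add_one] at h'; omega)).eq hd
      (by simp only [Nat.succ_eq_add_one] at h'; omega) ht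
  rw [Finset.sum_congr rfl fun i' hi' => this i' hi' r hlt,
    Finset.sum_congr rfl fun i' hi' => this i' hi' t ht]
  have : 0 ≤ if t < r then u (i * K + t) else 0 := by
    split_ifs with h
    · exact hu _ (by omega)
    · exact le_rfl
  linarith

/-- In a round that is not level, the last item and all later ones are strictly smaller than the
first item, which outweighs them together. -/
theorem LexOn.tail_lt (hl : LexOn u N) (hd : DecreasingOn u N) (hK : 0 < K) {i : ℕ}
    (hi : (i + 1) * K ≤ N) (h : ¬ LevelRound u K i) :
    u (i * K + (K - 1)) + ∑ j ∈ Finset.Ico ((i + 1) * K) N, u j < u (i * K) := by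
  have e : i * K + (K - 1) + 1 = (i + 1) * K := by rw [Nat.succ_mul]; omega
  have hlt : u (i * K + (K - 1)) < u (i * K) :=
    lt_of_le_of_ne (hd _ _ (by omega) (by omega)) h
  rw [← e, ← Finset.sum_eq_sum_Ico_succ_bot (by omega)]
  refine lt_of_le_of_lt (Finset.sum_le_sum_of_subset_of_nonneg ?_ fun j hj _ => ?_)
    (hl (i * K) (by omega)).2
  · intro j hj
    rw [Finset.mem_Ico] at hj
    simp only [Finset.mem_filter, Finset.mem_range]
    exact ⟨hj.2, (hd _ _ hj.1 hj.2).trans_lt hlt⟩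
  · exact (hl j (Finset.mem_range.1 (Finset.mem_filter.1 hj).1)).1.le

/-- The first unlevel round, if a round satisfying `p` is unlevel. -/
theorem exists_first_unlevel {p : ℕ → Prop} (hp : ∀ i j, i ≤ j → p j → p i)
    (h : ¬ ∀ i, p i → LevelRound u K i) :
    ∃ i, p i ∧ ¬ LevelRound u K i ∧ ∀ j < i, LevelRound u K j := by
  classical
  push Not at h
  obtain ⟨h1, h2⟩ := Nat.find_spec h
  exact ⟨_, h1, h2, fun j hj => by
    by_contra hc
    exact Nat.find_min h hj ⟨hp _ _ hj.le h1, hc⟩⟩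

theorem load_le_add_Ico (hu : ∀ i < N, 0 ≤ u i) {c t : ℕ} (hc : c ≤ N) :
    load u f N t ≤ load u f c t + ∑ j ∈ Finset.Ico c N, u j := by
  unfold load
  simp only [Finset.sum_filter]
  rw [Finset.range_eq_Ico, Finset.range_eq_Ico, ← Finset.sum_Ico_consecutive _ (Nat.zero_le _) hc]
  refine add_le_add le_rfl (Finset.sum_le_sum fun j hj => ?_)
  split_ifs
  · exact le_rfl
  · exact hu j (Finset.mem_Ico.1 hj).2

/-- If the first bundle of a round robin is not yet worth `μ` before its last item, then there is an
optimal distribution one of whose bundles contains it. -/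
theorem LexOn.exists_of_robin_lt (hl : LexOn u N) (hd : DecreasingOn u N) (hK : 0 < K) {μ : ℝ}
    (hg : ∀ i < N, g i < K) (hμ : ∀ t < K, μ ≤ load u g N t) {c c' : ℕ} (hc : c ≤ N)
    (hc' : c' ≤ N) (hcc : c' ≤ c + 1) (hlt : robin u K c 0 < μ) :
    ∃ f, (∀ i < N, f i < K) ∧ (∀ i < c', f i = i % K) ∧ ∀ t < K, μ ≤ load u f N t := by
  have hu : ∀ i < N, 0 ≤ u i := fun i hi => (hl i hi).1.le
  have hno := hl.noOvershoot hd
  by_cases hlev : ∀ i, (i + 1) * K < c' → LevelRound u K i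
  · obtain ⟨f, hf, hfr⟩ := (isGreedy_robin hd hu hK hc' hlev).exists_extend hK hc'
    exact ⟨f, fun i hi => (hf i hi).1, hfr, hf.le_load hu hno hg hμ⟩
  -- Play the round robin through the first unlevel round and continue greedily. The last bundle
  -- must reach μ, although after the level rounds it gets at most the last item of this round and
  -- all later ones. These weigh less than the item that bundle 0 gets in this round, so bundle 0
  -- has reached μ too early.
  exfalso
  obtain ⟨i, hi, hun, hmin⟩ := exists_first_unlevel (p := fun i => (i + 1) * K < c')
    (fun i j hij h => lt_of_le_of_lt (Nat.mul_le_mul_right K (by omega)) h) hlev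
  have hiN : (i + 1) * K ≤ N := by omega
  obtain ⟨f, hf, hfr⟩ := (isGreedy_robin hd hu hK hiN fun j hj =>
    hmin j (by have := Nat.lt_of_mul_lt_mul_right hj; omega)).exists_extend hK hiN
  have h1 := hf.le_load hu hno hg hμ (K - 1) (by omega)
  have h2 := load_le_add_Ico (f := f) (t := K - 1) hu hiN
  rw [load_congr (fun _ _ => rfl) hfr] at h2
  have h3 := hl.tail_lt hd hK hiN hun
  have h4 := robin_round (u := u) i (show K - 1 < K by omega)
  have h5 := robin_eq (u := u) i (show 1 ≤ K by omega) hK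
  have h6 := load_mono (f := (· % K)) hu (j := i * K + 1) (k := c)
    (by rw [Nat.succ_mul] at hi; omega) hc 0
  rw [if_pos Nat.one_pos] at h5
  have h7 : ∑ i' ∈ Finset.range i, u (i' * K + (K - 1)) = ∑ i' ∈ Finset.range i, u (i' * K + 0) :=
    Finset.sum_congr rfl fun j hj => hmin j (Finset.mem_range.1 hj)
  change robin u K _ _ ≤ robin u K _ _ at h6
  change _ ≤ robin u K _ _ + _ at h2
  simp only [add_zero] at *
  linarith

/-- If the first bundle of a round robin has no further item, or would be worth more than `μ` with
the next one, then the remaining items can be distributed to the other bundles. -/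
theorem LexOn.exists_of_lt_robin (hl : LexOn u N) (hd : DecreasingOn u N) (hK : 1 < K) {μ : ℝ}
    (hg : ∀ i < N, g i < K) (hμ : ∀ t < K, load u g N t ≤ μ) {c c' : ℕ} (hc : c ≤ N)
    (hc' : c' ≤ N) (hcc : c' ≤ c + 1) (hlt : c = N ∨ μ < robin u K c' 0) :
    ∃ f, (∀ i < N, f i < K) ∧ (∀ i < N, f i = 0 → i < c ∧ i % K = 0) ∧
      ∀ t < K, 0 < t → load u f N t ≤ μ := by
  have hu : ∀ i < N, 0 ≤ u i := fun i hi => (hl i hi).1.le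
  have hno := hl.noOvershoot hd
  have hK0 : 0 < K := by omega
  by_cases hlev : ∀ i, (i + 1) * K ≤ N ∧ i * K < c → LevelRound u K i
  · rcases hlt with rfl | hlt
    · have hf := isGreedy_robin hd hu hK0 le_rfl fun i hi =>
        hlev i ⟨hi.le, by rw [Nat.succ_mul] at hi; omega⟩
      exact ⟨_, fun i hi => (hf i hi).1, fun i hi h => ⟨hi, h⟩,
        fun t ht _ => hf.load_le hu hno hg hμ t ht⟩
    · exfalso
      obtain ⟨f, hf, hfr⟩ := (isGreedy_robin hd hu hK0 hc' fun i hi =>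
        hlev i ⟨by omega, by rw [Nat.succ_mul] at hi; omega⟩).exists_extend hK0 hc'
      have h1 := hf.load_le hu hno hg hμ 0 hK0
      have h2 := load_mono (f := f) hu hc' le_rfl 0
      rw [load_congr (fun _ _ => rfl) hfr] at h2
      change robin u K c' 0 ≤ _ at h2
      linarith
  obtain ⟨i, ⟨hi, hic⟩, hun, hmin⟩ := exists_first_unlevel
    (p := fun i => (i + 1) * K ≤ N ∧ i * K < c) (fun i j hij h =>
      ⟨(Nat.mul_le_mul_right K (by omega)).trans h.1,
        lt_of_le_of_lt (Nat.mul_le_mul_right K hij) h.2⟩) hlev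
  have hlast : robin u K ((i + 1) * K) 0 ≤ μ := by
    obtain ⟨f, hf, hfr⟩ := (isGreedy_robin hd hu hK0 hi fun j hj =>
      hmin j (by have := Nat.lt_of_mul_lt_mul_right hj; omega)).exists_extend hK0 hi
    have h1 := hf.load_le hu hno hg hμ 0 hK0
    have h2 := load_mono (f := f) hu hi le_rfl 0
    rw [load_congr (fun _ _ => rfl) hfr] at h2
    exact h2.trans h1
  -- The witness is the round robin through the first unlevel round, followed by giving everything
  -- else to the last bundle. The latter stays lighter than bundle 0 by `LexOn.tail_lt`, and bundle
  -- 0 is at most μ at that time by `hlast`.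
  set C := (i + 1) * K with hC
  have hf : ∀ j, (if j < C then j % K else K - 1) < K := fun j => by
    have := Nat.mod_lt j hK0
    split_ifs <;> omega
  refine ⟨fun j => if j < C then j % K else K - 1, fun j _ => hf j, fun j _ h => ?_,
    fun t ht ht0 => ?_⟩
  · simp only at h
    split_ifs at h with hj
    · refine ⟨?_, h⟩
      obtain ⟨k, rfl⟩ := Nat.dvd_of_mod_eq_zero h
      rw [hC, mul_comm] at hj
      have := Nat.lt_of_mul_lt_mul_right hj
      rw [mul_comm]
      exact lt_of_le_of_lt (Nat.mul_le_mul_right K (by omega)) hic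
    · omega
  set f : ℕ → ℕ := fun j => if j < C then j % K else K - 1
  have hfC : load u f C t = robin u K C t :=
    load_congr (fun _ _ => rfl) (fun j hj => if_pos hj) t
  have h3 := hl.tail_lt hd hK0 hi hun
  rcases Nat.lt_or_ge t (K - 1) with h | h
  · have : load u f N t = load u f C t := by
      unfold load
      refine (Finset.sum_subset (Finset.filter_subset_filter _ (Finset.range_mono hi))
        fun j hj hj' => ?_).symm
      simp only [Finset.mem_filter, Finset.mem_range, not_and] at hj hj'
      have : C ≤ j := by
        by_contra hc
        exact hj' (by omega) hj.2
      have h' := hj.2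
      simp only [f, if_neg (not_lt.2 this)] at h'
      omega
    rw [this, hfC]
    exact (robin_le_zero hd hu hK0 hi ht).trans hlast
  · obtain rfl : t = K - 1 := by omega
    have h2 := load_le_add_Ico (f := f) (t := K - 1) hu hi
    have h5 := robin_round (u := u) i hK0
    have h6 := robin_round (u := u) i ht
    have h7 : ∑ i' ∈ Finset.range i, u (i' * K + (K - 1)) =
        ∑ i' ∈ Finset.range i, u (i' * K + 0) :=
      Finset.sum_congr rfl fun j hj => hmin j (Finset.mem_range.1 hj)
    rw [hfC] at h2
    simp only [add_zero] at *
    linarith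

/-! ### Removing every `K`-th free slot -/

/-- The first of every `K` consecutive elements of `R`, as far as they are below `c`. -/
def heads (R : Finset ℕ) (K c : ℕ) : Finset ℕ :=
  R.filter fun s => s < c ∧ Nat.count (· ∈ R) s % K = 0

/-! ### Consecutive numbering of the free slots -/

section transfer
variable {M : Type*} [AddCommMonoid M] (R : Finset ℕ)

theorem card_toFinset_mem (hf : {s | s ∈ R}.Finite) : hf.toFinset.card = R.card := by
  congr 1; ext; simp

theorem count_lt_card {R : Finset ℕ} {s : ℕ} (hs : s ∈ R) : Nat.count (· ∈ R) s < R.card := by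
  rw [Nat.count_eq_card_filter_range]
  exact Finset.card_lt_card ⟨fun i hi => (Finset.mem_filter.1 hi).2, fun h => by
    have := h hs; simp at this⟩

theorem nth_mem_of_lt {R : Finset ℕ} {j : ℕ} (hj : j < R.card) : Nat.nth (· ∈ R) j ∈ R :=
  Nat.nth_mem (p := (· ∈ R)) j fun hf => by rwa [card_toFinset_mem R hf]

theorem count_nth_of_lt {R : Finset ℕ} {j : ℕ} (hj : j < R.card) :
    Nat.count (· ∈ R) (Nat.nth (· ∈ R) j) = j :=
  Nat.count_nth fun hf => by rwa [card_toFinset_mem R hf]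

theorem count_le_card (c : ℕ) : Nat.count (· ∈ R) c ≤ R.card := by
  rw [Nat.count_eq_card_filter_range]
  exact Finset.card_le_card fun i hi => (Finset.mem_filter.1 hi).2

theorem count_eq_card {m : ℕ} (h : R ⊆ Finset.range m) : Nat.count (· ∈ R) m = R.card := by
  rw [Nat.count_eq_card_filter_range]
  congr 1
  ext i
  simp only [Finset.mem_filter, Finset.mem_range, and_iff_right_iff_imp]
  exact fun hi => Finset.mem_range.1 (h hi)

theorem sum_filter_nth (p : ℕ → Prop) [DecidablePred p] (F : ℕ → M) :
    ∑ s ∈ R with p s, F s =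
      ∑ j ∈ Finset.range R.card with p (Nat.nth (· ∈ R) j), F (Nat.nth (· ∈ R) j) := by
  refine Finset.sum_nbij' (Nat.count (· ∈ R)) (Nat.nth (· ∈ R)) ?_ ?_ ?_ ?_ ?_
  · intro s hs
    rw [Finset.mem_filter] at hs
    rw [Finset.mem_filter, Finset.mem_range, Nat.nth_count hs.1]
    exact ⟨count_lt_card hs.1, hs.2⟩
  · intro j hj
    rw [Finset.mem_filter, Finset.mem_range] at hj
    exact Finset.mem_filter.2 ⟨nth_mem_of_lt hj.1, hj.2⟩
  · exact fun s hs => Nat.nth_count (Finset.mem_filter.1 hs).1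
  · exact fun j hj => count_nth_of_lt (Finset.mem_range.1 (Finset.mem_filter.1 hj).1)
  · intro s hs
    rw [Nat.nth_count (Finset.mem_filter.1 hs).1]

theorem sum_nth (F : ℕ → M) :
    ∑ s ∈ R, F s = ∑ j ∈ Finset.range R.card, F (Nat.nth (· ∈ R) j) := by
  simpa using sum_filter_nth R (fun _ => True) F

theorem count_lt_count_iff {R : Finset ℕ} {s c : ℕ} (hs : s ∈ R) :
    Nat.count (· ∈ R) s < Nat.count (· ∈ R) c ↔ s < c :=
  ⟨fun h => lt_of_not_ge fun hc => h.not_ge (Nat.count_monotone _ hc),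
    fun h => Nat.count_strict_mono hs h⟩

/-- In the consecutive numbering of the free slots, the heads are the multiples of K. They form
bundle 0 of a round robin, which is how the results on round robins apply to them. -/
theorem sum_heads (K c : ℕ) (F : ℕ → M) :
    ∑ s ∈ heads R K c, F s = ∑ j ∈ Finset.range (Nat.count (· ∈ R) c) with j % K = 0,
      F (Nat.nth (· ∈ R) j) := by
  rw [heads, sum_filter_nth]
  refine Finset.sum_congr ?_ fun _ _ => rfl
  ext j
  simp only [Finset.mem_filter, Finset.mem_range]
  constructor
  · rintro ⟨hj, h1, h2⟩
    rw [count_nth_of_lt hj] at h2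
    rw [← count_lt_count_iff (nth_mem_of_lt hj), count_nth_of_lt hj] at h1
    exact ⟨h1, h2⟩
  · rintro ⟨h1, h2⟩
    have hj := h1.trans_le (count_le_card R c)
    rw [← count_lt_count_iff (nth_mem_of_lt hj), count_nth_of_lt hj]
    exact ⟨hj, h1, h2⟩

theorem heads_subset (K c : ℕ) : heads R K c ⊆ R := Finset.filter_subset _ _

theorem heads_one {m : ℕ} (h : R ⊆ Finset.range m) : heads R 1 m = R := by
  refine Finset.filter_true_of_mem fun s hs => ⟨Finset.mem_range.1 (h hs), Nat.mod_one _⟩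

theorem count_succ_le (c : ℕ) : Nat.count (· ∈ R) (c + 1) ≤ Nat.count (· ∈ R) c + 1 := by
  rw [Nat.count_succ]; split_ifs <;> omega

end transfer

/-- A property of the free slots `R` and the number of agents that allows to satisfy an agent of
goods division, with weights `w` and threshold `μ`, after a removal of heads. -/
structure GoodsInvariant (m : ℕ) (w : ℕ → ℝ) (μ : ℝ) (Inv : Finset ℕ → ℕ → Prop) : Prop where
  mono : ∀ R A, Inv R (A + 1) → Inv R A
  le_heads : ∀ R A, Inv R (A + 1) → μ ≤ ∑ s ∈ heads R (A + 1) m, w s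
  step : ∀ R A c, Inv R (A + 1) → ∑ s ∈ heads R (A + 1) c, w s < μ →
    Inv (R \ heads R (A + 1) (c + 1)) A

/-- The analogue of `GoodsInvariant` for chore division. -/
structure ChoresInvariant (m : ℕ) (w : ℕ → ℝ) (μ : ℝ) (Inv : Finset ℕ → ℕ → Prop) : Prop where
  last : ∀ R, Inv R 1 → ∑ s ∈ R, w s ≤ μ
  step : ∀ R A c, Inv R (A + 2) → c ≤ m → (c = m ∨ μ < ∑ s ∈ heads R (A + 2) (c + 1), w s) →
    Inv (R \ heads R (A + 2) c) (A + 1)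

section restrict
variable {m : ℕ} {w : ℕ → ℝ} {R : Finset ℕ}

theorem nth_mono_of_lt {i j : ℕ} (hij : i ≤ j) (hj : j < R.card) :
    Nat.nth (· ∈ R) i ≤ Nat.nth (· ∈ R) j :=
  Nat.nth_le_nth_of_lt_card (R.finite_toSet) hij (by rwa [card_toFinset_mem])

theorem DecreasingOn.nth (hd : DecreasingOn w m) (hR : R ⊆ Finset.range m) :
    DecreasingOn (fun j => w (Nat.nth (· ∈ R) j)) R.card := fun _ _ hij hj =>
  hd _ _ (nth_mono_of_lt hij hj) (Finset.mem_range.1 (hR (nth_mem_of_lt hj)))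

theorem LexOn.nth (hl : LexOn w m) (hR : R ⊆ Finset.range m) :
    LexOn (fun j => w (Nat.nth (· ∈ R) j)) R.card := by
  intro j hj
  obtain ⟨h1, h2⟩ := hl _ (Finset.mem_range.1 (hR (nth_mem_of_lt hj)))
  refine ⟨h1, lt_of_le_of_lt ?_ h2⟩
  rw [← sum_filter_nth R (fun s => w s < w (Nat.nth (· ∈ R) j)) w]
  exact Finset.sum_le_sum_of_subset_of_nonneg (Finset.filter_subset_filter _ hR) fun i hi _ =>
    (hl i (Finset.mem_range.1 (Finset.mem_filter.1 hi).1)).1.le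

theorem sum_heads_eq_robin (K c : ℕ) : ∑ s ∈ heads R K c, w s =
    robin (fun j => w (Nat.nth (· ∈ R) j)) K (Nat.count (· ∈ R) c) 0 := sum_heads R K c w

theorem sum_filter_count (F : ℕ → ℕ) (t : ℕ) :
    ∑ s ∈ R with F (Nat.count (· ∈ R) s) = t, w s =
      load (fun j => w (Nat.nth (· ∈ R) j)) F R.card t := by
  rw [sum_filter_nth, load]
  refine Finset.sum_congr (Finset.filter_congr fun j hj => ?_) fun _ _ => rfl
  rw [count_nth_of_lt (Finset.mem_range.1 hj)]

theorem sum_le_mul_heads (hd : DecreasingOn w m) (hw : ∀ i < m, 0 ≤ w i)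
    (hR : R ⊆ Finset.range m) {K : ℕ} (hK : 0 < K) :
    ∑ s ∈ R, w s ≤ K * ∑ s ∈ heads R K m, w s := by
  rw [sum_heads_eq_robin, count_eq_card R hR, sum_nth R w]
  exact sum_le_mul_robin (hd.nth hR)
    (fun i hi => hw _ (Finset.mem_range.1 (hR (nth_mem_of_lt hi)))) hK

end restrict

/-- The invariant is that R can be divided into K bundles worth μ. By averaging, all heads together
are then worth μ. When a cut is rejected, there is such a division in which one bundle contains the
heads including the next slot, and the other bundles survive the removal. -/
theorem LexOn.goodsInvariant {m : ℕ} {w : ℕ → ℝ} (hl : LexOn w m) (hd : DecreasingOn w m)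
    (μ : ℝ) : GoodsInvariant m w μ fun R K => R ⊆ Finset.range m ∧
      ∃ f : ℕ → ℕ, ∀ t < K, μ ≤ ∑ s ∈ R with f s = t, w s where
  mono := fun R A ⟨hR, f, hf⟩ => ⟨hR, f, fun t ht => hf t (by omega)⟩
  le_heads := by
    rintro R A ⟨hR, f, hf⟩
    have hw : ∀ i ∈ R, 0 ≤ w i := fun i hi => (hl i (Finset.mem_range.1 (hR hi))).1.le
    have h1 := sum_le_mul_heads hd (fun i hi => (hl i hi).1.le) hR (Nat.succ_pos A)
    have h2 : ∑ t ∈ Finset.range (A + 1), ∑ s ∈ R with f s = t, w s ≤ ∑ s ∈ R, w s := by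
      rw [Finset.sum_fiberwise_eq_sum_filter]
      exact Finset.sum_le_sum_of_subset_of_nonneg (Finset.filter_subset _ _)
        fun i hi _ => hw i hi
    have h3 := Finset.card_nsmul_le_sum (Finset.range (A + 1)) _ μ
      fun t ht => hf t (Finset.mem_range.1 ht)
    rw [Finset.card_range, nsmul_eq_mul] at h3
    exact le_of_mul_le_mul_left (h3.trans (h2.trans h1)) (by positivity)
  step := by
    rintro R A c ⟨hR, f, hf⟩ hc
    have hw : ∀ i ∈ R, 0 ≤ w i := fun i hi => (hl i (Finset.mem_range.1 (hR hi))).1.le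
    rw [sum_heads_eq_robin] at hc
    -- Slots that f puts into none of the bundles 0 to A are added to bundle 0, which can only raise
    -- its load.
    have hload : ∀ t < A + 1, μ ≤ load (fun j => w (Nat.nth (· ∈ R) j))
        (fun j => if f (Nat.nth (· ∈ R) j) < A + 1 then f (Nat.nth (· ∈ R) j) else 0)
        R.card t := by
      intro t ht
      refine (hf t ht).trans ?_
      rw [sum_filter_nth, load]
      refine Finset.sum_le_sum_of_subset_of_nonneg (fun j hj => ?_) fun j hj _ =>
        hw _ (nth_mem_of_lt (Finset.mem_range.1 (Finset.mem_filter.1 hj).1))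
      simp only [Finset.mem_filter] at hj ⊢
      exact ⟨hj.1, by rw [hj.2, if_pos ht]⟩
    obtain ⟨F, -, hF2, hF3⟩ := (hl.nth hR).exists_of_robin_lt (hd.nth hR) (Nat.succ_pos A)
      (fun i _ => by split_ifs <;> omega) hload (count_le_card R c)
      (count_le_card R (c + 1)) (count_succ_le R c) hc
    -- Bundle 0 is dropped and the others are renumbered. The truncated subtraction sends what is
    -- left of bundle 0 to the new bundle 0, which is harmless for goods.
    refine ⟨Finset.sdiff_subset.trans hR, fun s => F (Nat.count (· ∈ R) s) - 1, fun t ht => ?_⟩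
    refine (hF3 (t + 1) (by omega)).trans ?_
    rw [← sum_filter_count]
    refine Finset.sum_le_sum_of_subset_of_nonneg (fun s hs => ?_) fun i hi _ =>
      hw i (Finset.mem_sdiff.1 (Finset.mem_filter.1 hi).1).1
    rw [Finset.mem_filter] at hs
    refine Finset.mem_filter.2 ⟨Finset.mem_sdiff.2 ⟨hs.1, fun h => ?_⟩, by simp [hs.2]⟩
    obtain ⟨-, h1, h2⟩ := Finset.mem_filter.1 h
    have := hF2 _ ((count_lt_count_iff hs.1).2 h1)
    rw [hs.2, h2] at this
    omega

/-- Dual to the case of goods: here bundle 0 of the new division has to lie inside the removed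
heads, so that everything left over is distributed to the other bundles within the threshold. -/
theorem LexOn.choresInvariant {m : ℕ} {w : ℕ → ℝ} (hl : LexOn w m) (hd : DecreasingOn w m)
    (μ : ℝ) : ChoresInvariant m w μ fun R K => R ⊆ Finset.range m ∧
      ∃ f : ℕ → ℕ, (∀ s ∈ R, f s < K) ∧ ∀ t < K, ∑ s ∈ R with f s = t, w s ≤ μ where
  last := by
    rintro R ⟨hR, f, hf, h⟩
    have := h 0 Nat.one_pos
    rwa [Finset.filter_true_of_mem fun s hs => by have := hf s hs; omega] at this
  step := by
    rintro R A c ⟨hR, f, hfR, hf⟩ hcm hc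
    have hw : ∀ i ∈ R, 0 ≤ w i := fun i hi => (hl i (Finset.mem_range.1 (hR hi))).1.le
    have hload : ∀ t < A + 2, load (fun j => w (Nat.nth (· ∈ R) j))
        (fun j => f (Nat.nth (· ∈ R) j)) R.card t ≤ μ := by
      intro t ht
      refine le_trans (le_of_eq ?_) (hf t ht)
      rw [sum_filter_nth R (fun s => f s = t), load]
    obtain ⟨F, hF1, hF2, hF3⟩ := (hl.nth hR).exists_of_lt_robin (hd.nth hR)
      (show 1 < A + 2 by omega) (fun i hi => hfR _ (nth_mem_of_lt hi)) hload (count_le_card R c)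
      (count_le_card R (c + 1)) (count_succ_le R c)
      (hc.imp (fun h => by rw [h, count_eq_card R hR]) fun h => by rwa [← sum_heads_eq_robin])
    -- No remaining slot is in bundle 0, so the renumbering by subtraction is exact and merges no
    -- bundles.
    have hpos : ∀ s ∈ R \ heads R (A + 2) c, 0 < F (Nat.count (· ∈ R) s) := fun s hs => by
      rw [Finset.mem_sdiff] at hs
      refine Nat.pos_of_ne_zero fun h => hs.2 (Finset.mem_filter.2 ⟨hs.1, ?_⟩)
      have := hF2 _ (count_lt_card hs.1) h
      rwa [count_lt_count_iff hs.1] at this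
    refine ⟨Finset.sdiff_subset.trans hR, fun s => F (Nat.count (· ∈ R) s) - 1, fun s hs => ?_,
      fun t ht => ?_⟩
    · have := hpos s hs
      have := hF1 _ (count_lt_card (Finset.mem_sdiff.1 hs).1)
      dsimp only
      omega
    · refine le_trans ?_ (hF3 (t + 1) (by omega) (by omega))
      rw [← sum_filter_count]
      refine Finset.sum_le_sum_of_subset_of_nonneg (fun s hs => ?_) fun i hi _ =>
        hw i (Finset.mem_filter.1 hi).1
      rw [Finset.mem_filter] at hs
      have h1 := hpos s hs.1
      have h2 : F _ - 1 = t := hs.2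
      exact Finset.mem_filter.2 ⟨(Finset.mem_sdiff.1 hs.1).1, by omega⟩

/-! ### Two-valued weights -/

/-- The number of multiples of `K` below `x`. -/
def multiples (K x : ℕ) : ℕ := ((Finset.range x).filter fun j => j % K = 0).card

/-- This identifies the number of multiples with x / K rounded up. The form with products suits the
linear estimates below. -/
theorem multiples_bounds {K : ℕ} (hK : 0 < K) (x : ℕ) :
    x ≤ K * multiples K x ∧ K * multiples K x < x + K := by
  induction x with
  | zero => simp [multiples, hK]
  | succ x ih =>
    have : multiples K (x + 1) = multiples K x + if x % K = 0 then 1 else 0 := by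
      unfold multiples
      rw [Finset.range_add_one, Finset.filter_insert]
      split_ifs
      · rw [Finset.card_insert_of_notMem (by simp)]
      · rfl
    rw [this]
    split_ifs with h
    · obtain ⟨y, rfl⟩ := Nat.dvd_of_mod_eq_zero h
      have h1 := Nat.le_of_mul_le_mul_left ih.1 hK
      have h2 : multiples K (K * y) < y + 1 := by
        refine Nat.lt_of_mul_lt_mul_left (a := K) ?_
        rw [mul_add, mul_one]; exact ih.2
      have h3 : multiples K (K * y) = y := by omega
      rw [h3, mul_add, mul_one]
      omega
    · have : K * multiples K x ≠ x := fun h' => h (by rw [← h']; simp)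
      rw [add_zero]
      omega

theorem multiples_mono (K : ℕ) : Monotone (multiples K) := fun _ _ h =>
  Finset.card_le_card (Finset.filter_subset_filter _ (Finset.range_mono h))

theorem multiples_succ_le (K x : ℕ) : multiples K (x + 1) ≤ multiples K x + 1 := by
  unfold multiples
  rw [Finset.range_add_one, Finset.filter_insert]
  split_ifs
  · exact Finset.card_insert_le _ _
  · omega

theorem sum_multiples_ite (K x l : ℕ) (a b : ℤ) :
    ∑ j ∈ Finset.range x with j % K = 0, (if j < l then b else a) =
      (b - a) * multiples K (min x l) + a * multiples K x := by
  have h : ∀ j, (if j < l then b else a) = (if j < l then b - a else 0) + a := fun j => by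
    split_ifs <;> ring
  simp only [h]
  rw [Finset.sum_add_distrib, ← Finset.sum_filter, Finset.filter_filter]
  have : (Finset.range x).filter (fun j => j % K = 0 ∧ j < l) =
      (Finset.range (min x l)).filter fun j => j % K = 0 := by
    ext j; simp only [Finset.mem_filter, Finset.mem_range, lt_min_iff]; tauto
  rw [this]
  simp [multiples]
  ring

theorem exists_threshold {q N : ℕ} {ω : ℕ → ℕ} (hq : 1 < q) (hv : ∀ i < N, ω i = 1 ∨ ω i = q)
    (ha : ∀ i j, i ≤ j → j < N → ω j ≤ ω i) :
    ∃ l ≤ N, ∀ j < N, ω j = if j < l then q else 1 := by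
  induction N with
  | zero => exact ⟨0, le_rfl, by simp⟩
  | succ N ih =>
    rcases hv N (by omega) with h | h
    · obtain ⟨l, hl, H⟩ := ih (fun i hi => hv i (by omega)) fun i j hij hj => ha i j hij (by omega)
      refine ⟨l, by omega, fun j hj => ?_⟩
      rcases Nat.lt_succ_iff_lt_or_eq.1 hj with hj | rfl
      · exact H j hj
      · rw [h, if_neg (by omega)]
    · refine ⟨N + 1, le_rfl, fun j hj => ?_⟩
      rw [if_pos hj]
      have := ha j N (by omega) (by omega)
      rcases hv j hj with h' | h' <;> omega

/-- How sums over `R` and its heads depend on the number `l` of large elements of `R`. -/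
theorem TwoValuedOn.exists_sums {m : ℕ} {w : ℕ → ℝ} {c : ℝ} {q : ℕ} {ω : ℕ → ℕ}
    (h : TwoValuedOn w m c q ω) {R : Finset ℕ} (hR : R ⊆ Finset.range m) :
    ∃ l ≤ R.card, ∀ a b : ℤ, (∑ s ∈ R, (if ω s = q then b else a) = (b - a) * l + a * R.card) ∧
      ∀ K x, ∑ s ∈ heads R K x, (if ω s = q then b else a) =
        (b - a) * multiples K (min (Nat.count (· ∈ R) x) l) +
          a * multiples K (Nat.count (· ∈ R) x) := by
  obtain ⟨l, hl, H⟩ := exists_threshold (N := R.card) (ω := fun j => ω (Nat.nth (· ∈ R) j)) h.one_lt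
    (fun i hi => h.values _ (Finset.mem_range.1 (hR (nth_mem_of_lt hi))))
    fun i j hij hj => h.anti _ _ (nth_mono_of_lt hij hj)
      (Finset.mem_range.1 (hR (nth_mem_of_lt hj)))
  have hite : ∀ a b : ℤ, ∀ j < R.card,
      (if ω (Nat.nth (· ∈ R) j) = q then b else a) = if j < l then b else a := fun a b j hj => by
    have := H j hj
    have := h.one_lt
    split_ifs at * <;> first | rfl | omega
  refine ⟨l, hl, fun a b => ⟨?_, fun K x => ?_⟩⟩
  · rw [sum_nth, Finset.sum_congr rfl fun j hj => hite a b j (Finset.mem_range.1 hj)]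
    have := sum_multiples_ite 1 R.card l a b
    have e : ∀ x, multiples 1 x = x := fun x => by simp [multiples, Nat.mod_one]
    rw [e, e, min_eq_right hl] at this
    simpa [Nat.mod_one] using this
  · rw [sum_heads, ← sum_multiples_ite]
    refine Finset.sum_congr rfl fun j hj => hite a b j ?_
    exact (Finset.mem_range.1 (Finset.mem_filter.1 hj).1).trans_le (count_le_card R x)

theorem TwoValuedOn.cast_eq {m : ℕ} {w : ℕ → ℝ} {c : ℝ} {q : ℕ} {ω : ℕ → ℕ}
    (h : TwoValuedOn w m c q ω) {X : Finset ℕ} (hX : X ⊆ Finset.range m) :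
    ∑ s ∈ X, w s = c * (∑ s ∈ X, (if ω s = q then (q : ℤ) else 1) : ℤ) := by
  rw [Int.cast_sum, Finset.mul_sum]
  refine Finset.sum_congr rfl fun s hs => ?_
  have hs := Finset.mem_range.1 (hX hs)
  rw [h.eq s hs]
  have := h.one_lt
  split_ifs with h'
  · rw [h']; simp
  · rw [(h.values s hs).resolve_right h']; simp

/-- Both inequalities are necessary for a division of R into K bundles worth q * d + e. The second
one lowers the value of large slots to e: a bundle that meets the threshold either has d + 1 large
slots or makes up for the missing ones by small slots, and is worth e * (d + 1) in both cases. For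
the remaining A bundles the two requirements differ by (q - e) * (A * d), while the two sums differ
by q - e for each large slot. So one inequality yields the other one, depending on whether at least
or at most A * d large slots remain. -/
theorem TwoValuedOn.goodsInvariant {m : ℕ} {w : ℕ → ℝ} {c : ℝ} {q : ℕ} {ω : ℕ → ℕ}
    (h : TwoValuedOn w m c q ω) {d e : ℤ} (he : 1 ≤ e) (heq : e ≤ q) (hd : -1 ≤ d)
    (hμ : 0 ≤ q * d + e) :
    GoodsInvariant m w (c * (q * d + e : ℤ)) fun R K => R ⊆ Finset.range m ∧
      K * (q * d + e) ≤ ∑ s ∈ R, (if ω s = q then (q : ℤ) else 1) ∧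
      K * (e * (d + 1)) ≤ ∑ s ∈ R, (if ω s = q then e else 1) where
  mono := by
    rintro R A ⟨hR, h1, h2⟩
    push_cast at h1 h2
    exact ⟨hR, by linarith, by nlinarith⟩
  le_heads := by
    rintro R A ⟨hR, h1, -⟩
    obtain ⟨l, hl, H⟩ := h.exists_sums hR
    rw [h.cast_eq ((heads_subset _ _ _).trans hR)]
    refine mul_le_mul_of_nonneg_left ?_ h.pos.le
    rw [Int.cast_le]
    rw [(H 1 q).1] at h1
    rw [(H 1 q).2, count_eq_card R hR, min_eq_right hl]
    have b1 := (multiples_bounds (Nat.succ_pos A) l).1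
    have b2 := (multiples_bounds (Nat.succ_pos A) R.card).1
    zify at b1 b2
    have hq : (1 : ℤ) < q := by exact_mod_cast h.one_lt
    push_cast at h1
    have b3 := mul_le_mul_of_nonneg_left b1 (show (0 : ℤ) ≤ q - 1 by linarith)
    refine le_of_mul_le_mul_left (a := (A : ℤ) + 1) ?_ (by positivity)
    simp only [Nat.succ_eq_add_one] at *
    linarith
  step := by
    rintro R A x ⟨hR, h1, h2⟩ hx
    obtain ⟨l, hl, H⟩ := h.exists_sums hR
    rw [h.cast_eq ((heads_subset _ _ _).trans hR)] at hx
    replace hx := lt_of_mul_lt_mul_left hx h.pos.le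
    rw [Int.cast_lt, (H 1 q).2] at hx
    have hs : ∀ F : ℕ → ℤ, ∑ s ∈ R \ heads R (A + 1) (x + 1), F s =
        ∑ s ∈ R, F s - ∑ s ∈ heads R (A + 1) (x + 1), F s := fun F => by
      rw [Finset.sum_sdiff_eq_sub (heads_subset _ _ _)]
    refine ⟨Finset.sdiff_subset.trans hR, ?_⟩
    rw [hs, hs, (H 1 q).2, (H 1 e).2, (H 1 q).1, (H 1 e).1]
    rw [(H 1 q).1] at h1
    rw [(H 1 e).1] at h2
    have hq : (1 : ℤ) < q := by exact_mod_cast h.one_lt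
    have hcc := count_succ_le R x
    generalize Nat.count (· ∈ R) x = k at *
    generalize Nat.count (· ∈ R) (x + 1) = k' at *
    have hk : multiples (A + 1) k' ≤ multiples (A + 1) k + 1 :=
      (multiples_mono _ hcc).trans (multiples_succ_le _ _)
    have bl := multiples_bounds (Nat.succ_pos A) l
    have bk := multiples_bounds (Nat.succ_pos A) k'
    simp only [Nat.succ_eq_add_one] at bl bk
    push_cast at h1 h2
    -- If the cut lies within the large slots, all removed slots are large and there are at most d +
    -- 1 of them, which gives the second inequality. Otherwise a rejected cut plus at most one small
    -- slot removes no more than the threshold, which gives the first one.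
    rcases le_or_gt k' l with hkl | hkl
    · rw [min_eq_left hkl]
      have hk2 : multiples (A + 1) k' ≤ multiples (A + 1) (min k l) + 1 :=
        (multiples_mono _ (by omega)).trans (multiples_succ_le _ _)
      generalize multiples (A + 1) (min k l) = y at *
      generalize multiples (A + 1) k = y' at *
      generalize multiples (A + 1) k' = β at *
      zify at *
      have hβ : (β : ℤ) ≤ d + 1 := by
        by_contra hc
        nlinarith
      have g2 : (A : ℤ) * (e * (d + 1)) ≤ (e - 1) * l + 1 * R.card - ((e - 1) * β + 1 * β) := by
        nlinarith
      refine ⟨?_, g2⟩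
      rcases hβ.lt_or_eq with hβ | hβ
      · nlinarith
      -- With exactly d + 1 large heads there were more than (A + 1) * d large slots, so at least A
      -- * d remain and the first inequality follows from the second.
      · have : 0 ≤ (q - e) * ((l : ℤ) - β - A * d) := by
          refine mul_nonneg (by linarith) ?_
          rw [hβ] at bk ⊢
          nlinarith
        nlinarith
    · rw [min_eq_right hkl.le]
      rw [min_eq_right (by omega)] at hx
      have hm := multiples_mono (A + 1) (show l ≤ k by omega)
      generalize multiples (A + 1) l = β at *
      generalize multiples (A + 1) k = y at *
      generalize multiples (A + 1) k' = y' at *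
      zify at *
      have hβ : (β : ℤ) ≤ d := by
        by_contra hc
        nlinarith
      have g1 : (A : ℤ) * (q * d + e) ≤ (q - 1) * l + 1 * R.card - ((q - 1) * β + 1 * y') := by
        nlinarith
      refine ⟨g1, ?_⟩
      have : 0 ≤ (q - e) * (A * d - ((l : ℤ) - β)) := by
        refine mul_nonneg (by linarith) ?_
        nlinarith
      nlinarith

/-- The invariant bounds the number of large slots by d per bundle and the total by the threshold
per bundle. The heads contain at least their share of the large slots once the cut is past all of
these. -/
theorem TwoValuedOn.choresInvariant {m : ℕ} {w : ℕ → ℝ} {c : ℝ} {q : ℕ} {ω : ℕ → ℕ}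
    (h : TwoValuedOn w m c q ω) {d e : ℤ} (he : 0 ≤ e) :
    ChoresInvariant m w (c * (q * d + e : ℤ)) fun R K => R ⊆ Finset.range m ∧
      ∑ s ∈ R, (if ω s = q then (1 : ℤ) else 0) ≤ K * d ∧
      ∑ s ∈ R, (if ω s = q then (q : ℤ) else 1) ≤ K * (q * d + e) where
  last := by
    rintro R ⟨hR, -, h2⟩
    rw [h.cast_eq hR]
    refine mul_le_mul_of_nonneg_left ?_ h.pos.le
    rw [Int.cast_le]
    simpa using h2
  step := by
    rintro R A x ⟨hR, h1, h2⟩ hxm hx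
    obtain ⟨l, hl, H⟩ := h.exists_sums hR
    rw [h.cast_eq ((heads_subset _ _ _).trans hR), mul_lt_mul_iff_right₀ h.pos, Int.cast_lt,
      (H 1 q).2] at hx
    have hs : ∀ F : ℕ → ℤ, ∑ s ∈ R \ heads R (A + 2) x, F s =
        ∑ s ∈ R, F s - ∑ s ∈ heads R (A + 2) x, F s := fun F => by
      rw [Finset.sum_sdiff_eq_sub (heads_subset _ _ _)]
    refine ⟨Finset.sdiff_subset.trans hR, ?_⟩
    rw [hs, hs, (H 1 q).2, (H 0 1).2, (H 1 q).1, (H 0 1).1]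
    rw [(H 0 1).1] at h1
    rw [(H 1 q).1] at h2
    have hq : (1 : ℤ) < q := by exact_mod_cast h.one_lt
    have hcc := count_succ_le R x
    have hcm : x = m → Nat.count (· ∈ R) x = R.card := fun h => by rw [h, count_eq_card R hR]
    replace hx := hx.imp hcm id
    clear hcm
    generalize Nat.count (· ∈ R) x = k at *
    generalize Nat.count (· ∈ R) (x + 1) = k' at *
    have hk : multiples (A + 2) k' ≤ multiples (A + 2) k + 1 :=
      (multiples_mono _ hcc).trans (multiples_succ_le _ _)
    have bl := multiples_bounds (show 0 < A + 2 by omega) l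
    have bk := multiples_bounds (show 0 < A + 2 by omega) k
    push_cast at h1 h2 ⊢
    rcases hx with rfl | hx
    · rw [min_eq_right hl]
      generalize multiples (A + 2) l = β at *
      generalize multiples (A + 2) R.card = y at *
      zify at *
      constructor
      · refine le_of_mul_le_mul_left (a := (A : ℤ) + 2) ?_ (by positivity)
        nlinarith
      · refine le_of_mul_le_mul_left (a := (A : ℤ) + 2) ?_ (by positivity)
        have b3 := mul_le_mul_of_nonneg_left bl.1 (show (0 : ℤ) ≤ q - 1 by linarith)
        have b4 := mul_le_mul_of_nonneg_left h2 (show (0 : ℤ) ≤ A + 1 by positivity)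
        linarith
    -- There are at most d large heads, so exceeding q * d + e takes a small slot and the cut is
    -- past all large ones. The offending slot has weight 1, so by integrality the heads before it
    -- already weigh at least q * d + e.
    · have hβ : (multiples (A + 2) l : ℤ) ≤ d := by
        generalize multiples (A + 2) l = β at *
        zify at bl
        by_contra hc
        nlinarith
      have hkl : l < k' := by
        by_contra hc
        rw [min_eq_left (by omega)] at hx
        have := multiples_mono (A + 2) (not_lt.1 hc)
        zify at this
        nlinarith
      rw [min_eq_right hkl.le] at hx
      rw [min_eq_right (by omega)]
      generalize multiples (A + 2) l = β at *
      generalize multiples (A + 2) k = y at *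
      generalize multiples (A + 2) k' = y' at *
      zify at *
      constructor
      · nlinarith
      · nlinarith

/-! ### Sorted weights of an agent -/

/-- The weights of the theorem: lexicographic ones and two-valued ones, in decreasing order. -/
structure Tractable (w : ℕ → ℝ) (m : ℕ) : Prop where
  dec : DecreasingOn w m
  cases : LexOn w m ∨ ∃ c q ω, TwoValuedOn w m c q ω

namespace Tractable
variable {w : ℕ → ℝ} {m n : ℕ}

theorem pos (h : Tractable w m) {i : ℕ} (hi : i < m) : 0 < w i := by
  rcases h.cases with h | ⟨c, q, ω, h⟩
  · exact (h i hi).1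
  · rw [h.eq i hi]
    have := h.one_lt
    have : 0 < ω i := by rcases h.values i hi with h' | h' <;> omega
    exact mul_pos h.pos (by exact_mod_cast this)

theorem nonneg (h : Tractable w m) : ∀ i < m, 0 ≤ w i := fun _ hi => (h.pos hi).le

theorem noOvershoot (h : Tractable w m) : NoOvershoot w m := by
  rcases h.cases with h' | ⟨c, q, ω, h'⟩
  · exact h'.noOvershoot h.dec
  · exact h'.noOvershoot

theorem sum_ite_eq_card (X : Finset ℕ) (p : ℕ → Prop) [DecidablePred p] (a b : ℤ) :
    ∑ s ∈ X, (if p s then b else a) = b * (X.filter p).card + a * (X.filter (¬ p ·)).card := by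
  rw [Finset.sum_ite]
  simp [mul_comm]

/-- The minimum load of a greedy distribution is a threshold that can be maintained. -/
theorem exists_goodsInvariant (h : Tractable w m) {f : ℕ → ℕ} (hf : IsGreedy w n m f) {μ : ℝ}
    (hμ : ∀ t < n, μ ≤ load w f m t) (hμ' : ∃ t < n, load w f m t = μ) :
    ∃ Inv, GoodsInvariant m w μ Inv ∧ Inv (Finset.range m) n := by
  rcases h.cases with h' | ⟨c, q, ω, h'⟩
  · exact ⟨_, h'.goodsInvariant h.dec μ, Finset.Subset.refl _, f, hμ⟩
  obtain ⟨t₀, ht₀, rfl⟩ := hμ'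
  have hl : ∀ t, load w f m t =
      c * (∑ s ∈ Finset.range m with f s = t, (if ω s = q then (q : ℤ) else 1) : ℤ) :=
    fun t => h'.cast_eq (Finset.filter_subset _ _)
  set X : ℕ → ℤ := fun t => ∑ s ∈ Finset.range m with f s = t, (if ω s = q then (q : ℤ) else 1)
  have hX0 : 0 ≤ X t₀ := Finset.sum_nonneg fun s _ => by split_ifs <;> simp
  have hX : ∀ t < n, X t₀ ≤ X t := fun t ht => by
    have := hμ t ht
    rw [hl, hl, mul_le_mul_iff_right₀ h'.pos] at this
    exact Int.cast_le.1 this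
  have hq : (1 : ℤ) < q := by exact_mod_cast h'.one_lt
  -- The shift by 1 puts the remainder e between 1 and q instead of 0 and q - 1. A zero threshold
  -- gives d = -1 and e = q.
  set d : ℤ := (X t₀ - 1) / q
  set e : ℤ := (X t₀ - 1) % q + 1
  have hde : q * d + e = X t₀ := by
    have := Int.mul_ediv_add_emod (X t₀ - 1) q
    simp only [d, e]; linarith
  have he1 : 1 ≤ e := by
    have := Int.emod_nonneg (X t₀ - 1) (show (q : ℤ) ≠ 0 by omega)
    simp only [e]; omega
  have heq : e ≤ q := by
    have := Int.emod_lt_of_pos (X t₀ - 1) (show (0 : ℤ) < q by omega)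
    simp only [e]; omega
  have hd : -1 ≤ d := by
    by_contra hc
    nlinarith
  rw [hl]
  change ∃ Inv, GoodsInvariant m w (c * (X t₀ : ℤ)) Inv ∧ _
  rw [← hde]
  refine ⟨_, h'.goodsInvariant he1 heq hd (by rw [hde]; exact hX0), Finset.Subset.refl _, ?_, ?_⟩
  · rw [hde, ← Finset.sum_fiberwise_of_maps_to (t := Finset.range n) (g := f) fun s hs =>
      Finset.mem_range.2 (hf s (Finset.mem_range.1 hs)).1]
    simpa using Finset.card_nsmul_le_sum (Finset.range n) X (X t₀)
      fun t ht => hX t (Finset.mem_range.1 ht)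
  · rw [← Finset.sum_fiberwise_of_maps_to (t := Finset.range n) (g := f) fun s hs =>
      Finset.mem_range.2 (hf s (Finset.mem_range.1 hs)).1]
    refine le_trans (by simp) (Finset.card_nsmul_le_sum (Finset.range n) _ (e * (d + 1))
      fun t ht => ?_)
    have h1 := hX t (Finset.mem_range.1 ht)
    simp only [X] at h1
    rw [show ∑ s ∈ Finset.range m with f s = t₀, (if ω s = q then (q : ℤ) else 1) = q * d + e
      from hde.symm, sum_ite_eq_card] at h1
    rw [sum_ite_eq_card]
    generalize ((((Finset.range m).filter fun s => f s = t).filter fun s => ω s = q).card : ℤ) = β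
      at *
    have hσ : (0 : ℤ) ≤ (((Finset.range m).filter fun s => f s = t).filter
      fun s => ¬ ω s = q).card := by positivity
    generalize ((((Finset.range m).filter fun s => f s = t).filter fun s => ¬ ω s = q).card : ℤ) = σ
      at *
    -- Here β counts large and σ small slots of a bundle. Either d + 1 large slots suffice, or each
    -- large slot missing from d is replaced by q ≥ e small ones, besides e further small ones.
    rcases le_or_gt (d + 1) β with hβ | hβ
    · nlinarith
    · nlinarith

/-- The maximum load is c * (q * d + e) with the ordinary remainder e < q, so a bundle within it has
at most d large slots. Summation over the greedy bundles gives both inequalities of the invariant.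
-/
theorem exists_choresInvariant (h : Tractable w m) {f : ℕ → ℕ} (hf : IsGreedy w n m f) {μ : ℝ}
    (hμ : ∀ t < n, load w f m t ≤ μ) (hμ' : ∃ t < n, load w f m t = μ) :
    ∃ Inv, ChoresInvariant m w μ Inv ∧ Inv (Finset.range m) n := by
  rcases h.cases with h' | ⟨c, q, ω, h'⟩
  · exact ⟨_, h'.choresInvariant h.dec μ, Finset.Subset.refl _, f,
      fun s hs => (hf s (Finset.mem_range.1 hs)).1, hμ⟩
  obtain ⟨t₀, ht₀, rfl⟩ := hμ'
  have hl : ∀ t, load w f m t =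
      c * (∑ s ∈ Finset.range m with f s = t, (if ω s = q then (q : ℤ) else 1) : ℤ) :=
    fun t => h'.cast_eq (Finset.filter_subset _ _)
  set X : ℕ → ℤ := fun t => ∑ s ∈ Finset.range m with f s = t, (if ω s = q then (q : ℤ) else 1)
  have hX : ∀ t < n, X t ≤ X t₀ := fun t ht => by
    have := hμ t ht
    rw [hl, hl, mul_le_mul_iff_right₀ h'.pos] at this
    exact Int.cast_le.1 this
  have hq : (1 : ℤ) < q := by exact_mod_cast h'.one_lt
  have hde := Int.mul_ediv_add_emod (X t₀) q
  have he0 := Int.emod_nonneg (X t₀) (show (q : ℤ) ≠ 0 by omega)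
  have heq := Int.emod_lt_of_pos (X t₀) (show (0 : ℤ) < q by omega)
  set d : ℤ := X t₀ / q
  set e : ℤ := X t₀ % q
  rw [hl]
  change ∃ Inv, ChoresInvariant m w (c * (X t₀ : ℤ)) Inv ∧ _
  rw [← hde]
  refine ⟨_, h'.choresInvariant he0, Finset.Subset.refl _, ?_, ?_⟩
  · rw [← Finset.sum_fiberwise_of_maps_to (t := Finset.range n) (g := f) fun s hs =>
      Finset.mem_range.2 (hf s (Finset.mem_range.1 hs)).1]
    refine le_trans (Finset.sum_le_card_nsmul (Finset.range n) _ d fun t ht => ?_) (by simp)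
    have h1 := hX t (Finset.mem_range.1 ht)
    simp only [X] at h1
    rw [show ∑ s ∈ Finset.range m with f s = t₀, (if ω s = q then (q : ℤ) else 1) = q * d + e
      from hde.symm, sum_ite_eq_card] at h1
    rw [sum_ite_eq_card]
    generalize ((((Finset.range m).filter fun s => f s = t).filter fun s => ω s = q).card : ℤ) = β
      at *
    have hσ : (0 : ℤ) ≤ (((Finset.range m).filter fun s => f s = t).filter
      fun s => ¬ ω s = q).card := by positivity
    by_contra hc
    nlinarith
  · rw [hde, ← Finset.sum_fiberwise_of_maps_to (t := Finset.range n) (g := f) fun s hs =>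
      Finset.mem_range.2 (hf s (Finset.mem_range.1 hs)).1]
    simpa using Finset.sum_le_card_nsmul (Finset.range n) X (X t₀)
      fun t ht => hX t (Finset.mem_range.1 ht)

end Tractable

/-- `w` lists the absolute values of `u` in decreasing order. -/
structure IsSorting {m : ℕ} (u : Fin m → ℝ) (w : ℕ → ℝ) : Prop where
  dec : DecreasingOn w m
  perm : ∃ σ : Fin m ≃ Fin m, ∀ r, w (σ r) = |u r|

variable {m n : ℕ} {u : Fin m → ℝ} {w : ℕ → ℝ}

theorem abs_bundleValue (hu : (∀ r, 0 ≤ u r) ∨ ∀ r, u r ≤ 0) (S : Finset (Fin m)) :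
    |bundleValue u S| = ∑ r ∈ S, |u r| := by
  unfold bundleValue
  rcases hu with hu | hu
  · rw [abs_of_nonneg (Finset.sum_nonneg fun r _ => hu r)]
    exact Finset.sum_congr rfl fun r _ => (abs_of_nonneg (hu r)).symm
  · rw [abs_of_nonpos (Finset.sum_nonpos fun r _ => hu r), ← Finset.sum_neg_distrib]
    exact Finset.sum_congr rfl fun r _ => (abs_of_nonpos (hu r)).symm

/-- This replaces the partition into classes by a condition on values. An item of smaller absolute
value than z is in a later class: it is not in the same one, and in an earlier one it would outweigh
z. The constant sign excludes cancellation inside a class union. -/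
theorem IsWeaklyLexicographic.sum_lt (h : IsWeaklyLexicographic u)
    (hu : (∀ r, 0 ≤ u r) ∨ ∀ r, u r ≤ 0) (z : Fin m) :
    0 < |u z| ∧ ∑ r with |u r| < |u z|, |u r| < |u z| := by
  obtain ⟨k, L, ⟨-, hcov⟩, h1, h2⟩ := h
  obtain ⟨i, hi⟩ := hcov z
  refine ⟨(h1 i z hi z hi).2, lt_of_le_of_lt ?_ (h2 i z hi)⟩
  rw [abs_bundleValue hu]
  refine Finset.sum_le_sum_of_subset_of_nonneg (fun r hr => ?_) fun _ _ _ => abs_nonneg _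
  replace hr := (Finset.mem_filter.1 hr).2
  obtain ⟨j, hj⟩ := hcov r
  rw [Finset.mem_biUnion]
  refine ⟨j, Finset.mem_Ioi.2 ?_, hj⟩
  by_contra hc
  rcases (not_lt.1 hc).lt_or_eq with hlt | rfl
  · have := h2 j r hj
    rw [abs_bundleValue hu] at this
    have h3 := Finset.single_le_sum (f := fun r => |u r|) (fun _ _ => abs_nonneg _)
      (Finset.mem_biUnion.2 ⟨i, Finset.mem_Ioi.2 hlt, hi⟩)
    linarith
  · exact hr.ne (h1 j r hj z hi).1

namespace IsSorting

theorem sum_eq (h : IsSorting u w) (F : ℝ → ℝ) :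
    ∑ i ∈ Finset.range m, F (w i) = ∑ r, F |u r| := by
  obtain ⟨σ, hσ⟩ := h.perm
  rw [← Fin.sum_univ_eq_sum_range (fun i => F (w i)), ← Equiv.sum_comp σ]
  exact Finset.sum_congr rfl fun r _ => by rw [hσ]

theorem exists_eq (h : IsSorting u w) {i : ℕ} (hi : i < m) : ∃ r, w i = |u r| := by
  obtain ⟨σ, hσ⟩ := h.perm
  exact ⟨σ.symm ⟨i, hi⟩, by rw [← hσ]; simp⟩

theorem tractable_of_lex (h : IsSorting u w) (hl : IsWeaklyLexicographic u)
    (hu : (∀ r, 0 ≤ u r) ∨ ∀ r, u r ≤ 0) : Tractable w m := by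
  refine ⟨h.dec, .inl fun j hj => ?_⟩
  obtain ⟨z, hz⟩ := h.exists_eq hj
  obtain ⟨h1, h2⟩ := hl.sum_lt hu z
  rw [Finset.sum_filter, hz, h.sum_eq fun x => if x < |u z| then x else 0, ← Finset.sum_filter]
  exact ⟨h1, h2⟩

theorem tractable_of_two_valued (h : IsSorting u w) {a b : ℝ} {q : ℕ}
    (hab : (0 < a ∧ a < b) ∨ (a < 0 ∧ b < a)) (hq : b = q * a) (hv : ∀ r, u r = a ∨ u r = b) :
    Tractable w m := by
  have ha : a ≠ 0 := by rcases hab with h | h <;> [exact h.1.ne'; exact h.1.ne]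
  have hq1 : 1 < q := by
    by_contra hc
    have : (q : ℝ) = 0 ∨ (q : ℝ) = 1 := by
      have : q = 0 ∨ q = 1 := by omega
      exact_mod_cast this
    rcases this with h' | h' <;> rw [h'] at hq <;> rcases hab with h | h <;> linarith
  have hqR : (1 : ℝ) < q := by exact_mod_cast hq1
  have habs : |b| = |a| * q := by rw [hq, abs_mul, Nat.abs_cast, mul_comm]
  have hw : ∀ i < m, w i = |a| ∨ w i = |a| * q := fun i hi => by
    obtain ⟨r, hr⟩ := h.exists_eq hi
    rw [hr, ← habs]
    exact (hv r).imp (congrArg _) (congrArg _)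
  have hpos : 0 < |a| := abs_pos.2 ha
  have hne : |a| < |a| * q := by nlinarith
  refine ⟨h.dec, .inr ⟨|a|, q, fun i => if w i = |a| then 1 else q, hpos, hq1, fun i hi => ?_,
    fun i hi => ?_, fun i j hij hj => ?_⟩⟩
  · split_ifs with h'
    · simp [h']
    · exact (hw i hi).resolve_left h'
  · split_ifs <;> simp
  · have := h.dec i j hij hj
    split_ifs with h1 h2 h2
    · rfl
    · omega
    · rw [(hw j hj).resolve_left h1] at this
      linarith
    · rfl

/-- The distribution of the sorted weights that corresponds to a partition. -/
theorem exists_load (h : IsSorting u w) {S : Fin n → Finset (Fin m)} (hS : IsPartition S) :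
    ∃ g : ℕ → ℕ, (∀ i < m, g i < n) ∧ ∀ t : Fin n, load w g m t = ∑ r ∈ S t, |u r| := by
  obtain ⟨σ, hσ⟩ := h.perm
  choose b hb using hS.2
  have hbS : ∀ r t, r ∈ S t ↔ b r = t := fun r t =>
    ⟨fun hr => by
      by_contra hne
      exact Finset.disjoint_left.1 (hS.1 _ _ hne) (hb r) hr, fun h => h ▸ hb r⟩
  refine ⟨fun i => if hi : i < m then b (σ.symm ⟨i, hi⟩) else 0, fun i hi => ?_, fun t => ?_⟩
  · simp [hi]
  · rw [load, Finset.sum_filter, ← Fin.sum_univ_eq_sum_range (fun i =>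
      if (if hi : i < m then (b (σ.symm ⟨i, hi⟩) : ℕ) else 0) = t then w i else 0),
      ← Equiv.sum_comp σ, ← Finset.sum_filter]
    refine Finset.sum_congr ?_ fun r _ => hσ r
    ext r
    simp [hbS, Fin.ext_iff]

variable {f : ℕ → ℕ} {μ : ℝ}

theorem nonempty_partition (hn : 1 ≤ n) :
    Nonempty {S : Fin n → Finset (Fin m) // IsPartition S} := by
  refine ⟨⟨fun t => if t = ⟨0, hn⟩ then Finset.univ else ∅, fun s t hst => ?_,
    fun r => ⟨⟨0, hn⟩, by simp⟩⟩⟩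
  by_cases hs : s = ⟨0, hn⟩
  · simp [show t ≠ ⟨0, hn⟩ from fun h => hst (hs.trans h.symm)]
  · simp [hs]

/-- If all bundles of a partition are worth some amount, then so are all greedy bundles. Hence every
greedy load, not only the least one, is an upper bound for the maximin share. -/
theorem maximinShare_le_of_goods (h : IsSorting u w) (ht : Tractable w m) (hu : ∀ r, 0 ≤ u r)
    (hn : 1 ≤ n) (hf : IsGreedy w n m f) (hμ : ∃ t < n, load w f m t = μ) :
    maximinShare n u ≤ μ := by
  have := nonempty_partition (m := m) hn
  refine ciSup_le fun S => ?_
  obtain ⟨g, hg, hl⟩ := h.exists_load S.2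
  obtain ⟨t, htn, rfl⟩ := hμ
  refine hf.le_load ht.nonneg ht.noOvershoot hg (fun t ht => ?_) t htn
  rw [hl ⟨t, ht⟩]
  refine (ciInf_le (Set.finite_range _).bddBelow ⟨t, ht⟩).trans (le_of_eq ?_)
  exact Finset.sum_congr rfl fun r _ => (abs_of_nonneg (hu r)).symm

theorem maximinShare_le_of_chores (h : IsSorting u w) (ht : Tractable w m) (hu : ∀ r, u r ≤ 0)
    (hn : 1 ≤ n) (hf : IsGreedy w n m f) (hμ : ∃ t < n, load w f m t = μ) :
    maximinShare n u ≤ -μ := by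
  have := nonempty_partition (m := m) hn
  refine ciSup_le fun S => ?_
  obtain ⟨g, hg, hl⟩ := h.exists_load S.2
  obtain ⟨t, htn, rfl⟩ := hμ
  rw [le_neg]
  refine hf.load_le ht.nonneg ht.noOvershoot hg (fun t ht => ?_) t htn
  rw [hl ⟨t, ht⟩, le_neg]
  refine (ciInf_le (Set.finite_range _).bddBelow ⟨t, ht⟩).trans (le_of_eq ?_)
  rw [bundleValue, ← Finset.sum_neg_distrib]
  exact Finset.sum_congr rfl fun r _ => by rw [abs_of_nonpos (hu r), neg_neg]

end IsSorting

/-! ### Pareto optimality and exchange cycles -/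

/-- No exchange along a cycle, in which every item is replaced by one that is as good for the owner,
improves an owner. -/
def NoStrictCycle {n m : ℕ} (v : Fin n → Fin m → ℝ) (own : Fin m → Fin n) : Prop :=
  ∀ r₀ r₁, v (own r₀) r₀ < v (own r₀) r₁ →
    ¬ Relation.ReflTransGen (fun r r' => v (own r) r ≤ v (own r) r') r₁ r₀

/-- The bundles of the agents, if `own r` receives item `r`. -/
def bundles {n m : ℕ} (own : Fin m → Fin n) (i : Fin n) : Finset (Fin m) :=
  Finset.univ.filter fun r => own r = i

section bundles
variable {n m : ℕ} (v : Fin n → Fin m → ℝ)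

theorem isAllocation_bundles (own : Fin m → Fin n) : IsAllocation (bundles own) := by
  refine ⟨fun s t hst => Finset.disjoint_left.2 fun r h1 h2 => hst ?_, fun r => ⟨own r, by
    simp [bundles]⟩⟩
  rw [← (Finset.mem_filter.1 h1).2, ← (Finset.mem_filter.1 h2).2]

theorem IsAllocation.exists_own {y : Fin n → Finset (Fin m)} (hy : IsAllocation y) :
    ∃ own : Fin m → Fin n, y = bundles own := by
  choose own hown using hy.2
  refine ⟨own, funext fun i => Finset.ext fun r => ?_⟩
  simp only [bundles, Finset.mem_filter, Finset.mem_univ, true_and]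
  refine ⟨fun hr => ?_, fun h => h ▸ hown r⟩
  by_contra hne
  exact Finset.disjoint_left.1 (hy.1 _ _ hne) (hown r) hr

theorem sum_bundleValue (own : Fin m → Fin n) (α : Fin n → ℝ) :
    ∑ i, α i * bundleValue (v i) (bundles own i) = ∑ r, α (own r) * v (own r) r := by
  rw [← Finset.sum_fiberwise (s := Finset.univ) (g := own)]
  refine Finset.sum_congr rfl fun i _ => ?_
  rw [bundleValue, Finset.mul_sum]
  exact Finset.sum_congr rfl fun r hr => by rw [(Finset.mem_filter.1 hr).2]

/-- An allocation that gives every item to an agent of maximum weighted value is Pareto optimal. -/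
theorem isParetoOptimal_of_weights {own : Fin m → Fin n} (α : Fin n → ℝ) (hα : ∀ i, 0 < α i)
    (h : ∀ r i, α i * v i r ≤ α (own r) * v (own r) r) : IsParetoOptimal v (bundles own) := by
  rintro y hy ⟨h1, i, h2⟩
  obtain ⟨p, rfl⟩ := hy.exists_own
  have := Finset.sum_lt_sum (s := Finset.univ)
    (fun i _ => mul_le_mul_of_nonneg_left (h1 i) (hα i).le)
    ⟨i, Finset.mem_univ _, mul_lt_mul_of_pos_left h2 (hα i)⟩
  rw [sum_bundleValue, sum_bundleValue] at this
  exact this.not_ge (Finset.sum_le_sum fun r _ => h r (p r))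

/-- The allocation maximizes a weighted welfare. Start with the agents who own an item of low value
to them, and close up under desired items and their owners: G consists of these agents and T of the
items reached. Agents in G get weight 1 and all others lo / hi. The items of T contribute hi and all
others lo, and no agent could contribute more. -/
theorem NoStrictCycle.isParetoOptimal_of_two_valued {own : Fin m → Fin n}
    (h : NoStrictCycle v own) {lo hi : ℝ} (hlt : lo < hi) (hs : 0 < lo ∨ hi < 0)
    (hv : ∀ i r, v i r = lo ∨ v i r = hi) : IsParetoOptimal v (bundles own) := by
  classical
  set Arc : Fin m → Fin m → Prop := fun r r' => v (own r) r ≤ v (own r) r'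
  let U : Fin n → Prop := fun i => ∃ r, own r = i ∧ v i r = lo
  let T : Fin m → Prop := fun r => ∃ i r', U i ∧ v i r' = hi ∧ Relation.ReflTransGen Arc r' r
  let G : Fin n → Prop := fun i => U i ∨ ∃ r, T r ∧ own r = i
  have hle : ∀ i r, lo ≤ v i r ∧ v i r ≤ hi := fun i r => by
    rcases hv i r with h | h <;> rw [h] <;> exact ⟨by linarith, by linarith⟩
  -- An owner of a reached item with low value accepts any item in exchange, in particular the item
  -- s of an agent who started the search. This closes a cycle in which that agent strictly gains.
  have hT : ∀ r, T r → v (own r) r = hi := by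
    rintro r ⟨i, r', ⟨s, rfl, hsl⟩, hr', hp⟩
    by_contra hc
    have hr := (hv (own r) r).resolve_right hc
    refine h s r' (by rw [hsl, hr']; exact hlt) (hp.tail ?_)
    change v (own r) r ≤ _
    rw [hr]
    exact (hle _ _).1
  have hG : ∀ i r, G i → v i r = hi → T r := by
    rintro i r (hU | ⟨t, ⟨j, r', h1, h2, h3⟩, rfl⟩) hr
    · exact ⟨i, r, hU, hr, .refl⟩
    · refine ⟨j, r', h1, h2, h3.tail ?_⟩
      change _ ≤ v (own t) r
      rw [hr]
      exact (hle _ _).2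
  have hhi : hi ≠ 0 := by rcases hs with h | h <;> linarith
  have hα : 0 < lo / hi := by
    rcases hs with h | h
    · exact div_pos h (by linarith)
    · exact div_pos_of_neg_of_neg (by linarith) h
  have hαhi : lo / hi * hi = lo := div_mul_cancel₀ _ hhi
  have hαlo : lo / hi * lo ≤ lo := by
    rcases hs with h | h
    · have : lo / hi ≤ 1 := by rw [div_le_one (by linarith)]; exact hlt.le
      nlinarith
    · have : 1 ≤ lo / hi := by rw [le_div_iff_of_neg h]; linarith
      nlinarith
  refine isParetoOptimal_of_weights v (fun i => if G i then 1 else lo / hi)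
    (fun i => by split_ifs <;> [exact one_pos; exact hα]) fun r i => ?_
  have hout : ∀ i, lo / hi * v i r ≤ lo := fun i => by
    rcases hv i r with h | h <;> rw [h]
    · exact hαlo
    · exact hαhi.le
  by_cases hr : T r
  · rw [if_pos (show G (own r) from .inr ⟨r, hr, rfl⟩), one_mul, hT r hr]
    split_ifs
    · rw [one_mul]; exact (hle _ _).2
    · exact (hout i).trans hlt.le
  · have h1 : (if G i then 1 else lo / hi) * v i r ≤ lo := by
      split_ifs with hi'
      · rw [one_mul, (hv i r).resolve_right fun h => hr (hG i r hi' h)]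
      · exact hout i
    refine h1.trans (le_of_eq ?_)
    split_ifs with ho
    · rw [one_mul, (hv (own r) r).resolve_right fun h => hr (hG _ r ho h)]
    · rw [(hv (own r) r).resolve_left fun h => ho (.inl ⟨r, rfl, h⟩), hαhi]

end bundles

/-! ### Strict improvements of lexicographic values contain strict cycles -/

section lexicographic
variable {I N : Type*} [Fintype I] [DecidableEq N]

/-- Item `z'`, gained by the agent who loses item `z`, is as good as `z`. -/
def Exchange (w : N → I → ℝ) (o p : I → N) (z z' : I) : Prop :=
  o z = p z' ∧ o z' ≠ p z' ∧ w (o z) z ≤ w (o z) z'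

theorem sum_owned_eq (w : I → ℝ) (o p : I → N) (i : N) :
    ∑ r with p r = i, w r - ∑ r with o r = i, w r =
      ∑ r with p r = i ∧ o r ≠ i, w r - ∑ r with o r = i ∧ p r ≠ i, w r := by
  rw [← Finset.sum_filter_add_sum_filter_not (Finset.univ.filter fun r => p r = i)
      (fun r => o r = i), ← Finset.sum_filter_add_sum_filter_not
      (Finset.univ.filter fun r => o r = i) (fun r => p r = i), Finset.filter_filter,
    Finset.filter_filter, Finset.filter_filter, Finset.filter_filter]
  simp only [and_comm, ne_eq]
  ring

/-- If the best item that agent `i` trades away has no better replacement, then it has at least as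
many equally good ones. -/
theorem card_lost_le_card_gained {w : I → ℝ} (hl : ∀ z, 0 < w z ∧ ∑ r with w r < w z, w r < w z)
    {o p : I → N} {i : N} (hd : ∑ r with o r = i, w r ≤ ∑ r with p r = i, w r) {z : I}
    (hz : ∀ r, p r = i → o r ≠ i → w r ≤ w z) :
    (Finset.univ.filter fun r => (o r = i ∧ p r ≠ i) ∧ w r = w z).card ≤
      (Finset.univ.filter fun r => (p r = i ∧ o r ≠ i) ∧ w r = w z).card := by
  by_contra hc
  have hc' : ((Finset.univ.filter fun r => (p r = i ∧ o r ≠ i) ∧ w r = w z).card : ℝ) + 1 ≤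
      (Finset.univ.filter fun r => (o r = i ∧ p r ≠ i) ∧ w r = w z).card := by
    exact_mod_cast not_le.1 hc
  have h0 := sum_owned_eq w o p i
  have hconst : ∀ (q : I → Prop) [DecidablePred q], ∑ r with q r ∧ w r = w z, w r =
      (Finset.univ.filter fun r => q r ∧ w r = w z).card * w z := fun q _ => by
    rw [← nsmul_eq_mul, ← Finset.sum_const]
    exact Finset.sum_congr rfl fun r hr => (Finset.mem_filter.1 hr).2.2
  have hG := Finset.sum_filter_add_sum_filter_not
    (Finset.univ.filter fun r => p r = i ∧ o r ≠ i) (fun r => w r = w z) w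
  rw [Finset.filter_filter, hconst] at hG
  have hL := Finset.sum_filter_add_sum_filter_not
    (Finset.univ.filter fun r => o r = i ∧ p r ≠ i) (fun r => w r = w z) w
  rw [Finset.filter_filter, hconst] at hL
  have hL0 : 0 ≤ ∑ r ∈ (Finset.univ.filter fun r => o r = i ∧ p r ≠ i) with ¬ w r = w z, w r :=
    Finset.sum_nonneg fun r _ => (hl r).1.le
  have hG0 : ∑ r ∈ (Finset.univ.filter fun r => p r = i ∧ o r ≠ i) with ¬ w r = w z, w r < w z := by
    refine lt_of_le_of_lt (Finset.sum_le_sum_of_subset_of_nonneg (fun r hr => ?_)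
      fun r _ _ => (hl r).1.le) (hl z).2
    simp only [Finset.mem_filter, Finset.mem_univ, true_and] at hr ⊢
    exact lt_of_le_of_ne (hz r hr.1.1 hr.1.2) hr.2
  have := (hl z).1
  nlinarith

/-- A strict improvement for lexicographic weights contains an exchange along a strict cycle. -/
theorem exists_strict_cycle [Fintype N] {w : N → I → ℝ}
    (hl : ∀ i z, 0 < w i z ∧ ∑ r with w i r < w i z, w i r < w i z) {o p : I → N}
    (hd : ∀ i, ∑ r with o r = i, w i r ≤ ∑ r with p r = i, w i r)
    (hs : ∃ i, ∑ r with o r = i, w i r < ∑ r with p r = i, w i r) :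
    ∃ z z', Exchange w o p z z' ∧ w (o z) z < w (o z) z' ∧
      Relation.ReflTransGen (Exchange w o p) z' z := by
  classical
  -- The induction is on the number of items that change hands. Without a strict cycle, part of the
  -- trade turns out to be neutral for everybody; undoing it leaves a smaller trade with the same
  -- values.
  induction hk : (Finset.univ.filter fun r => o r ≠ p r).card using Nat.strong_induction_on
    generalizing p with
  | _ k ih =>
  by_contra H
  push Not at H
  set D := Finset.univ.filter fun r => o r ≠ p r with hD
  have hDne : D.Nonempty := by
    by_contra hempty
    have : o = p := funext fun r => by
      by_contra hr
      exact hempty ⟨r, by simpa [hD] using hr⟩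
    subst this
    obtain ⟨i, hi⟩ := hs
    exact hi.false
  let reach : I → Finset I := fun r =>
    D.filter fun z => Relation.ReflTransGen (Exchange w o p) r z
  -- A smallest reachable set is a strongly connected component without outgoing arcs.
  obtain ⟨r₀, hr₀, hmin⟩ := D.exists_min_image (fun r => (reach r).card) hDne
  set K := reach r₀ with hK
  have hKD : ∀ z ∈ K, o z ≠ p z := fun z hz =>
    (Finset.mem_filter.1 (Finset.mem_filter.1 hz).1).2
  have hr₀K : r₀ ∈ K := Finset.mem_filter.2 ⟨hr₀, .refl⟩
  have hscc : ∀ z ∈ K, ∀ z' ∈ K, Relation.ReflTransGen (Exchange w o p) z z' := by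
    intro z hz z' hz'
    have hsub : reach z ⊆ K := fun y hy => by
      obtain ⟨h1, h2⟩ := Finset.mem_filter.1 hy
      exact Finset.mem_filter.2 ⟨h1, (Finset.mem_filter.1 hz).2.trans h2⟩
    have := Finset.eq_of_subset_of_card_le hsub (hmin z (Finset.mem_filter.1 hz).1)
    rw [← this] at hz'
    exact (Finset.mem_filter.1 hz').2
  have hout : ∀ z ∈ K, ∀ z', Exchange w o p z z' → z' ∈ K := fun z hz z' he =>
    Finset.mem_filter.2 ⟨by simpa [hD] using he.2.1, (Finset.mem_filter.1 hz).2.tail he⟩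
  -- an agent gains nothing better than an item lost within `K`
  have hgain : ∀ z ∈ K, ∀ r, p r = o z → o r ≠ o z → w (o z) r ≤ w (o z) z := by
    intro z hz r hp ho
    by_contra hc
    have he : Exchange w o p z r := ⟨hp.symm, by rwa [hp], (not_le.1 hc).le⟩
    exact H z r he (not_le.1 hc) (hscc r (hout z hz r he) z hz)
  have hcard := fun z hz => card_lost_le_card_gained (hl (o z)) (hd (o z)) (hgain z hz)
  -- all items that an agent loses within `K` are equally good
  have hsame : ∀ z ∈ K, ∀ z' ∈ K, o z = o z' → w (o z) z' ≤ w (o z) z := by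
    intro z hz z' hz' ho
    by_contra hc
    have h1 := hcard z' hz'
    have h2 : 0 < (Finset.univ.filter fun r => (o r = o z' ∧ p r ≠ o z') ∧
        w (o z') r = w (o z') z').card :=
      Finset.card_pos.2 ⟨z', by simpa using (hKD z' hz').symm⟩
    obtain ⟨y, hy⟩ := Finset.card_pos.1 (h2.trans_le h1)
    simp only [Finset.mem_filter, Finset.mem_univ, true_and] at hy
    have := hgain z hz y (by rw [ho]; exact hy.1.1) (by rw [ho]; exact hy.1.2)
    rw [ho, hy.2, ← ho] at this
    exact hc this
  -- The items that an agent loses within K are equally good to the agent, and at least as many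
  -- items of this value are gained. The latter are successors of the former, so they are in K. As
  -- every item of K is lost once and gained once, equality holds for each agent.
  have hle : ∀ i, (K.filter fun r => o r = i).card ≤ (K.filter fun r => p r = i).card := by
    intro i
    by_cases hi : ∃ z ∈ K, o z = i
    · obtain ⟨z, hz, rfl⟩ := hi
      refine le_trans (Finset.card_le_card fun r hr => ?_)
        ((hcard z hz).trans (Finset.card_le_card fun r hr => ?_))
      · obtain ⟨h1, h2⟩ := Finset.mem_filter.1 hr
        have h3 := hsame z hz r h1 h2.symm
        have h4 := hsame r h1 z hz h2
        rw [h2] at h4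
        simp only [Finset.mem_filter, Finset.mem_univ, true_and]
        exact ⟨⟨h2, by rw [← h2]; exact (hKD r h1).symm⟩, le_antisymm h3 h4⟩
      · simp only [Finset.mem_filter, Finset.mem_univ, true_and] at hr
        refine Finset.mem_filter.2 ⟨hout z hz r ⟨hr.1.1.symm, ?_, hr.2.ge⟩, hr.1.1⟩
        rw [hr.1.1]; exact hr.1.2
    · rw [Finset.card_eq_zero.2]
      · exact Nat.zero_le _
      · exact Finset.filter_eq_empty_iff.2 fun r hr h => hi ⟨r, hr, h⟩
  have hsum : ∀ f : I → N, ∑ i, (K.filter fun r => f r = i).card = K.card := fun f =>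
    (Finset.card_eq_sum_card_fiberwise fun r _ => Finset.mem_univ _).symm
  have heq : ∀ i, (K.filter fun r => o r = i).card = (K.filter fun r => p r = i).card := fun i =>
    (Finset.sum_eq_sum_iff_of_le fun i _ => hle i).1 ((hsum o).trans (hsum p).symm) i
      (Finset.mem_univ i)
  have hval : ∀ i, ∑ r ∈ K with o r = i, w i r = ∑ r ∈ K with p r = i, w i r := by
    intro i
    by_cases hi : ∃ z ∈ K, o z = i
    · obtain ⟨z, hz, rfl⟩ := hi
      have e1 : ∀ r ∈ K.filter (fun r => o r = o z), w (o z) r = w (o z) z := fun r hr => by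
        obtain ⟨h1, h2⟩ := Finset.mem_filter.1 hr
        have h3 := hsame z hz r h1 h2.symm
        have h4 := hsame r h1 z hz h2
        rw [h2] at h4
        exact le_antisymm h3 h4
      have e2 : (Finset.univ.filter fun r => (p r = o z ∧ o r ≠ o z) ∧ w (o z) r = w (o z) z) =
          K.filter fun r => p r = o z := by
        refine Finset.eq_of_subset_of_card_le (fun r hr => ?_) ?_
        · simp only [Finset.mem_filter, Finset.mem_univ, true_and] at hr
          refine Finset.mem_filter.2 ⟨hout z hz r ⟨hr.1.1.symm, ?_, hr.2.ge⟩, hr.1.1⟩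
          rw [hr.1.1]; exact hr.1.2
        · rw [← heq]
          refine le_trans (Finset.card_le_card fun r hr => ?_) (hcard z hz)
          have h3 := e1 r hr
          obtain ⟨h1, h2⟩ := Finset.mem_filter.1 hr
          simp only [Finset.mem_filter, Finset.mem_univ, true_and]
          exact ⟨⟨h2, by rw [← h2]; exact (hKD r h1).symm⟩, h3⟩
      rw [Finset.sum_congr rfl e1, ← e2]
      have e3 : ∀ r ∈ Finset.univ.filter fun r =>
          (p r = o z ∧ o r ≠ o z) ∧ w (o z) r = w (o z) z, w (o z) r = w (o z) z := fun r hr =>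
        (Finset.mem_filter.1 hr).2.2
      rw [Finset.sum_congr rfl e3, Finset.sum_const, Finset.sum_const, e2, heq]
    · have h0 : K.filter (fun r => o r = i) = ∅ :=
        Finset.filter_eq_empty_iff.2 fun r hr h => hi ⟨r, hr, h⟩
      have h1 : K.filter (fun r => p r = i) = ∅ := by
        rw [← Finset.card_eq_zero, ← heq, h0, Finset.card_empty]
      rw [h0, h1]
  -- undo the exchange within `K`
  set p' : I → N := fun r => if r ∈ K then o r else p r with hp'
  have hval' : ∀ i, ∑ r with p' r = i, w i r = ∑ r with p r = i, w i r := by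
    intro i
    rw [← Finset.sum_filter_add_sum_filter_not (Finset.univ.filter fun r => p' r = i) (· ∈ K),
      ← Finset.sum_filter_add_sum_filter_not (Finset.univ.filter fun r => p r = i) (· ∈ K)]
    congr 1
    · rw [Finset.filter_filter, Finset.filter_filter]
      have e1 : (Finset.univ.filter fun r => p' r = i ∧ r ∈ K) = K.filter fun r => o r = i := by
        ext r
        simp only [Finset.mem_filter, Finset.mem_univ, true_and, hp']
        constructor
        · rintro ⟨h1, h2⟩; rw [if_pos h2] at h1; exact ⟨h2, h1⟩
        · rintro ⟨h1, h2⟩; rw [if_pos h1]; exact ⟨h2, h1⟩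
      have e2 : (Finset.univ.filter fun r => p r = i ∧ r ∈ K) = K.filter fun r => p r = i := by
        ext r
        simp only [Finset.mem_filter, Finset.mem_univ, true_and]
        tauto
      rw [e1, e2, hval]
    · rw [Finset.filter_filter, Finset.filter_filter]
      refine Finset.sum_congr (Finset.filter_congr fun r _ => and_congr_left fun h => ?_)
        fun _ _ => rfl
      simp only [hp', if_neg h]
  have hsub : (Finset.univ.filter fun r => o r ≠ p' r) ⊂ D := by
    refine Finset.ssubset_iff_subset_ne.2 ⟨fun r hr => ?_, fun h => ?_⟩
    · simp only [Finset.mem_filter, Finset.mem_univ, true_and, hp'] at hr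
      split_ifs at hr with h
      · exact absurd rfl hr
      · simpa [hD] using hr
    · rw [← h] at hr₀
      simp [hp', hr₀K] at hr₀
  have hmono : ∀ z z', Exchange w o p' z z' → Exchange w o p z z' := by
    rintro z z' ⟨h1, h2, h3⟩
    simp only [hp'] at h1 h2
    split_ifs at h1 h2 with h
    · exact absurd rfl h2
    · exact ⟨h1, h2, h3⟩
  obtain ⟨z, z', h1, h2, h3⟩ := ih _ (hk ▸ Finset.card_lt_card hsub) (p := p')
    (fun i => by rw [hval']; exact hd i) (by simpa only [hval'] using hs) rfl
  exact H z z' (hmono _ _ h1) h2 (h3.lift id hmono)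

end lexicographic

/-- For chores a Pareto improvement decreases absolute values. So the old and the new allocation
swap roles in `exists_strict_cycle`, and the arcs of the resulting cycle are reversed. -/
theorem NoStrictCycle.isParetoOptimal_of_lex {n m : ℕ} {v : Fin n → Fin m → ℝ}
    {own : Fin m → Fin n} (h : NoStrictCycle v own) (hs : IsGoods v ∨ IsChores v)
    (hv : WeaklyLexicographicInstance v) : IsParetoOptimal v (bundles own) := by
  rintro y hy ⟨h1, h2⟩
  obtain ⟨p, rfl⟩ := hy.exists_own
  simp only [bundleValue, bundles] at h1 h2
  have hl : ∀ i z, 0 < |v i z| ∧ ∑ r with |v i r| < |v i z|, |v i r| < |v i z| := fun i z =>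
    (hv i).sum_lt (hs.imp (fun h => h i) fun h => h i) z
  rcases hs with hs | hs
  · have habs : ∀ i r, |v i r| = v i r := fun i r => abs_of_nonneg (hs i r)
    obtain ⟨z, z', -, h3, h4⟩ := exists_strict_cycle (w := fun i r => |v i r|) hl
      (o := own) (p := p) (by simpa only [habs] using h1) (by simpa only [habs] using h2)
    simp only [habs] at h3 h4
    refine h z z' h3 (h4.lift id fun a b hab => hab.2.2)
  · have habs : ∀ i r, |v i r| = - v i r := fun i r => abs_of_nonpos (hs i r)
    obtain ⟨z, z', h3, h4, h5⟩ := exists_strict_cycle (w := fun i r => |v i r|) hl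
      (o := p) (p := own)
      (by simpa only [habs, Finset.sum_neg_distrib, neg_le_neg_iff] using h1)
      (by simpa only [habs, Finset.sum_neg_distrib, neg_lt_neg_iff] using h2)
    simp only [habs, neg_lt_neg_iff] at h4
    refine h z' z (by rw [← h3.1]; exact h4) ?_
    rw [← Relation.reflTransGen_swap]
    refine h5.lift id fun a b hab => ?_
    have := hab.2.2
    simp only [habs, neg_le_neg_iff] at this
    change v (own b) b ≤ v (own b) a
    rw [← hab.1]
    exact this

theorem NoStrictCycle.isParetoOptimal {n m : ℕ} {v : Fin n → Fin m → ℝ}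
    {own : Fin m → Fin n} (h : NoStrictCycle v own) (hs : IsGoods v ∨ IsChores v)
    (hv : WeaklyLexicographicInstance v ∨ FactoredBivaluedInstance v) :
    IsParetoOptimal v (bundles own) := by
  rcases hv with hv | ⟨a, b, hab, -, hv⟩
  · exact h.isParetoOptimal_of_lex hs hv
  · rcases hab with hab | hab
    · exact h.isParetoOptimal_of_two_valued v hab.2 (.inl hab.1) hv
    · exact h.isParetoOptimal_of_two_valued v hab.2 (.inr hab.1) fun i r => (hv i r).symm

/-! ### Ranks -/

section rank
variable (V : ℕ → ℝ) (m : ℕ)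

/-- Item `r'` comes before item `r` in the order of decreasing absolute values. -/
def Before (r' r : ℕ) : Prop := |V r| < |V r'| ∨ (¬ |V r'| < |V r| ∧ r' < r)

open Classical in
/-- The number of the items that come before `r`. -/
noncomputable def rank (r : ℕ) : ℕ := ((Finset.range m).filter fun r' => Before V r' r).card

variable {V m}

theorem Before.trans {a b c : ℕ} (h : Before V a b) (h' : Before V b c) : Before V a c := by
  rcases h with h | ⟨h1, h2⟩ <;> rcases h' with h' | ⟨h3, h4⟩
  · exact .inl (h'.trans h)
  · exact .inl ((not_lt.1 h3).trans_lt h)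
  · exact .inl (h'.trans_le (not_lt.1 h1))
  · exact .inr ⟨not_lt.2 ((not_lt.1 h3).trans (not_lt.1 h1)), h2.trans h4⟩

theorem before_irrefl (a : ℕ) : ¬ Before V a a := by
  rintro (h | h)
  · exact h.false
  · exact h.2.false

theorem before_total {a b : ℕ} (h : a ≠ b) : Before V a b ∨ Before V b a := by
  unfold Before
  rcases lt_trichotomy |V a| |V b| with h1 | h1 | h1
  · exact .inr (.inl h1)
  · rcases lt_or_gt_of_ne h with h2 | h2
    · exact .inl (.inr ⟨h1.not_lt, h2⟩)
    · exact .inr (.inr ⟨h1.symm.not_lt, h2⟩)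
  · exact .inl (.inl h1)

theorem rank_lt_of_before {a b : ℕ} (ha : a < m) (h : Before V a b) :
    rank V m a < rank V m b := by
  classical
  unfold rank
  refine Finset.card_lt_card ⟨fun c hc => ?_, fun hsub => ?_⟩
  · rw [Finset.mem_filter] at hc ⊢
    exact ⟨hc.1, hc.2.trans h⟩
  · have := hsub (Finset.mem_filter.2 ⟨Finset.mem_range.2 ha, h⟩)
    exact before_irrefl a (Finset.mem_filter.1 this).2

theorem rank_lt {a : ℕ} (ha : a < m) : rank V m a < m := by
  classical
  unfold rank
  conv_rhs => rw [← Finset.card_range m]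
  refine Finset.card_lt_card ⟨Finset.filter_subset _ _, fun hsub => ?_⟩
  exact before_irrefl a (Finset.mem_filter.1 (hsub (Finset.mem_range.2 ha))).2

theorem rank_injOn : Set.InjOn (rank V m) (Finset.range m) := by
  intro a ha b hb hab
  by_contra hne
  rw [Finset.mem_coe, Finset.mem_range] at ha hb
  rcases before_total (V := V) hne with h | h
  · exact (rank_lt_of_before ha h).ne hab
  · exact (rank_lt_of_before hb h).ne' hab

/-- `w` lists the absolute values of `V` by rank. -/
def ListsByRank (V : ℕ → ℝ) (m : ℕ) (w : ℕ → ℝ) : Prop := ∀ r < m, w (rank V m r) = |V r|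

theorem exists_rank_eq {i : ℕ} (hi : i < m) : ∃ r < m, rank V m r = i := by
  have := Finset.surj_on_of_inj_on_of_card_le (s := Finset.range m) (t := Finset.range m)
    (fun r _ => rank V m r) (fun r hr => Finset.mem_range.2 (rank_lt (Finset.mem_range.1 hr)))
    (fun a b ha hb h => rank_injOn ha hb h) le_rfl i (Finset.mem_range.2 hi)
  obtain ⟨r, hr, h⟩ := this
  exact ⟨r, Finset.mem_range.1 hr, h.symm⟩

variable {w : ℕ → ℝ}

theorem ListsByRank.dec (h : ListsByRank V m w) : DecreasingOn w m := by
  intro i j hij hj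
  obtain ⟨a, ha, rfl⟩ := exists_rank_eq (V := V) (lt_of_le_of_lt hij hj)
  obtain ⟨b, hb, rfl⟩ := exists_rank_eq (V := V) hj
  rw [h a ha, h b hb]
  by_contra hc
  exact (rank_lt_of_before hb (.inl (not_le.1 hc))).not_ge hij

theorem ListsByRank.isSorting (h : ListsByRank V m w) : IsSorting (fun r : Fin m => V r) w where
  dec := h.dec
  perm := by
    refine ⟨Equiv.ofBijective (fun r : Fin m => ⟨rank V m r, rank_lt r.2⟩)
      (Finite.injective_iff_bijective.1 fun a b hab => ?_), fun r => h r r.2⟩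
    exact Fin.ext (rank_injOn (by simp) (by simp) (Fin.mk.inj hab))

/-- If `s` items are taken, then a remaining one is as large as the one of rank `s`. -/
theorem ListsByRank.exists_large (h : ListsByRank V m w) {X : Finset ℕ} {s : ℕ} (hs : s < m)
    (hX : X.card ≤ s) : ∃ r < m, r ∉ X ∧ w s ≤ |V r| := by
  by_contra hc
  push Not at hc
  have hsub : ((Finset.range m).filter fun r => rank V m r ≤ s) ⊆ X := fun r hr => by
    rw [Finset.mem_filter, Finset.mem_range] at hr
    by_contra hrX
    have h1 := hc r hr.1 hrX
    have h2 := h.dec _ _ hr.2 hs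
    rw [h r hr.1] at h2
    linarith
  have hcard : s + 1 ≤ ((Finset.range m).filter fun r => rank V m r ≤ s).card := by
    conv_lhs => rw [← Finset.card_range (s + 1)]
    refine Finset.card_le_card_of_surjOn (rank V m) fun i hi => ?_
    rw [Finset.mem_coe, Finset.mem_range] at hi
    obtain ⟨r, hr, rfl⟩ := exists_rank_eq (V := V) (show i < m by omega)
    exact ⟨r, by simp [hr]; omega, rfl⟩
  have := Finset.card_le_card hsub
  omega

/-- If fewer than `m - s` items are taken, then a remaining one is as small as the one of
rank `s`. -/
theorem ListsByRank.exists_small (h : ListsByRank V m w) {X : Finset ℕ} {s : ℕ}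
    (hX : X.card < m - s) : ∃ r < m, r ∉ X ∧ |V r| ≤ w s := by
  by_contra hc
  push Not at hc
  have hsub : ((Finset.range m).filter fun r => s ≤ rank V m r) ⊆ X := fun r hr => by
    rw [Finset.mem_filter, Finset.mem_range] at hr
    by_contra hrX
    have h1 := hc r hr.1 hrX
    have h2 := h.dec _ _ hr.2 (rank_lt hr.1)
    rw [h r hr.1] at h2
    linarith
  have hcard : m - s ≤ ((Finset.range m).filter fun r => s ≤ rank V m r).card := by
    conv_lhs => rw [← Nat.card_Ico s m]
    refine Finset.card_le_card_of_surjOn (rank V m) fun i hi => ?_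
    rw [Finset.mem_coe, Finset.mem_Ico] at hi
    obtain ⟨r, hr, rfl⟩ := exists_rank_eq (V := V) hi.2
    exact ⟨r, by simp [hr, hi.1], rfl⟩
  have := Finset.card_le_card hsub
  omega

end rank

/-! ### Stages -/

/-- The situation when the agents in `D` have received slots, the slots in `R` are free, and `A`
agents are left. -/
structure Progress (m n : ℕ) (W : ℕ → ℕ → ℝ) (Inv : ℕ → Finset ℕ → ℕ → Prop)
    (ok : ℕ → ℝ → Prop) (A : ℕ) (R D : Finset ℕ) (π : ℕ → ℕ) : Prop where
  sub : R ⊆ Finset.range m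
  agents : D ⊆ Finset.range n
  card : D.card + A = n
  inv : ∀ k < n, k ∉ D → Inv k R A
  ok : ∀ k ∈ D, ok k (∑ s ∈ Finset.range m \ R with π s = k, W k s)
  mem : ∀ s < m, s ∉ R → π s ∈ D
  lt : ∀ s, π s < n

section stages
variable {m n : ℕ} {W : ℕ → ℕ → ℝ} {Inv : ℕ → Finset ℕ → ℕ → Prop} {ok : ℕ → ℝ → Prop} {A : ℕ}
  {R D : Finset ℕ} {π : ℕ → ℕ}

theorem Progress.assign (h : Progress m n W Inv ok (A + 1) R D π) {g : ℕ} (hg : g < n)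
    (hgD : g ∉ D) {B : Finset ℕ} (hB : B ⊆ R) (hok : ok g (∑ s ∈ B, W g s))
    (hinv : ∀ k < n, k ∉ D → k ≠ g → Inv k (R \ B) A) :
    Progress m n W Inv ok A (R \ B) (insert g D) fun s => if s ∈ B then g else π s where
  sub := Finset.sdiff_subset.trans h.sub
  agents := Finset.insert_subset (Finset.mem_range.2 hg) h.agents
  card := by rw [Finset.card_insert_of_notMem hgD, ← h.card]; ring
  inv k hk hkD := by
    rw [Finset.mem_insert, not_or] at hkD
    exact hinv k hk hkD.2 hkD.1
  ok k hk := by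
    rcases Finset.mem_insert.1 hk with rfl | hk
    · convert hok using 2
      ext s
      simp only [Finset.mem_filter, Finset.mem_sdiff, Finset.mem_range]
      constructor
      · rintro ⟨⟨h1, h2⟩, h3⟩
        by_contra hs
        rw [if_neg hs] at h3
        exact hgD (h3 ▸ h.mem s h1 fun hR => h2 ⟨hR, hs⟩)
      · exact fun hs => ⟨⟨Finset.mem_range.1 (h.sub (hB hs)), fun h => h.2 hs⟩, if_pos hs⟩
    · convert h.ok k hk using 2
      ext s
      simp only [Finset.mem_filter, Finset.mem_sdiff, Finset.mem_range]
      constructor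
      · rintro ⟨⟨h1, h2⟩, h3⟩
        split_ifs at h3 with hs
        · exact absurd (h3 ▸ hk) hgD
        · exact ⟨⟨h1, fun hR => h2 ⟨hR, hs⟩⟩, h3⟩
      · rintro ⟨⟨h1, h2⟩, h3⟩
        exact ⟨⟨h1, fun h => h2 h.1⟩, by rw [if_neg fun hs => h2 (hB hs), h3]⟩
  mem s hs hR := by
    by_cases hsB : s ∈ B
    · simp [hsB]
    · simp only [hsB, if_false]
      exact Finset.mem_insert_of_mem (h.mem s hs fun h => hR (Finset.mem_sdiff.2 ⟨h, hsB⟩))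
  lt s := by
    split_ifs
    · exact hg
    · exact h.lt s

theorem Progress.exists_agent (h : Progress m n W Inv ok (A + 1) R D π) : ∃ k < n, k ∉ D := by
  by_contra hc
  push Not at hc
  have := Finset.card_le_card (show Finset.range n ⊆ D from fun k hk =>
    hc k (Finset.mem_range.1 hk))
  rw [Finset.card_range] at this
  have := h.card
  omega

@[simp] theorem heads_zero (K : ℕ) : heads R K 0 = ∅ := by simp [heads]

/-- The agent `g` and the cut `c` chosen in a stage: the first acceptable cut for goods, the last
one for chores. -/
structure StageChoice (m n : ℕ) (W : ℕ → ℕ → ℝ) (ok : ℕ → ℝ → Prop) (chores : Prop) (K : ℕ)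
    (R D : Finset ℕ) (g c : ℕ) : Prop where
  lt : g < n
  notMem : g ∉ D
  le : c ≤ m
  accepts : ok g (∑ s ∈ heads R K c, W g s)
  first : ¬ chores → ∀ c' < c, ∀ k < n, k ∉ D → ¬ ok k (∑ s ∈ heads R K c', W k s)
  last : chores → ∀ c' ≤ m, c < c' → ∀ k < n, k ∉ D → ¬ ok k (∑ s ∈ heads R K c', W k s)

/-- Since the cut is the first acceptable one, every remaining agent rejects the cut before it,
which is the premise of `GoodsInvariant.step`. At cut 0 nothing is removed and `GoodsInvariant.mono`
takes its place. -/
theorem Progress.step_goods {thr : ℕ → ℝ} (hInv : ∀ k < n, GoodsInvariant m (W k) (thr k) (Inv k))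
    (h : Progress m n W Inv (fun k S => thr k ≤ S) (A + 1) R D π) {g c : ℕ} {ch : Prop}
    (hch : ¬ ch) (hc : StageChoice m n W (fun k S => thr k ≤ S) ch (A + 1) R D g c) :
    Progress m n W Inv (fun k S => thr k ≤ S) A (R \ heads R (A + 1) c) (insert g D)
      fun s => if s ∈ heads R (A + 1) c then g else π s := by
  refine h.assign hc.lt hc.notMem (heads_subset _ _ _) hc.accepts fun k hk hkD _ => ?_
  rcases c with _ | c
  · simpa using (hInv k hk).mono R A (h.inv k hk hkD)
  · exact (hInv k hk).step R A c (h.inv k hk hkD)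
      (not_le.1 (hc.first hch c (Nat.lt_succ_self c) k hk hkD))

theorem Progress.exists_ok_goods {thr : ℕ → ℝ}
    (hInv : ∀ k < n, GoodsInvariant m (W k) (thr k) (Inv k))
    (h : Progress m n W Inv (fun k S => thr k ≤ S) (A + 1) R D π) :
    ∃ k < n, k ∉ D ∧ thr k ≤ ∑ s ∈ heads R (A + 1) m, W k s := by
  obtain ⟨k, hk, hkD⟩ := h.exists_agent
  exact ⟨k, hk, hkD, (hInv k hk).le_heads R A (h.inv k hk hkD)⟩

/-- Since the cut is the last acceptable one, either it is m or every remaining agent rejects the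
next one. The last agent tolerates all free slots, so the final cut is m and nothing is left over.
-/
theorem Progress.step_chores {thr : ℕ → ℝ}
    (hInv : ∀ k < n, ChoresInvariant m (W k) (thr k) (Inv k)) (hW : ∀ k < n, ∀ s < m, 0 ≤ W k s)
    (h : Progress m n W Inv (fun k S => S ≤ thr k) (A + 1) R D π) {g c : ℕ} {ch : Prop}
    (hch : ch) (hc : StageChoice m n W (fun k S => S ≤ thr k) ch (A + 1) R D g c) :
    Progress m n W Inv (fun k S => S ≤ thr k) A (R \ heads R (A + 1) c) (insert g D)
      (fun s => if s ∈ heads R (A + 1) c then g else π s) ∧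
    (A = 0 → R \ heads R (A + 1) c = ∅) := by
  have hcm : c < m → ∀ k < n, k ∉ D → thr k < ∑ s ∈ heads R (A + 1) (c + 1), W k s :=
    fun h' k hk hkD => not_le.1 (hc.last hch (c + 1) h' (Nat.lt_succ_self c) k hk hkD)
  have hA : A = 0 → c = m := by
    rintro rfl
    by_contra hne
    have h1 := hcm (lt_of_le_of_ne hc.le hne) g hc.lt hc.notMem
    have h2 := (hInv g hc.lt).last R (h.inv g hc.lt hc.notMem)
    refine h1.not_ge (le_trans (Finset.sum_le_sum_of_subset_of_nonneg (heads_subset _ _ _)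
      fun s hs _ => hW g hc.lt s (Finset.mem_range.1 (h.sub hs))) h2)
  refine ⟨h.assign hc.lt hc.notMem (heads_subset _ _ _) hc.accepts fun k hk hkD hkg => ?_, fun h0 => ?_⟩
  · rcases A with _ | A
    · exfalso
      have h1 := h.card
      have h2 : insert k (insert g D) ⊆ Finset.range n :=
        Finset.insert_subset (Finset.mem_range.2 hk)
          (Finset.insert_subset (Finset.mem_range.2 hc.lt) h.agents)
      have h3 := Finset.card_le_card h2
      rw [Finset.card_insert_of_notMem (by simp [hkg, hkD]),
        Finset.card_insert_of_notMem hc.notMem, Finset.card_range] at h3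
      omega
    · refine (hInv k hk).step R A c (h.inv k hk hkD) hc.le ?_
      rcases hc.le.lt_or_eq with h' | h'
      · exact .inr (hcm h' k hk hkD)
      · exact .inl h'
  · subst h0
    rw [hA rfl, heads_one R h.sub, Finset.sdiff_self]

/-- Slots that no stage has assigned still have an owner according to π. They are a bonus for goods.
-/
theorem Progress.finish_goods {thr : ℕ → ℝ} (hW : ∀ k < n, ∀ s < m, 0 ≤ W k s)
    (h : Progress m n W Inv (fun k S => thr k ≤ S) 0 R D π) {k : ℕ} (hk : k < n) :
    thr k ≤ ∑ s ∈ Finset.range m with π s = k, W k s := by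
  have hD : D = Finset.range n := Finset.eq_of_subset_of_card_le h.agents (by
    rw [Finset.card_range]; exact h.card.ge)
  refine (h.ok k (by simpa [hD] using hk)).trans ?_
  refine Finset.sum_le_sum_of_subset_of_nonneg
    (Finset.filter_subset_filter _ Finset.sdiff_subset) fun s hs _ =>
    hW k hk s (Finset.mem_range.1 (Finset.mem_filter.1 hs).1)

theorem Progress.finish_chores {thr : ℕ → ℝ}
    (h : Progress m n W Inv (fun k S => S ≤ thr k) 0 ∅ D π) {k : ℕ} (hk : k < n) :
    ∑ s ∈ Finset.range m with π s = k, W k s ≤ thr k := by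
  have hD : D = Finset.range n := Finset.eq_of_subset_of_card_le h.agents (by
    rw [Finset.card_range]; exact h.card.ge)
  simpa using h.ok k (by simpa [hD] using hk)

theorem Progress.start (hn : 0 < n) (h : ∀ k < n, Inv k (Finset.range m) n) :
    Progress m n W Inv ok n (Finset.range m) ∅ fun _ => 0 where
  sub := Finset.Subset.refl _
  agents := Finset.empty_subset _
  card := by simp
  inv k hk _ := h k hk
  ok := by simp
  mem s hs h := absurd (Finset.mem_range.2 hs) h
  lt _ := hn

end stages

/-! ### Preparation and sorting

Integer variables `0`, `1` and `2` hold the number of agents, the number of items, and `1` for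
chores, `0` for goods. The tables indexed by agents and items are stored row by row; integer
array `8` holds the offsets of the rows. -/

/-- The memory holds the numbers of agents and items and the offsets. -/
structure Layout (n m : ℕ) (s : Memory) : Prop where
  agents : s.var 0 = n
  items : s.var 1 = m
  offset : ∀ k ≤ n, s.intArr 8 k = k * m

theorem Layout.of_frame {n m c : ℕ} {I R : Finset ℕ} {s s' : Memory} (h : Layout n m s)
    (h' : Frame c I R s s') (hc : 2 ≤ c := by decide) (hI : 8 ∉ I := by decide) :
    Layout n m s' where
  agents := (h'.var 0 (by omega)).trans h.agents
  items := (h'.var 1 (by omega)).trans h.items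
  offset k hk := by rw [h'.int 8 hI]; exact h.offset k hk

theorem index_inj {m i j r t : ℕ} (hr : r < m) (ht : t < m) :
    i * m + r = j * m + t ↔ i = j ∧ r = t := by
  constructor
  · intro h
    have h1 := congrArg (· % m) h
    simp only [Nat.mul_add_mod_self_right, Nat.mod_eq_of_lt hr, Nat.mod_eq_of_lt ht] at h1
    subst h1
    exact ⟨Nat.eq_of_mul_eq_mul_right (by omega) (by omega : i * m = j * m), rfl⟩
  · rintro ⟨rfl, rfl⟩; rfl

theorem index_lt {n m i r : ℕ} (hi : i < n) (hr : r < m) : i * m + r < n * m :=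
  calc i * m + r < i * m + m := by omega
    _ = (i + 1) * m := by ring
    _ ≤ n * m := Nat.mul_le_mul_right m hi

namespace Program

/-- The position of the entry of the agent in variable `k` and the item in variable `r`. -/
def index (k r : ℕ) : IntExpr := .add (.get 8 (.var k)) (.var r)

/-- Compute the offsets. -/
def offsets : Program :=
  .seq (.setInt 8 (.const 0) (.const 0))
    (.forLoop 3 0 (.setInt 8 (.add (.var 3) (.const 1)) (.add (.get 8 (.var 3)) (.var 1))))

/-- Set real array `5` to the absolute values of the utilities. -/
def absolutes : Program :=
  .seq (.setVar 3 (.get 8 (.var 0)))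
    (.forLoop 4 3 (.ite (.realLt (.get 0 (.var 4)) .zero)
      (.setReal 5 (.var 4) (.sub .zero (.get 0 (.var 4))))
      (.setReal 5 (.var 4) (.get 0 (.var 4)))))

/-- Set variable `2` to the kind of the instance. -/
def kind : Program :=
  .ite (.realLt (.get 0 (.const 0)) .zero) (.setVar 2 (.const 1)) (.setVar 2 (.const 0))

/-- Set variable `5` to the rank of item `4` for agent `3`. -/
def countBefore : Program :=
  .seq (.setVar 5 (.const 0)) (.forLoop 6 1
    (.ite (.realLt (.get 5 (index 3 4)) (.get 5 (index 3 6)))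
      (.setVar 5 (.add (.var 5) (.const 1)))
      (.ite (.and (.not (.realLt (.get 5 (index 3 6)) (.get 5 (index 3 4))))
          (.intLt (.var 6) (.var 4)))
        (.setVar 5 (.add (.var 5) (.const 1))) .skip)))

/-- List the absolute values of the utilities of agent `3` by rank in real array `1`. -/
def sortAgent : Program :=
  .forLoop 4 1 (.seq countBefore (.setReal 1 (index 3 5) (.get 5 (index 3 4))))

/-- List the absolute values of the utilities by rank in real array `1`. -/
def sortAll : Program := .forLoop 3 0 sortAgent

end Program

section
variable {N n m : ℕ} {s : Memory}

theorem term_offsets (hn : n ≤ N) (h0 : s.var 0 = n) (h1 : s.var 1 = m) :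
    Term N .offsets s fun s' => Frame 3 {8} ∅ s s' ∧ Layout n m s' := by
  refine .seq (.setInt (.forLoop n hn
    (fun i s' => Frame 3 {8} ∅ s s' ∧ ∀ k ≤ i, s'.intArr 8 k = k * m) ?_ ?_ ?_ ?_))
  · refine ⟨((Frame.refl _ _ _ _).setInt).setVar, fun k hk => ?_⟩
    obtain rfl : k = 0 := by omega
    simp [IntExpr.eval]
  · rintro i s' - ⟨hF, -⟩ -
    rw [hF.var 0 (by decide), h0]
  · rintro i s' - ⟨hF, hI⟩ hx
    refine .setInt ⟨by simpa using hx, ⟨(hF.setInt).setVar, fun k hk => ?_⟩⟩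
    simp only [setVar_intArr, setInt_intArr, if_true, IntExpr.eval, hx, Function.update_apply,
      hF.var 1 (by decide), h1]
    split_ifs with h
    · rw [hI i le_rfl, h]; ring
    · exact hI k (by omega)
  · rintro s' ⟨hF, hI⟩ -
    exact ⟨hF, by rw [hF.var 0 (by decide), h0], by rw [hF.var 1 (by decide), h1], hI⟩

theorem term_absolutes (hN : n * m ≤ N) (hs : Layout n m s) :
    Term N .absolutes s fun s' => Frame 3 ∅ {5} s s' ∧
      ∀ x < n * m, s'.realArr 5 x = |s.realArr 0 x| := by
  refine .seq (.setVar (.forLoop (n * m) hN (fun i s' => Frame 3 ∅ {5} s s' ∧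
    s'.var 3 = n * m ∧ ∀ x < i, s'.realArr 5 x = |s.realArr 0 x|) ?_ ?_ ?_ ?_))
  · refine ⟨((Frame.refl _ _ _ _).setVar).setVar, ?_, fun x hx => absurd hx (Nat.not_lt_zero _)⟩
    simp [IntExpr.eval, hs.agents, hs.offset]
  · rintro i s' - ⟨-, h, -⟩ -
    exact h
  · rintro i s' - ⟨hF, h3, hI⟩ hx
    have h0 := hF.real 0 (by decide)
    refine .ite (fun hb => .setReal ?_) fun hb => .setReal ?_
    all_goals
      refine ⟨by simpa using hx, (hF.setReal).setVar, by simpa using h3, fun x hxi => ?_⟩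
      simp only [Test.Holds, IntExpr.eval, RealExpr.eval, hx, h0] at hb
      simp only [setVar_realArr, setReal_realArr, if_true, IntExpr.eval, RealExpr.eval, hx,
        Function.update_apply, h0]
      split_ifs with h
      · subst h
        first
        | rw [abs_of_neg hb, zero_sub]
        | rw [abs_of_nonneg (not_lt.1 hb)]
      · exact hI x (by omega)
  · rintro s' ⟨hF, -, hI⟩ -
    exact ⟨hF, hI⟩

theorem term_kind : Term N .kind s fun s' => Frame 2 ∅ ∅ s s' ∧
    (s'.var 2 = 1 ∧ s.realArr 0 0 < 0 ∨ s'.var 2 = 0 ∧ 0 ≤ s.realArr 0 0) := by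
  refine .ite (fun h => .setVar ⟨(Frame.refl _ _ _ _).setVar, .inl ⟨?_, h⟩⟩)
    fun h => .setVar ⟨(Frame.refl _ _ _ _).setVar, .inr ⟨?_, not_lt.1 h⟩⟩
  all_goals simp [IntExpr.eval]

variable {V : ℕ → ℝ} {k : ℕ}

theorem eval_index (hs : Layout n m s) {x y : ℕ} (hx : s.var x ≤ n) :
    (Program.index x y).eval s = s.var x * m + s.var y := by
  simp [Program.index, IntExpr.eval, hs.offset _ hx]

theorem term_countBefore (hm : m ≤ N) (hs : Layout n m s) (hk : k < n) (h3 : s.var 3 = k)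
    (hV : ∀ r < m, s.realArr 5 (k * m + r) = |V r|) {r : ℕ} (hr : r < m) (h4 : s.var 4 = r) :
    Term N .countBefore s fun s' => Frame 5 ∅ ∅ s s' ∧ s'.var 5 = rank V m r := by
  classical
  refine .seq (.setVar (.forLoop m hm (fun i s' => Frame 5 ∅ ∅ s s' ∧
    s'.var 5 = ((Finset.range i).filter fun r' => Before V r' r).card) ?_ ?_ ?_ ?_))
  · exact ⟨((Frame.refl _ _ _ _).setVar).setVar, by simp [IntExpr.eval]⟩
  · rintro i s' - ⟨hF, -⟩ -
    exact (hs.of_frame hF).items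
  · rintro i s' hi ⟨hF, hI⟩ hx
    have hs' := hs.of_frame hF
    have h3' := (hF.var 3 (by decide)).trans h3
    have h4' := (hF.var 4 (by decide)).trans h4
    have e4 : s'.realArr 5 ((Program.index 3 4).eval s') = |V r| := by
      rw [eval_index hs' (by omega), h3', h4', hF.real 5 (by decide), hV r hr]
    have e6 : s'.realArr 5 ((Program.index 3 6).eval s') = |V i| := by
      rw [eval_index hs' (by omega), h3', hx, hF.real 5 (by decide), hV i hi]
    have yes : Before V i r → Term N (.setVar 5 (.add (.var 5) (.const 1))) s' fun s'' =>
        s''.var 6 = i ∧ Frame 5 ∅ ∅ s (s''.setVar 6 (i + 1)) ∧ (s''.setVar 6 (i + 1)).var 5 =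
          ((Finset.range (i + 1)).filter fun r' => Before V r' r).card := fun hb => by
      refine .setVar ⟨by simpa using hx, (hF.setVar).setVar, ?_⟩
      rw [Finset.range_add_one, Finset.filter_insert, if_pos hb,
        Finset.card_insert_of_notMem (by simp)]
      simp [IntExpr.eval, hI]
    refine .ite (fun hb => yes (.inl ?_)) fun hb => .ite (fun hb' => yes (.inr ?_))
      fun hb' => .skip ⟨hx, hF.setVar, ?_⟩
    · simpa only [Test.Holds, RealExpr.eval, e4, e6] using hb
    · simpa only [Test.Holds, RealExpr.eval, e4, e6, IntExpr.eval, hx, h4'] using hb'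
    · simp only [Test.Holds, RealExpr.eval, e4, e6, IntExpr.eval, hx, h4'] at hb hb'
      rw [Finset.range_add_one, Finset.filter_insert, if_neg (show ¬ Before V i r from not_or.2 ⟨hb, hb'⟩)]
      simpa using hI
  · rintro s' ⟨hF, hI⟩ -
    refine ⟨hF, ?_⟩
    rw [hI]; unfold rank; congr

theorem term_sortAgent (hm : m ≤ N) (hs : Layout n m s) (hk : k < n) (h3 : s.var 3 = k)
    (hV : ∀ r < m, s.realArr 5 (k * m + r) = |V r|) :
    Term N .sortAgent s fun s' => Frame 4 ∅ {1} s s' ∧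
      ListsByRank V m (fun r => s'.realArr 1 (k * m + r)) ∧
      ∀ k' ≠ k, ∀ r < m, s'.realArr 1 (k' * m + r) = s.realArr 1 (k' * m + r) := by
  refine .forLoop m hm (fun i s' => Frame 4 ∅ {1} s s' ∧
      (∀ r < i, s'.realArr 1 (k * m + rank V m r) = |V r|) ∧
      ∀ k' ≠ k, ∀ r < m, s'.realArr 1 (k' * m + r) = s.realArr 1 (k' * m + r)) ?_ ?_ ?_ ?_
  · exact ⟨(Frame.refl _ _ _ _).setVar, by simp, by simp⟩
  · rintro i s' - ⟨hF, -⟩ -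
    exact (hs.of_frame hF).items
  · rintro i s' hi ⟨hF, hI, hI'⟩ hx
    have h3' := (hF.var 3 (by decide)).trans h3
    refine .seq ((term_countBefore hm (hs.of_frame hF) hk h3' (by rwa [hF.real 5 (by decide)])
      hi hx).mono ?_)
    rintro s'' ⟨hF', h5⟩
    have hF'' := hF.trans hF'
    have hs'' := hs.of_frame hF''
    have h3'' := (hF''.var 3 (by decide)).trans h3
    have h4'' := (hF'.var 4 (by decide)).trans hx
    have hr := rank_lt (V := V) hi
    refine .setReal ⟨by simpa using h4'', (hF''.setReal).setVar, fun r hri => ?_,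
      fun k' hk' r hr => ?_⟩
    · simp only [setVar_realArr, setReal_realArr, if_true, RealExpr.eval,
        eval_index hs'' (h3''.le.trans hk.le), Function.update_apply, h3'', h4'', h5,
        index_inj (rank_lt (V := V) (show r < m by omega)) hr, true_and, hF''.real 5 (by decide),
        hV i hi, hF'.real 1 (by decide)]
      split_ifs with h
      · rw [rank_injOn (by simp; omega) (by simpa using hi) h]
      · refine hI r (lt_of_le_of_ne (by omega) ?_)
        rintro rfl
        exact h rfl
    · simp only [setVar_realArr, setReal_realArr, if_true,
        eval_index hs'' (h3''.le.trans hk.le), Function.update_apply, h3'', h5,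
        index_inj hr (rank_lt (V := V) hi), hk', false_and, if_false, hF'.real 1 (by decide)]
      exact hI' k' hk' r hr
  · rintro s' ⟨hF, hI, hI'⟩ -
    exact ⟨hF, hI, hI'⟩

theorem term_sortAll {V : ℕ → ℕ → ℝ} (hn : n ≤ N) (hm : m ≤ N) (hs : Layout n m s)
    (hV : ∀ k < n, ∀ r < m, s.realArr 5 (k * m + r) = |V k r|) :
    Term N .sortAll s fun s' => Frame 3 ∅ {1} s s' ∧
      ∀ k < n, ListsByRank (V k) m (fun r => s'.realArr 1 (k * m + r)) := by
  refine .forLoop n hn (fun i s' => Frame 3 ∅ {1} s s' ∧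
      ∀ k < i, ListsByRank (V k) m (fun r => s'.realArr 1 (k * m + r))) ?_ ?_ ?_ ?_
  · exact ⟨(Frame.refl _ _ _ _).setVar, by simp⟩
  · rintro i s' - ⟨hF, -⟩ -
    exact (hs.of_frame hF).agents
  · rintro i s' hi ⟨hF, hI⟩ hx
    refine (term_sortAgent hm (hs.of_frame hF) hi hx (by
      rw [hF.real 5 (by decide)]; exact hV i hi)).mono ?_
    rintro s'' ⟨hF', h1, h2⟩
    refine ⟨(hF'.var 3 (by decide)).trans hx, (hF.trans hF').setVar, fun k hk => ?_⟩
    rcases eq_or_ne k i with rfl | hne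
    · exact h1
    · intro r hr
      exact (h2 k hne _ (rank_lt hr)).trans (hI k (by omega) r hr)
  · rintro s' ⟨hF, hI⟩ -
    exact ⟨hF, hI⟩

end

/-! ### Greedy distributions and thresholds -/

namespace Program

/-- Set variable `x` to an index below variable `y` that is best with respect to the test `b`
of whether `x + 1` is better than `x`. -/
def findBest (x y : ℕ) (b : Test) : Program :=
  .seq (.setVar x (.const 0)) (.forLoop (x + 1) y (.ite b (.setVar x (.var (x + 1))) .skip))

/-- Set variable `5` to the bundle of minimum load. -/
def findMin : Program := findBest 5 0 (.realLt (.get 2 (.var 6)) (.get 2 (.var 5)))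

/-- Set variable `5` to the bundle of maximum load. -/
def findMax : Program := findBest 5 0 (.realLt (.get 2 (.var 5)) (.get 2 (.var 6)))

/-- Give every bundle the load zero. -/
def clearLoads : Program := .forLoop 4 0 (.setReal 2 (.var 4) .zero)

/-- Distribute the items of agent `3` greedily. -/
def distribute : Program :=
  .forLoop 4 1 (.seq findMin
    (.setReal 2 (.var 5) (.add (.get 2 (.var 5)) (.get 1 (index 3 4)))))

/-- Set the threshold of agent `3`. -/
def threshold : Program :=
  .seq clearLoads (.seq distribute (.seq (.ite (.intLt (.const 0) (.var 2)) findMax findMin)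
    (.setReal 3 (.var 3) (.get 2 (.var 5)))))

/-- Set the thresholds of all agents. -/
def thresholds : Program := .forLoop 3 0 threshold

end Program

section
variable {N n m : ℕ} {s : Memory}

/-- Variable x holds the best index so far and variable x + 1 the current one. The key in an
arbitrary linear order covers maxima, minima (by the order dual), the choice among admissible items
(with a bottom element) and the search for an index with a property (with values 0 and 1). -/
theorem term_findBest {κ : Type*} [LinearOrder κ] (key : ℕ → κ) {x y K : ℕ} {b : Test}
    (hKN : K ≤ N) (hK : 0 < K) (hyx : y < x) (hy : s.var y = K)
    (hb : ∀ s', Frame x ∅ ∅ s s' → s'.var x < K → s'.var (x + 1) < K →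
      (b.Holds s' ↔ key (s'.var x) < key (s'.var (x + 1)))) :
    Term N (.findBest x y b) s fun s' => Frame x ∅ ∅ s s' ∧ s'.var x < K ∧
      ∀ t < K, key t ≤ key (s'.var x) := by
  refine .seq (.setVar (.forLoop K hKN (fun i s' => Frame x ∅ ∅ s s' ∧ s'.var x < K ∧
    ∀ t < i, key t ≤ key (s'.var x)) ?_ ?_ ?_ ?_))
  · exact ⟨((Frame.refl _ _ _ _).setVar le_rfl).setVar (Nat.le_succ x),
      by simpa [IntExpr.eval] using hK, by simp⟩
  · rintro i s' - ⟨hF, -⟩ -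
    rw [hF.var y hyx, hy]
  · rintro i s' hi ⟨hF, hx, hI⟩ hi'
    have hbb := hb s' hF hx (hi' ▸ hi)
    rw [hi'] at hbb
    refine .ite (fun h => .setVar ?_) fun h => .skip ?_
    · refine ⟨by simp [hi'], (hF.setVar le_rfl).setVar (Nat.le_succ x),
        by simpa [IntExpr.eval, hi'], fun t ht => ?_⟩
      simp only [setVar_var, IntExpr.eval, hi', if_true, (Nat.lt_succ_self x).ne, if_false]
      rcases Nat.lt_succ_iff_lt_or_eq.1 ht with ht | rfl
      · exact (hI t ht).trans (hbb.1 h).le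
      · exact le_rfl
    · refine ⟨hi', hF.setVar (Nat.le_succ x), by simpa using hx, fun t ht => ?_⟩
      simp only [setVar_var, (Nat.lt_succ_self x).ne, if_false]
      rcases Nat.lt_succ_iff_lt_or_eq.1 ht with ht | rfl
      · exact hI t ht
      · exact not_lt.1 fun h' => h (hbb.2 h')
  · rintro s' ⟨hF, hx, hI⟩ -
    exact ⟨hF, hx, hI⟩

theorem term_findMin (hnN : n ≤ N) (hn : 0 < n) (hs : s.var 0 = n) :
    Term N .findMin s fun s' => Frame 5 ∅ ∅ s s' ∧ s'.var 5 < n ∧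
      ∀ t < n, s.realArr 2 (s'.var 5) ≤ s.realArr 2 t :=
  term_findBest (κ := ℝᵒᵈ) (fun t => OrderDual.toDual (s.realArr 2 t)) hnN hn (by decide) hs
    fun s' hF _ _ => by
      simp [Test.Holds, RealExpr.eval, IntExpr.eval, hF.real 2 (by decide)]

theorem term_findMax (hnN : n ≤ N) (hn : 0 < n) (hs : s.var 0 = n) :
    Term N .findMax s fun s' => Frame 5 ∅ ∅ s s' ∧ s'.var 5 < n ∧
      ∀ t < n, s.realArr 2 t ≤ s.realArr 2 (s'.var 5) :=
  term_findBest (s.realArr 2) hnN hn (by decide) hs fun s' hF _ _ => by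
      simp [Test.Holds, RealExpr.eval, IntExpr.eval, hF.real 2 (by decide)]

theorem term_clearLoads (hnN : n ≤ N) (hs : s.var 0 = n) :
    Term N .clearLoads s fun s' => Frame 4 ∅ {2} s s' ∧ ∀ t < n, s'.realArr 2 t = 0 := by
  refine .forLoop n hnN (fun i s' => Frame 4 ∅ {2} s s' ∧ ∀ t < i, s'.realArr 2 t = 0) ?_ ?_ ?_ ?_
  · exact ⟨(Frame.refl _ _ _ _).setVar, by simp⟩
  · rintro i s' - ⟨hF, -⟩ -
    rw [hF.var 0 (by decide), hs]
  · rintro i s' hi ⟨hF, hI⟩ hx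
    refine .setReal ⟨hx, (hF.setReal).setVar, fun t ht => ?_⟩
    simp only [setVar_realArr, setReal_realArr, if_true, IntExpr.eval, hx, Function.update_apply,
      RealExpr.eval]
    split_ifs with h
    · rfl
    · exact hI t (by omega)
  · rintro s' ⟨hF, hI⟩ -
    exact ⟨hF, hI⟩

variable {k : ℕ} {w : ℕ → ℝ}

theorem term_distribute (hnN : n ≤ N) (hmN : m ≤ N) (hs : Layout n m s) (hk : k < n)
    (h3 : s.var 3 = k) (h0 : ∀ t < n, s.realArr 2 t = 0)
    (hw : ∀ i < m, s.realArr 1 (k * m + i) = w i) :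
    Term N .distribute s fun s' => Frame 4 ∅ {2} s s' ∧
      ∃ f, IsGreedy w n m f ∧ ∀ t < n, s'.realArr 2 t = load w f m t := by
  refine .forLoop m hmN (fun i s' => Frame 4 ∅ {2} s s' ∧
    ∃ f, IsGreedy w n i f ∧ ∀ t < n, s'.realArr 2 t = load w f i t) ?_ ?_ ?_ ?_
  · exact ⟨(Frame.refl _ _ _ _).setVar, fun _ => 0, fun j hj => absurd hj (Nat.not_lt_zero _),
      fun t ht => by simpa [load_zero] using h0 t ht⟩
  · rintro i s' - ⟨hF, -⟩ -
    exact (hs.of_frame hF).items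
  · rintro i s' hi ⟨hF, f, hf, hl⟩ hx
    refine .seq ((term_findMin hnN (by omega) (hs.of_frame hF).agents).mono ?_)
    rintro s'' ⟨hF', h5, hmin⟩
    have hF'' := hF.trans hF'
    have hs'' := hs.of_frame hF''
    have h3'' := (hF''.var 3 (by decide)).trans h3
    have h4'' := (hF'.var 4 (by decide)).trans hx
    have hu : ∀ j ≤ i, ∀ t, load w (Function.update f i (s''.var 5)) j t = load w f j t :=
      fun j hj t => load_congr (fun _ _ => rfl)
        (fun l hl => Function.update_of_ne (by omega) _ _) t
    refine .setReal ⟨by simpa using h4'', (hF''.setReal).setVar,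
      Function.update f i (s''.var 5), fun j hj => ?_, fun t ht => ?_⟩
    · rcases Nat.lt_succ_iff_lt_or_eq.1 hj with hj | rfl
      · rw [Function.update_of_ne (by omega)]
        simp only [hu j hj.le]
        exact hf j hj
      · simp only [Function.update_self, hu j le_rfl]
        refine ⟨h5, fun t ht => ?_⟩
        rw [← hl t ht, ← hl _ h5]
        exact hmin t ht
    · simp only [load_succ, hu i le_rfl, Function.update_self, setVar_realArr, setReal_realArr,
        if_true, IntExpr.eval, RealExpr.eval, Function.update_apply, eval_index hs''
        (h3''.le.trans hk.le), h3'', h4'', hF''.real 1 (by decide), hw i hi,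
        hF'.real 2 (by decide)]
      rcases eq_or_ne t (s''.var 5) with rfl | hne
      · simp [hl _ ht]
      · simp [hl _ ht, hne, hne.symm]
  · rintro s' ⟨hF, hI⟩ -
    exact ⟨hF, hI⟩

/-- `μ` is the maximum load for chores and the minimum load for goods. -/
def IsThreshold (n m : ℕ) (w : ℕ → ℝ) (chores : Prop) (μ : ℝ) : Prop :=
  ∃ f, IsGreedy w n m f ∧ (∃ t < n, load w f m t = μ) ∧
    (chores → ∀ t < n, load w f m t ≤ μ) ∧ (¬ chores → ∀ t < n, μ ≤ load w f m t)

theorem term_threshold (hnN : n ≤ N) (hmN : m ≤ N) (hs : Layout n m s) (hk : k < n)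
    (h3 : s.var 3 = k) (hw : ∀ i < m, s.realArr 1 (k * m + i) = w i) :
    Term N .threshold s fun s' => Frame 4 ∅ {2, 3} s s' ∧
      (∀ k' ≠ k, s'.realArr 3 k' = s.realArr 3 k') ∧
      IsThreshold n m w (0 < s.var 2) (s'.realArr 3 k) := by
  refine .seq ((term_clearLoads hnN hs.agents).mono ?_)
  rintro s₁ ⟨hF₁, h0⟩
  refine .seq ((term_distribute hnN hmN (hs.of_frame hF₁) hk
    ((hF₁.var 3 (by decide)).trans h3) h0 (by rwa [hF₁.real 1 (by decide)])).mono ?_)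
  rintro s₂ ⟨hF₂, f, hf, hl⟩
  have hF := hF₁.trans hF₂
  have h2 := hF.var 2 (by decide)
  have finish : ∀ s₃, Frame 5 ∅ ∅ s₂ s₃ → s₃.var 5 < n →
      ((0 < s.var 2) → ∀ t < n, s₂.realArr 2 t ≤ s₂.realArr 2 (s₃.var 5)) →
      ((¬ 0 < s.var 2) → ∀ t < n, s₂.realArr 2 (s₃.var 5) ≤ s₂.realArr 2 t) →
      Term N (.setReal 3 (.var 3) (.get 2 (.var 5))) s₃ fun s' => Frame 4 ∅ {2, 3} s s' ∧
      (∀ k' ≠ k, s'.realArr 3 k' = s.realArr 3 k') ∧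
      IsThreshold n m w (0 < s.var 2) (s'.realArr 3 k) := by
    intro s₃ hF₃ h5 hmax hmin
    have hF' := hF.trans hF₃
    have h3' := (hF'.var 3 (by decide)).trans h3
    refine .setReal ⟨((Frame.refl 4 ∅ {2, 3} s).trans hF').setReal, fun k' hk' => ?_, ?_⟩
    · simp [IntExpr.eval, h3', hk', hF'.real 3 (by decide)]
    · have e : (s₃.setReal 3 ((IntExpr.var 3).eval s₃)
          ((RealExpr.get 2 (.var 5)).eval s₃)).realArr 3 k = s₂.realArr 2 (s₃.var 5) := by
        simp [IntExpr.eval, RealExpr.eval, h3', hF₃.real 2 (by decide)]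
      rw [e]
      refine ⟨f, hf, ⟨_, h5, (hl _ h5).symm⟩, fun hc t ht => ?_, fun hc t ht => ?_⟩
      · rw [← hl t ht]; exact hmax hc t ht
      · rw [← hl t ht]; exact hmin hc t ht
  refine .seq (.ite (fun hb => ?_) fun hb => ?_)
  · simp only [Test.Holds, IntExpr.eval, h2] at hb
    refine (term_findMax hnN (by omega) (hs.of_frame hF).agents).mono ?_
    rintro s₃ ⟨hF₃, h5, h⟩
    exact finish s₃ hF₃ h5 (fun _ => h) fun hc => absurd hb hc
  · simp only [Test.Holds, IntExpr.eval, h2] at hb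
    refine (term_findMin hnN (by omega) (hs.of_frame hF).agents).mono ?_
    rintro s₃ ⟨hF₃, h5, h⟩
    exact finish s₃ hF₃ h5 (fun hc => absurd hc hb) fun _ => h

theorem term_thresholds {W : ℕ → ℕ → ℝ} (hnN : n ≤ N) (hmN : m ≤ N) (hs : Layout n m s)
    (hW : ∀ k < n, ∀ i < m, s.realArr 1 (k * m + i) = W k i) :
    Term N .thresholds s fun s' => Frame 3 ∅ {2, 3} s s' ∧
      ∀ k < n, IsThreshold n m (W k) (0 < s.var 2) (s'.realArr 3 k) := by
  refine .forLoop n hnN (fun i s' => Frame 3 ∅ {2, 3} s s' ∧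
      ∀ k < i, IsThreshold n m (W k) (0 < s.var 2) (s'.realArr 3 k)) ?_ ?_ ?_ ?_
  · exact ⟨(Frame.refl _ _ _ _).setVar, by simp⟩
  · rintro i s' - ⟨hF, -⟩ -
    exact (hs.of_frame hF).agents
  · rintro i s' hi ⟨hF, hI⟩ hx
    refine (term_threshold hnN hmN (hs.of_frame hF) hi hx (by
      rw [hF.real 1 (by decide)]; exact hW i hi)).mono ?_
    rintro s'' ⟨hF', h1, h2⟩
    refine ⟨(hF'.var 3 (by decide)).trans hx, (hF.trans hF').setVar, fun k hk => ?_⟩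
    rcases eq_or_ne k i with rfl | hne
    · rwa [hF.var 2 (by decide)] at h2
    · rw [setVar_realArr, h1 k hne]
      exact hI k (by omega)
  · rintro s' ⟨hF, hI⟩ -
    exact ⟨hF, hI⟩

end

/-! ### The program for a stage -/

namespace Program

/-- Set the values of the bundle under construction to zero. -/
def clearValues : Program := .forLoop 11 0 (.setReal 4 (.var 11) .zero)

/-- Add slot `5` to the bundle under construction. -/
def addSlot : Program :=
  .forLoop 11 0 (.setReal 4 (.var 11) (.add (.get 4 (.var 11)) (.get 1 (index 11 5))))

/-- Decide whether slot `5` belongs to the bundle under construction. -/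
def visit : Program :=
  .seq (.setInt 4 (.var 5) (.const 0)) (.ite (.intLt (.get 2 (.var 5)) (.const 1))
    (.seq (.ite (.intLt (.var 10) (.const 1))
        (.seq (.setInt 4 (.var 5) (.const 1)) addSlot) .skip)
      (.seq (.setVar 10 (.add (.var 10) (.const 1)))
        (.ite (.intLt (.var 10) (.var 4)) .skip (.setVar 10 (.const 0)))))
    .skip)

/-- Agent `11` accepts the bundle under construction. -/
def accepts : Test :=
  .and (.not (.and (.intLt (.const 0) (.var 2))
      (.realLt (.get 3 (.var 11)) (.get 4 (.var 11)))))
    (.not (.and (.intLt (.var 2) (.const 1))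
      (.realLt (.get 4 (.var 11)) (.get 3 (.var 11)))))

/-- Agent `11` is to be chosen with the present bundle. -/
def chosen : Test :=
  .and (.intLt (.get 3 (.var 11)) (.const 1)) (.and accepts
    (.not (.and (.intLt (.var 2) (.const 1)) (.intLt (.const 0) (.var 7)))))

/-- Look for an agent that accepts the bundle under construction. -/
def check : Program :=
  .forLoop 11 0 (.ite chosen
    (.seq (.setVar 7 (.const 1)) (.seq (.setVar 8 (.var 11)) (.setVar 9 (.var 6)))) .skip)

/-- Choose an agent and a cut. -/
def choose : Program :=
  .seq clearValues (.seq (.setVar 10 (.const 0)) (.seq (.setVar 7 (.const 0))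
    (.seq (.setVar 6 (.const 0)) (.seq check (.forLoop 5 1
      (.seq visit (.seq (.setVar 6 (.add (.var 5) (.const 1))) check)))))))

/-- Give the chosen agent the slots of the chosen bundle. -/
def give : Program :=
  .seq (.forLoop 5 9 (.ite (.intLt (.const 0) (.get 4 (.var 5)))
      (.seq (.setInt 1 (.var 5) (.var 8)) (.setInt 2 (.var 5) (.const 1))) .skip))
    (.setInt 3 (.var 8) (.const 1))

/-- Distribute the slots. -/
def stages : Program :=
  .forLoop 3 0 (.seq (.setVar 4 (.sub (.var 0) (.var 3))) (.seq choose give))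

end Program

section heads
variable (R : Finset ℕ) (K i : ℕ)

theorem mem_heads {s c : ℕ} :
    s ∈ heads R K c ↔ s ∈ R ∧ s < c ∧ Nat.count (· ∈ R) s % K = 0 := by
  simp [heads]

theorem heads_succ_of_pos (h : i ∈ R ∧ Nat.count (· ∈ R) i % K = 0) :
    heads R K (i + 1) = insert i (heads R K i) := by
  ext s
  simp only [mem_heads, Finset.mem_insert]
  constructor
  · rintro ⟨h1, h2, h3⟩
    rcases Nat.lt_succ_iff_lt_or_eq.1 h2 with h2 | h2
    · exact .inr ⟨h1, h2, h3⟩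
    · exact .inl h2
  · rintro (rfl | ⟨h1, h2, h3⟩)
    · exact ⟨h.1, Nat.lt_succ_self _, h.2⟩
    · exact ⟨h1, by omega, h3⟩

theorem heads_succ_of_neg (h : ¬ (i ∈ R ∧ Nat.count (· ∈ R) i % K = 0)) :
    heads R K (i + 1) = heads R K i := by
  ext s
  simp only [mem_heads]
  constructor
  · rintro ⟨h1, h2, h3⟩
    rcases Nat.lt_succ_iff_lt_or_eq.1 h2 with h2 | rfl
    · exact ⟨h1, h2, h3⟩
    · exact absurd ⟨h1, h3⟩ h
  · rintro ⟨h1, h2, h3⟩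
    exact ⟨h1, by omega, h3⟩

end heads

/-- An agent accepts bundles of value at most the threshold for chores, and at least the
threshold for goods. -/
def Accepts (chores : Prop) (thr : ℕ → ℝ) (k : ℕ) (x : ℝ) : Prop :=
  (chores → x ≤ thr k) ∧ (¬ chores → thr k ≤ x)

/-- Among the pairs in `P`, agent `g` with cut `c` is the choice, if there is one. -/
structure Selection (Cand P : ℕ → ℕ → Prop) (chores : Prop) (found g c : ℕ) : Prop where
  none : found = 0 → ∀ c' k, P c' k → ¬ Cand c' k
  some : found ≠ 0 → P c g ∧ Cand c g
  first : found ≠ 0 → ¬ chores → ∀ c' < c, ∀ k, P c' k → ¬ Cand c' k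
  last : found ≠ 0 → chores → ∀ c', c < c' → ∀ k, P c' k → ¬ Cand c' k

/-! ### Search for the first or the last acceptable cut -/

section selection
variable {Cand : ℕ → ℕ → Prop} {chores : Prop} {found g c₀ c j : ℕ}

/-- Agent `k` with cut `c'` comes before agent `j` with cut `c`. -/
def Earlier (c j c' k : ℕ) : Prop := c' < c ∨ c' = c ∧ k < j

theorem Selection.take (h : Selection Cand (Earlier c j) chores found g c₀) (hc : Cand c j)
    (h' : chores ∨ found = 0) : Selection Cand (Earlier c (j + 1)) chores 1 j c where
  none h := absurd h one_ne_zero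
  some _ := ⟨.inr ⟨rfl, Nat.lt_succ_self j⟩, hc⟩
  first _ hch c' hc' k _ := h.none (h'.resolve_left hch) c' k (.inl hc')
  last _ _ c' hc' k hk := by rcases hk with h | ⟨h, -⟩ <;> omega

theorem Selection.leave (h : Selection Cand (Earlier c j) chores found g c₀)
    (h' : ¬ Cand c j ∨ (¬ chores ∧ found ≠ 0)) :
    Selection Cand (Earlier c (j + 1)) chores found g c₀ := by
  have key : ∀ c' k, Earlier c (j + 1) c' k → Earlier c j c' k ∨ (c' = c ∧ k = j) := by
    rintro c' k (h | ⟨h1, h2⟩)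
    · exact .inl (.inl h)
    · rcases Nat.lt_succ_iff_lt_or_eq.1 h2 with h2 | h2
      · exact .inl (.inr ⟨h1, h2⟩)
      · exact .inr ⟨h1, h2⟩
  constructor
  · intro hf c' k hk
    rcases key c' k hk with hk | ⟨rfl, rfl⟩
    · exact h.none hf c' k hk
    · exact h'.resolve_right fun h => h.2 hf
  · intro hf
    obtain ⟨h1, h2⟩ := h.some hf
    exact ⟨h1.imp id fun h => ⟨h.1, by omega⟩, h2⟩
  · intro hf hch c' hc' k hk
    rcases key c' k hk with hk | ⟨rfl, rfl⟩
    · exact h.first hf hch c' hc' k hk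
    · rcases (h.some hf).1 with h | h <;> omega
  · intro hf hch c' hc' k hk
    rcases key c' k hk with hk | ⟨rfl, rfl⟩
    · exact h.last hf hch c' hc' k hk
    · exact h'.resolve_right fun h => h.1 hch

theorem Selection.next {n : ℕ} (hn : ∀ c' k, Cand c' k → k < n)
    (h : Selection Cand (Earlier c n) chores found g c₀) :
    Selection Cand (Earlier (c + 1) 0) chores found g c₀ := by
  have key : ∀ c' k, Earlier (c + 1) 0 c' k → Cand c' k → Earlier c n c' k := by
    rintro c' k (h | ⟨-, h⟩) hc
    · rcases Nat.lt_succ_iff_lt_or_eq.1 h with h | h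
      · exact .inl h
      · exact .inr ⟨h, hn c' k hc⟩
    · exact absurd h (Nat.not_lt_zero _)
  constructor
  · exact fun hf c' k hk hc => h.none hf c' k (key _ _ hk hc) hc
  · intro hf
    obtain ⟨h1, h2⟩ := h.some hf
    refine ⟨.inl ?_, h2⟩
    rcases h1 with h | h <;> omega
  · exact fun hf hch c' hc' k hk hc => h.first hf hch c' hc' k (key _ _ hk hc) hc
  · exact fun hf hch c' hc' k hk hc => h.last hf hch c' hc' k (key _ _ hk hc) hc

theorem Selection.start (g c₀ : ℕ) : Selection Cand (Earlier 0 0) chores 0 g c₀ where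
  none _ c' k h := by rcases h with h | ⟨-, h⟩ <;> exact absurd h (Nat.not_lt_zero _)
  some h := absurd rfl h
  first h := absurd rfl h
  last h := absurd rfl h

end selection

section
variable {N n m : ℕ} {s : Memory} {W : ℕ → ℕ → ℝ} {A : ℕ} {R D : Finset ℕ}

theorem term_clearValues (hnN : n ≤ N) (hs : s.var 0 = n) :
    Term N .clearValues s fun s' => Frame 11 ∅ {4} s s' ∧ ∀ k < n, s'.realArr 4 k = 0 := by
  refine .forLoop n hnN (fun i s' => Frame 11 ∅ {4} s s' ∧ ∀ t < i, s'.realArr 4 t = 0) ?_ ?_ ?_ ?_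
  · exact ⟨(Frame.refl _ _ _ _).setVar, by simp⟩
  · rintro i s' - ⟨hF, -⟩ -
    rw [hF.var 0 (by decide), hs]
  · rintro i s' hi ⟨hF, hI⟩ hx
    refine .setReal ⟨hx, (hF.setReal).setVar, fun t ht => ?_⟩
    simp only [setVar_realArr, setReal_realArr, if_true, IntExpr.eval, hx, Function.update_apply,
      RealExpr.eval]
    split_ifs with h
    · rfl
    · exact hI t (by omega)
  · rintro s' ⟨hF, hI⟩ -
    exact ⟨hF, hI⟩

theorem term_addSlot (hnN : n ≤ N) (hs : Layout n m s) {i : ℕ} (h5 : s.var 5 = i)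
    (hW : ∀ k < n, s.realArr 1 (k * m + i) = W k i) :
    Term N .addSlot s fun s' => Frame 11 ∅ {4} s s' ∧
      ∀ k < n, s'.realArr 4 k = s.realArr 4 k + W k i := by
  refine .forLoop n hnN (fun j s' => Frame 11 ∅ {4} s s' ∧
    (∀ k < j, s'.realArr 4 k = s.realArr 4 k + W k i) ∧
    ∀ k, j ≤ k → s'.realArr 4 k = s.realArr 4 k) ?_ ?_ ?_ ?_
  · exact ⟨(Frame.refl _ _ _ _).setVar, by simp, by simp⟩
  · rintro j s' - ⟨hF, -⟩ -
    exact (hs.of_frame hF).agents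
  · rintro j s' hj ⟨hF, hI, hI'⟩ hx
    have h5' := (hF.var 5 (by decide)).trans h5
    refine .setReal ⟨hx, (hF.setReal).setVar, fun k hk => ?_, fun k hk => ?_⟩ <;>
    simp only [setVar_realArr, setReal_realArr, if_true, IntExpr.eval, hx, Function.update_apply,
      RealExpr.eval, eval_index (hs.of_frame hF) (hx.le.trans hj.le), h5',
      hF.real 1 (by decide), hW j hj, hI' j le_rfl]
    · split_ifs with h
      · rw [h]
      · exact hI k (by omega)
    · rw [if_neg (by omega)]
      exact hI' k (by omega)
  · rintro s' ⟨hF, hI, -⟩ -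
    exact ⟨hF, hI⟩

theorem succ_mod {x K : ℕ} (hK : 0 < K) :
    (x + 1) % K = if x % K + 1 < K then x % K + 1 else 0 := by
  rw [← Nat.mod_add_mod]
  split_ifs with h
  · exact Nat.mod_eq_of_lt h
  · rw [show x % K + 1 = K by have := Nat.mod_lt x hK; omega, Nat.mod_self]

theorem term_visit (hnN : n ≤ N) (hs : Layout n m s) {i : ℕ} (h5 : s.var 5 = i)
    (hA : 0 < A) (h4 : s.var 4 = A) (hR : s.intArr 2 i = 0 ↔ i ∈ R)
    (h10 : s.var 10 = Nat.count (· ∈ R) i % A)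
    (hB : ∀ k < n, s.realArr 4 k = ∑ t ∈ heads R A i, W k t)
    (hW : ∀ k < n, s.realArr 1 (k * m + i) = W k i) :
    Term N .visit s fun s' => Frame 10 {4} {4} s s' ∧
      (s'.intArr 4 i ≠ 0 ↔ i ∈ heads R A (i + 1)) ∧
      (∀ x ≠ i, s'.intArr 4 x = s.intArr 4 x) ∧
      s'.var 10 = Nat.count (· ∈ R) (i + 1) % A ∧
      ∀ k < n, s'.realArr 4 k = ∑ t ∈ heads R A (i + 1), W k t := by
  refine .seq (.setInt ?_)
  simp only [IntExpr.eval, h5]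
  have hF₀ : Frame 10 {4} {4} s (s.setInt 4 i 0) := (Frame.refl _ _ _ _).setInt
  by_cases hiR : i ∈ R
  swap
  · have hh := heads_succ_of_neg R A i fun h => hiR h.1
    refine .ite (fun hb => ?_) fun hb => .skip ⟨hF₀, ?_, ?_, ?_, ?_⟩
    · simp [Test.Holds, IntExpr.eval, h5, hR, hiR] at hb
    · simp [mem_heads, hiR]
    · intro x hx; simp [hx]
    · simp [Nat.count_succ, hiR, h10]
    · rw [hh]; simpa using hB
  refine .ite (fun _ => ?_) fun hb => ?_
  swap
  · simp [Test.Holds, IntExpr.eval, h5, hR, hiR] at hb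
  have finish : ∀ s₁, Frame 10 {4} {4} s s₁ → (s₁.intArr 4 i ≠ 0 ↔ i ∈ heads R A (i + 1)) →
      (∀ x ≠ i, s₁.intArr 4 x = s.intArr 4 x) → s₁.var 10 = s.var 10 →
      (∀ k < n, s₁.realArr 4 k = ∑ t ∈ heads R A (i + 1), W k t) →
      Term N (.seq (.setVar 10 (.add (.var 10) (.const 1)))
        (.ite (.intLt (.var 10) (.var 4)) .skip (.setVar 10 (.const 0)))) s₁ fun s' =>
      Frame 10 {4} {4} s s' ∧
      (s'.intArr 4 i ≠ 0 ↔ i ∈ heads R A (i + 1)) ∧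
      (∀ x ≠ i, s'.intArr 4 x = s.intArr 4 x) ∧
      s'.var 10 = Nat.count (· ∈ R) (i + 1) % A ∧
      ∀ k < n, s'.realArr 4 k = ∑ t ∈ heads R A (i + 1), W k t := by
    intro s₁ hF h1 h2 h3 h6
    have h4' := (hF.var 4 (by decide)).trans h4
    have e := succ_mod (x := Nat.count (· ∈ R) i) hA
    refine .seq (.setVar ?_)
    simp only [IntExpr.eval, h3, h10]
    refine .ite (fun hb => .skip ⟨hF.setVar, h1, h2, ?_, h6⟩)
      fun hb => .setVar ⟨(hF.setVar).setVar, h1, h2, ?_, h6⟩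
    all_goals
      simp only [Test.Holds, IntExpr.eval, setVar_var, h4', if_true] at hb
      rw [Nat.count_succ, if_pos hiR, e]
    · rw [if_pos (by simpa using hb)]; simp
    · rw [if_neg (by simpa using hb)]; simp [IntExpr.eval]
  refine .seq (.ite (fun hb => .seq (.setInt ?_)) fun hb => .skip ?_)
  · have hc : Nat.count (· ∈ R) i % A = 0 := by
      simpa [Test.Holds, IntExpr.eval, h10] using hb
    have hh := heads_succ_of_pos R A i ⟨hiR, hc⟩
    simp only [IntExpr.eval, setInt_var, h5]
    have hF₁ : Frame 10 {4} {4} s ((s.setInt 4 i 0).setInt 4 i 1) := hF₀.setInt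
    refine (term_addSlot hnN (hs.of_frame hF₁) h5 hW).mono ?_
    rintro s₁ ⟨hF, hI⟩
    refine finish s₁ (hF₁.trans hF) ?_ ?_ ?_ ?_
    · rw [hF.int 4 (by decide), hh]; simp
    · intro x hx; rw [hF.int 4 (by decide)]; simp [hx]
    · rw [hF.var 10 (by decide)]; simp
    · intro k hk
      rw [hI k hk, hh, Finset.sum_insert (by simp [mem_heads]), add_comm]
      congr 1
      exact hB k hk
  · have hc : Nat.count (· ∈ R) i % A ≠ 0 := by
      simpa [Test.Holds, IntExpr.eval, h10] using hb
    have hh := heads_succ_of_neg R A i fun h => hc h.2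
    refine finish _ hF₀ ?_ ?_ ?_ ?_
    · rw [hh]; simp [mem_heads]
    · intro x hx; simp [hx]
    · simp
    · rw [hh]; simpa using hB

theorem accepts_holds :
    Program.accepts.Holds s ↔
      Accepts (0 < s.var 2) (s.realArr 3) (s.var 11) (s.realArr 4 (s.var 11)) := by
  simp [Program.accepts, Test.Holds, IntExpr.eval, RealExpr.eval, Accepts]

theorem term_check (hnN : n ≤ N) (hs : s.var 0 = n) {Cand : ℕ → ℕ → Prop} {c : ℕ}
    (hn : ∀ c' k, Cand c' k → k < n) (h6 : s.var 6 = c)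
    (hC : ∀ k < n, Cand c k ↔ s.intArr 3 k = 0 ∧
      Accepts (0 < s.var 2) (s.realArr 3) k (s.realArr 4 k))
    (hS : Selection Cand (Earlier c 0) (0 < s.var 2) (s.var 7) (s.var 8) (s.var 9)) :
    Term N .check s fun s' => Frame 7 ∅ ∅ s s' ∧ s'.var 10 = s.var 10 ∧
      Selection Cand (Earlier (c + 1) 0) (0 < s.var 2) (s'.var 7) (s'.var 8) (s'.var 9) := by
  refine .forLoop n hnN (fun j s' => Frame 7 ∅ ∅ s s' ∧ s'.var 10 = s.var 10 ∧
      Selection Cand (Earlier c j) (0 < s.var 2) (s'.var 7) (s'.var 8) (s'.var 9)) ?_ ?_ ?_ ?_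
  · exact ⟨(Frame.refl _ _ _ _).setVar, by simp, by simpa using hS⟩
  · rintro i s' - ⟨hF, -⟩ -
    rw [hF.var 0 (by decide), hs]
  · rintro j s' hj ⟨hF, h10, hI⟩ hx
    have h2 := hF.var 2 (by decide)
    have hb' : Program.chosen.Holds s' ↔ Cand c j ∧ (0 < s.var 2 ∨ s'.var 7 = 0) := by
      rw [hC j hj, Program.chosen, Test.Holds, Test.Holds, Test.Holds, accepts_holds, hx, h2,
        hF.real 3 (by decide), hF.real 4 (by decide)]
      simp only [Test.Holds, IntExpr.eval, hx, h2, hF.int 3 (by decide)]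
      constructor
      · rintro ⟨h1, h2, h3⟩
        exact ⟨⟨by omega, h2⟩, by omega⟩
      · rintro ⟨⟨h1, h2⟩, h3⟩
        exact ⟨by omega, h2, by omega⟩
    refine .ite (fun hb => .seq (.setVar (.seq (.setVar (.setVar ⟨?_, ?_, ?_, ?_⟩)))))
      fun hb => .skip ⟨hx, hF.setVar, by simpa using h10, ?_⟩
    · simpa using hx
    · exact (((hF.setVar).setVar).setVar).setVar
    · simpa using h10
    · have h6' := (hF.var 6 (by decide)).trans h6
      rw [hb'] at hb
      simpa [IntExpr.eval, hx, h6'] using hI.take hb.1 hb.2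
    · rw [hb'] at hb
      have : ¬ Cand c j ∨ (¬ 0 < s.var 2 ∧ s'.var 7 ≠ 0) := by tauto
      simpa using hI.leave this
  · rintro s' ⟨hF, h10, hI⟩ -
    exact ⟨hF, h10, hI.next hn⟩

/-- The agents in `D` are done, the slots in `R` are free. -/
structure StageState (n m : ℕ) (R D : Finset ℕ) (s : Memory) : Prop where
  free : ∀ t < m, s.intArr 2 t = 0 ↔ t ∈ R
  active : ∀ k < n, s.intArr 3 k = 0 ↔ k ∉ D

theorem term_choose (hnN : n ≤ N) (hmN : m ≤ N) (hs : Layout n m s) (hA : 0 < A)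
    (h4 : s.var 4 = A) (hR : StageState n m R D s)
    (hW : ∀ k < n, ∀ i < m, s.realArr 1 (k * m + i) = W k i)
    (hex : ∃ c ≤ m, ∃ k < n, k ∉ D ∧
      Accepts (0 < s.var 2) (s.realArr 3) k (∑ t ∈ heads R A c, W k t)) :
    Term N .choose s fun s' => Frame 5 {4} {4} s s' ∧
      (∀ t < m, s'.intArr 4 t ≠ 0 ↔ t ∈ heads R A m) ∧
      StageChoice m n W (Accepts (0 < s.var 2) (s.realArr 3)) (0 < s.var 2) A R D
        (s'.var 8) (s'.var 9) := by
  set Cand : ℕ → ℕ → Prop := fun c k => k < n ∧ k ∉ D ∧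
    Accepts (0 < s.var 2) (s.realArr 3) k (∑ t ∈ heads R A c, W k t) with hCand
  have hn : ∀ c' k, Cand c' k → k < n := fun _ _ h => h.1
  have hC : ∀ s' c, Frame 5 {4} {4} s s' → (∀ k < n, s'.realArr 4 k = ∑ t ∈ heads R A c, W k t) →
      ∀ k < n, Cand c k ↔ s'.intArr 3 k = 0 ∧
        Accepts (0 < s'.var 2) (s'.realArr 3) k (s'.realArr 4 k) := by
    intro s' c hF hB k hk
    rw [hF.int 3 (by decide), hF.real 3 (by decide), hF.var 2 (by decide), hB k hk,
      hR.active k hk]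
    simp [hCand, hk]
  refine .seq ((term_clearValues hnN hs.agents).mono ?_)
  rintro s₁ ⟨hF₁, h0⟩
  refine .seq (.setVar (.seq (.setVar (.seq (.setVar (.seq ?_))))))
  simp only [IntExpr.eval]
  set s₂ := ((s₁.setVar 10 0).setVar 7 0).setVar 6 0 with hs₂
  have hF₂ : Frame 5 {4} {4} s s₂ :=
    ((((Frame.refl 5 {4} {4} s).trans hF₁).setVar).setVar).setVar
  have v2 : s₂.var 2 = s.var 2 := hF₂.var 2 (by decide)
  -- The empty bundle, cut 0, is offered before the first slot is visited. It is the candidate that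
  -- always exists for chores, and it is the right one for goods with threshold zero.
  refine (term_check hnN (hs.of_frame hF₂).agents (Cand := Cand) (c := 0) hn (by simp [hs₂])
    (hC s₂ 0 hF₂ (by simpa [hs₂] using h0)) (by
      have : s₂.var 7 = 0 := by simp [hs₂]
      rw [this]
      exact Selection.start _ _)).mono ?_
  rintro s₃ ⟨hF₃, h10, hS⟩
  rw [v2] at hS
  refine .forLoop m hmN (fun i s' => Frame 5 {4} {4} s s' ∧
    (∀ t < i, s'.intArr 4 t ≠ 0 ↔ t ∈ heads R A m) ∧
    s'.var 10 = Nat.count (· ∈ R) i % A ∧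
    (∀ k < n, s'.realArr 4 k = ∑ t ∈ heads R A i, W k t) ∧
    Selection Cand (Earlier (i + 1) 0) (0 < s.var 2) (s'.var 7) (s'.var 8) (s'.var 9)) ?_ ?_ ?_ ?_
  · refine ⟨(hF₂.trans hF₃).setVar, by simp, ?_, ?_, ?_⟩
    · simp [h10, hs₂]
    · intro k hk
      simp [hF₃.real 4 (by decide), hs₂, h0 k hk]
    · simpa using hS
  · rintro i s' - ⟨hF, -⟩ -
    exact (hs.of_frame hF).items
  · rintro i s' hi ⟨hF, ht, h10, hB, hS⟩ hx
    refine .seq ((term_visit (W := W) (R := R) hnN (hs.of_frame hF) hx hA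
      ((hF.var 4 (by decide)).trans h4)
      (by rw [hF.int 2 (by decide)]; exact hR.free i hi) h10 hB (fun k hk => by
        rw [hF.real 1 (by decide)]; exact hW k hk i hi)).mono ?_)
    rintro s₄ ⟨hF₄, ht', ht'', h10', hB'⟩
    have hF' := hF.trans hF₄
    refine .seq (.setVar ?_)
    have x4 : s₄.var 5 = i := (hF₄.var 5 (by decide)).trans hx
    simp only [IntExpr.eval, x4]
    have hF'' : Frame 5 {4} {4} s (s₄.setVar 6 (i + 1)) := hF'.setVar
    have v2' := hF''.var 2 (by decide)
    refine (term_check hnN (hs.of_frame hF'').agents (Cand := Cand) (c := i + 1) hn (by simp)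
      (hC _ (i + 1) hF'' (by simpa using hB')) (by
        rw [v2']
        simpa [hF₄.var 7 (by decide), hF₄.var 8 (by decide), hF₄.var 9 (by decide)] using hS)).mono
      ?_
    rintro s₅ ⟨hF₅, h10'', hS'⟩
    rw [v2'] at hS'
    refine ⟨(hF₅.var 5 (by decide)).trans (by simp [x4]), (hF''.trans hF₅).setVar,
      fun t hti => ?_, ?_, ?_, ?_⟩
    · simp only [setVar_intArr, hF₅.int 4 (by decide)]
      rcases Nat.lt_succ_iff_lt_or_eq.1 hti with hti | rfl
      · rw [ht'' t (by omega)]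
        exact ht t hti
      · rw [ht']
        simp [mem_heads, hi]
    · simpa [h10''] using h10'
    · simpa [hF₅.real 4 (by decide)] using hB'
    · simpa using hS'
  · rintro s' ⟨hF, ht, -, -, hS⟩ -
    refine ⟨hF, ht, ?_⟩
    have hf : s'.var 7 ≠ 0 := fun h => by
      obtain ⟨c, hc, k, hk⟩ := hex
      exact hS.none h c k (.inl (by omega)) hk
    obtain ⟨h1, h2, h3, h5⟩ := hS.some hf
    refine ⟨h2, h3, ?_, h5, fun hch c' hc' k hk hkD hok => ?_,
      fun hch c' hcm hc' k hk hkD hok => ?_⟩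
    · rcases h1 with h | ⟨-, h⟩ <;> omega
    · refine hS.first hf hch c' hc' k (.inl ?_) ⟨hk, hkD, hok⟩
      rcases h1 with h | ⟨-, h⟩ <;> omega
    · exact hS.last hf hch c' hc' k (.inl (by omega)) ⟨hk, hkD, hok⟩

/-- The marks in array 4 stem from the scan of all slots, which goes on after the chosen cut. So B
is the set of all heads, and only its part below c is given away. -/
theorem term_give (hmN : m ≤ N) {B : Finset ℕ} {g c : ℕ} (h8 : s.var 8 = g) (h9 : s.var 9 = c)
    (hc : c ≤ m) (ht : ∀ t < m, s.intArr 4 t ≠ 0 ↔ t ∈ B) :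
    Term N .give s fun s' => Frame 5 {1, 2, 3} ∅ s s' ∧
      (s'.intArr 1 = fun t => if t ∈ B ∧ t < c then g else s.intArr 1 t) ∧
      (∀ t < m, s'.intArr 2 t = 0 ↔ s.intArr 2 t = 0 ∧ ¬ (t ∈ B ∧ t < c)) ∧
      ∀ k, s'.intArr 3 k = 0 ↔ s.intArr 3 k = 0 ∧ k ≠ g := by
  refine .seq (.forLoop c (hc.trans hmN) (fun i s' => Frame 5 {1, 2} ∅ s s' ∧
    s'.var 8 = g ∧ s'.var 9 = c ∧
    (∀ t, s'.intArr 1 t = if t ∈ B ∧ t < i then g else s.intArr 1 t) ∧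
    (∀ t < m, s'.intArr 2 t = 0 ↔ s.intArr 2 t = 0 ∧ ¬ (t ∈ B ∧ t < i))) ?_ ?_ ?_ ?_)
  · exact ⟨(Frame.refl _ _ _ _).setVar, by simp [h8], by simp [h9], by simp, by simp⟩
  · rintro i s' - ⟨-, -, h, -⟩ -
    exact h
  · rintro i s' hi ⟨hF, h8', h9', h1, h2⟩ hx
    have hbB : (Test.intLt (.const 0) (.get 4 (.var 5))).Holds s' ↔ i ∈ B := by
      rw [← ht i (by omega)]
      simp [Test.Holds, IntExpr.eval, hx, hF.int 4 (by decide), Nat.pos_iff_ne_zero]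
    refine .ite (fun hb => .seq (.setInt (.setInt ⟨by simpa using hx, ?_, ?_, ?_, ?_, ?_⟩)))
      fun hb => .skip ⟨hx, hF.setVar, by simpa using h8', by simpa using h9', fun t => ?_,
        fun t htm => ?_⟩
    · exact ((hF.setInt).setInt).setVar
    · simpa using h8'
    · simpa using h9'
    · intro t
      rw [hbB] at hb
      simp only [setVar_intArr, setInt_intArr, IntExpr.eval, hx, h8', if_true,
        Function.update_apply, h1, show (1 : ℕ) ≠ 2 by decide, if_false]
      rcases eq_or_ne t i with rfl | hne
      · simp [hb]
      · simp [hne, show t < i + 1 ↔ t < i by omega]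
    · intro t htm
      rw [hbB] at hb
      simp only [setVar_intArr, setInt_intArr, setInt_var, IntExpr.eval, hx, if_true,
        Function.update_apply, show (2 : ℕ) ≠ 1 by decide, if_false]
      rcases eq_or_ne t i with rfl | hne
      · simp [hb]
      · simp [hne, show t < i + 1 ↔ t < i by omega, h2 t htm]
    · rw [hbB] at hb
      rw [setVar_intArr, h1]
      rcases eq_or_ne t i with rfl | hne
      · simp [hb]
      · simp [show t < i + 1 ↔ t < i by omega]
    · rw [hbB] at hb
      rw [setVar_intArr, h2 t htm]
      rcases eq_or_ne t i with rfl | hne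
      · simp [hb]
      · simp [show t < i + 1 ↔ t < i by omega]
  · rintro s' ⟨hF, h8', -, h1, h2⟩ -
    refine .setInt ⟨((Frame.refl 5 {1, 2, 3} ∅ s).trans hF).setInt, ?_, ?_, ?_⟩
    · simpa using funext h1
    · simpa using h2
    · intro k
      simp only [setInt_intArr, if_true, IntExpr.eval, h8', Function.update_apply,
        hF.int 3 (by decide)]
      split_ifs with h <;> simp [h]

end

/-- An invariant for the stages that keeps a threshold. -/
structure StageInvariant (m : ℕ) (w : ℕ → ℝ) (chores : Prop) (μ : ℝ)
    (Inv : Finset ℕ → ℕ → Prop) : Prop where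
  goods : ¬ chores → GoodsInvariant m w μ Inv
  chores : chores → ChoresInvariant m w μ Inv
  nonneg : 0 ≤ μ

section
variable {m n : ℕ} {W : ℕ → ℕ → ℝ} {Inv : ℕ → Finset ℕ → ℕ → Prop} {A : ℕ}
  {R D : Finset ℕ} {π : ℕ → ℕ} {ch : Prop} {thr : ℕ → ℝ}

theorem accepts_of_chores (h : ch) : Accepts ch thr = fun k x => x ≤ thr k := by
  funext k x; simp [Accepts, h]

theorem accepts_of_goods (h : ¬ ch) : Accepts ch thr = fun k x => thr k ≤ x := by
  funext k x; simp [Accepts, h]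

theorem IsThreshold.exists_stageInvariant {w : ℕ → ℝ} {μ : ℝ} (hw : Tractable w m)
    (h : IsThreshold n m w ch μ) :
    ∃ Inv, StageInvariant m w ch μ Inv ∧ Inv (Finset.range m) n := by
  obtain ⟨f, hf, hμ, h1, h2⟩ := h
  have h0 : 0 ≤ μ := by
    obtain ⟨t, -, rfl⟩ := hμ
    exact Finset.sum_nonneg fun i hi =>
      hw.nonneg i (Finset.mem_range.1 (Finset.mem_filter.1 hi).1)
  by_cases hch : ch
  · obtain ⟨Inv, h3, h4⟩ := hw.exists_choresInvariant hf (h1 hch) hμ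
    exact ⟨Inv, ⟨fun h => absurd hch h, fun _ => h3, h0⟩, h4⟩
  · obtain ⟨Inv, h3, h4⟩ := hw.exists_goodsInvariant hf (h2 hch) hμ
    exact ⟨Inv, ⟨fun _ => h3, fun h => absurd h hch, h0⟩, h4⟩

/-- For chores every agent tolerates the empty bundle, as thresholds are non-negative. For goods the
invariant makes the bundle of all heads acceptable. -/
theorem Progress.exists_accepts (hInv : ∀ k < n, StageInvariant m (W k) ch (thr k) (Inv k))
    (h : Progress m n W Inv (Accepts ch thr) (A + 1) R D π) :
    ∃ c ≤ m, ∃ k < n, k ∉ D ∧ Accepts ch thr k (∑ s ∈ heads R (A + 1) c, W k s) := by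
  by_cases hch : ch
  · rw [accepts_of_chores hch] at h ⊢
    obtain ⟨k, hk, hkD⟩ := h.exists_agent
    exact ⟨0, Nat.zero_le _, k, hk, hkD, by simpa using (hInv k hk).nonneg⟩
  · rw [accepts_of_goods hch] at h ⊢
    exact ⟨m, le_rfl, h.exists_ok_goods fun k hk => (hInv k hk).goods hch⟩

theorem Progress.step (hInv : ∀ k < n, StageInvariant m (W k) ch (thr k) (Inv k))
    (hW : ∀ k < n, ∀ s < m, 0 ≤ W k s)
    (h : Progress m n W Inv (Accepts ch thr) (A + 1) R D π) {g c : ℕ}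
    (hc : StageChoice m n W (Accepts ch thr) ch (A + 1) R D g c) :
    Progress m n W Inv (Accepts ch thr) A (R \ heads R (A + 1) c) (insert g D)
      (fun s => if s ∈ heads R (A + 1) c then g else π s) ∧
    (ch → A = 0 → R \ heads R (A + 1) c = ∅) := by
  by_cases hch : ch
  · rw [accepts_of_chores hch] at h hc ⊢
    obtain ⟨h1, h2⟩ := h.step_chores (fun k hk => (hInv k hk).chores hch) hW hch hc
    exact ⟨h1, fun _ => h2⟩
  · rw [accepts_of_goods hch] at h hc ⊢
    exact ⟨h.step_goods (fun k hk => (hInv k hk).goods hch) hch hc, fun h => absurd h hch⟩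

theorem Progress.finish (hW : ∀ k < n, ∀ s < m, 0 ≤ W k s)
    (h : Progress m n W Inv (Accepts ch thr) 0 R D π) (hR : ch → R = ∅) {k : ℕ} (hk : k < n) :
    Accepts ch thr k (∑ s ∈ Finset.range m with π s = k, W k s) := by
  by_cases hch : ch
  · rw [accepts_of_chores hch] at h ⊢
    rw [hR hch] at h
    exact h.finish_chores hk
  · rw [accepts_of_goods hch] at h ⊢
    exact h.finish_goods hW hk

variable {N : ℕ} {s : Memory}

theorem term_stages (hnN : n ≤ N) (hmN : m ≤ N) (hn : 0 < n) (hs : Layout n m s)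
    (hW : ∀ k < n, ∀ i < m, s.realArr 1 (k * m + i) = W k i)
    (hW0 : ∀ k < n, ∀ i < m, 0 ≤ W k i)
    (hInv : ∀ k < n, StageInvariant m (W k) (0 < s.var 2) (s.realArr 3 k) (Inv k))
    (hInv' : ∀ k < n, Inv k (Finset.range m) n)
    (h1 : s.intArr 1 = fun _ => 0) (h2 : s.intArr 2 = fun _ => 0)
    (h3 : s.intArr 3 = fun _ => 0) :
    Term N .stages s fun s' => Frame 3 {1, 2, 3, 4} {4} s s' ∧ (∀ t, s'.intArr 1 t < n) ∧
      ∀ k < n, Accepts (0 < s.var 2) (s.realArr 3) k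
        (∑ t ∈ Finset.range m with s'.intArr 1 t = k, W k t) := by
  refine .forLoop n hnN (fun i s' => Frame 3 {1, 2, 3, 4} {4} s s' ∧ ∃ R D,
    Progress m n W Inv (Accepts (0 < s.var 2) (s.realArr 3)) (n - i) R D (s'.intArr 1) ∧
    StageState n m R D s' ∧ (0 < s.var 2 → i = n → R = ∅)) ?_ ?_ ?_ ?_
  · refine ⟨(Frame.refl _ _ _ _).setVar, Finset.range m, ∅, ?_, ⟨?_, ?_⟩, ?_⟩
    · rw [setVar_intArr, h1]
      exact Progress.start hn hInv'
    · simp [h2]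
    · simp [h3]
    · intro _ h; omega
  · rintro i s' - ⟨hF, -⟩ -
    exact (hs.of_frame hF).agents
  · rintro i s' hi ⟨hF, R, D, hP, hSt, -⟩ hx
    obtain ⟨A, hA⟩ : ∃ A, n - i = A + 1 := ⟨n - i - 1, by omega⟩
    have hA' : n - (i + 1) = A := by omega
    rw [hA] at hP
    have hs' := hs.of_frame hF
    refine .seq (.setVar ?_)
    simp only [IntExpr.eval, hs'.agents, hx, hA]
    have hF₁ : Frame 3 {1, 2, 3, 4} {4} s (s'.setVar 4 (A + 1)) := hF.setVar
    have v2 : s'.var 2 = s.var 2 := hF.var 2 (by decide)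
    have r3 : s'.realArr 3 = s.realArr 3 := hF.real 3 (by decide)
    refine .seq ((term_choose (W := W) (R := R) (D := D) hnN hmN (hs.of_frame hF₁)
      (Nat.succ_pos A) (by simp) ⟨hSt.free, hSt.active⟩
      (by simpa [hF.real 1 (by decide)] using hW) (by
        simpa [v2, r3] using hP.exists_accepts hInv)).mono ?_)
    rintro s₂ ⟨hF₂, ht, hc⟩
    simp only [setVar_var, setVar_realArr, v2, r3, show (2 : ℕ) ≠ 4 by decide, if_false] at hc
    refine (term_give hmN rfl rfl hc.le ht).mono ?_
    rintro s₃ ⟨hF₃, i1, i2, i3⟩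
    have hmem : ∀ t, t ∈ heads R (A + 1) m ∧ t < s₂.var 9 ↔
        t ∈ heads R (A + 1) (s₂.var 9) := fun t => by
      have := hc.le
      simp only [mem_heads]
      constructor
      · rintro ⟨⟨h1, -, h2⟩, h3⟩; exact ⟨h1, h3, h2⟩
      · rintro ⟨h1, h3, h2⟩; exact ⟨⟨h1, by omega, h2⟩, h3⟩
    obtain ⟨hP', hR'⟩ := hP.step hInv hW0 hc
    refine ⟨?_, ((hF₁.trans hF₂).trans hF₃).setVar, R \ heads R (A + 1) (s₂.var 9),
      insert (s₂.var 8) D, ?_, ⟨fun t htm => ?_, fun k hk => ?_⟩, fun hch h => hR' hch (by omega)⟩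
    · rw [hF₃.var 3 (by decide), hF₂.var 3 (by decide)]
      simpa using hx
    · rw [hA', setVar_intArr, i1]
      simp only [hmem, hF₂.int 1 (by decide), setVar_intArr]
      exact hP'
    · rw [setVar_intArr, i2 t htm, hmem, hF₂.int 2 (by decide), setVar_intArr, hSt.free t htm,
        Finset.mem_sdiff]
    · rw [setVar_intArr, i3, hF₂.int 3 (by decide), setVar_intArr, hSt.active k hk,
        Finset.mem_insert, not_or]
      tauto
  · rintro s' ⟨hF, R, D, hP, -, hR⟩ -
    rw [Nat.sub_self] at hP
    exact ⟨hF, hP.lt, fun k hk => hP.finish hW0 (fun h => hR h rfl) hk⟩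

end

/-! ### Picking items -/

namespace Program

/-- Item `7` is better for agent `5` than item `6`, among the items that are not taken. -/
def better : Test :=
  .and (.intLt (.get 5 (.var 7)) (.const 1)) (.not (.and (.intLt (.get 5 (.var 6)) (.const 1))
    (.not (.realLt (.get 0 (index 5 6)) (.get 0 (index 5 7))))))

/-- The owner of slot `4` takes a best item. -/
def pickOne : Program :=
  .seq (.setVar 5 (.get 1 (.var 4))) (.seq (findBest 6 1 better)
    (.seq (.setInt 0 (.var 6) (.var 5)) (.setInt 5 (.var 6) (.const 1))))

/-- The owners of the slots take items, in decreasing order of the slots for chores. -/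
def pick : Program :=
  .forLoop 3 1 (.seq (.ite (.intLt (.const 0) (.var 2))
    (.setVar 4 (.sub (.sub (.var 1) (.const 1)) (.var 3))) (.setVar 4 (.var 3))) pickOne)

end Program

section
variable {N n m : ℕ} {s : Memory} {V : ℕ → ℕ → ℝ}

/-- The value of the items that agent `k` receives. -/
noncomputable def value (m : ℕ) (f : ℕ → ℕ → ℝ) (own : ℕ → ℕ) (k : ℕ) : ℝ :=
  ∑ r ∈ Finset.range m, if own r = k then f k r else 0

theorem term_pickOne (hmN : m ≤ N) (hs : Layout n m s) {t i : ℕ} (h4 : s.var 4 = t)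
    (hi : s.intArr 1 t = i) (hin : i < n)
    (hV : ∀ r < m, s.realArr 0 (i * m + r) = V i r) (hex : ∃ r < m, s.intArr 5 r = 0) :
    Term N .pickOne s fun s' => Frame 5 {0, 5} ∅ s s' ∧ ∃ r < m, s.intArr 5 r = 0 ∧
      (∀ r' < m, s.intArr 5 r' = 0 → V i r' ≤ V i r) ∧
      s'.intArr 0 = Function.update (s.intArr 0) r i ∧
      s'.intArr 5 = Function.update (s.intArr 5) r 1 := by
  refine .seq (.setVar ?_)
  simp only [IntExpr.eval, h4, hi]
  have hF₁ : Frame 5 {0, 5} ∅ s (s.setVar 5 i) := (Frame.refl _ _ _ _).setVar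
  have hs₁ := hs.of_frame hF₁
  have hm : 0 < m := by obtain ⟨r, hr, -⟩ := hex; omega
  -- Taken items get the key ⊥, below every utility, so a best item is free as soon as some item is.
  set key : ℕ → WithBot ℝ := fun r => if s.intArr 5 r = 0 then (V i r : WithBot ℝ) else ⊥
    with hkey
  refine .seq ((term_findBest key hmN hm (by decide) hs₁.items fun s' hF hx hx' => ?_).mono ?_)
  · have h5' : s'.var 5 = i := by rw [hF.var 5 (by decide)]; simp
    have e : ∀ x, s'.var x < m →
        s'.realArr 0 ((Program.index 5 x).eval s') = V i (s'.var x) := fun x hx => by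
      rw [eval_index (hs₁.of_frame hF) (h5'.le.trans hin.le), h5', hF.real 0 (by decide),
        setVar_realArr, hV _ hx]
    simp only [Program.better, Test.Holds, RealExpr.eval, e 6 hx, e 7 hx', IntExpr.eval,
      hF.int 5 (by decide), setVar_intArr, hkey, Nat.lt_one_iff]
    by_cases h7 : s.intArr 5 (s'.var 7) = 0 <;> by_cases h6 : s.intArr 5 (s'.var 6) = 0 <;>
      simp [h6, h7]
  · rintro s₂ ⟨hF₂, h6, hmax⟩
    have hfree : s.intArr 5 (s₂.var 6) = 0 := by
      obtain ⟨r, hr, hr0⟩ := hex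
      by_contra hne
      have := hmax r hr
      simp [hkey, hr0, hne] at this
    have h5' : s₂.var 5 = i := by rw [hF₂.var 5 (by decide)]; simp
    refine .seq (.setInt (.setInt ⟨((hF₁.trans hF₂).setInt).setInt, s₂.var 6, h6, hfree,
      fun r' hr' hr0 => ?_, ?_, ?_⟩))
    · have := hmax r' hr'
      simpa [hkey, hr0, hfree] using this
    · simp [IntExpr.eval, h5', hF₂.int 0 (by decide)]
    · simp [IntExpr.eval, hF₂.int 5 (by decide)]

theorem value_update {f : ℕ → ℕ → ℝ} {own : ℕ → ℕ} {r i k : ℕ} (hr : r < m) :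
    value m f (Function.update own r i) k =
      value m f own k + (if i = k then f k r else 0) - (if own r = k then f k r else 0) := by
  have h : ∀ own : ℕ → ℕ, value m f own k = (if own r = k then f k r else 0) +
      ∑ r' ∈ (Finset.range m).erase r, if own r' = k then f k r' else 0 := fun own =>
    (Finset.add_sum_erase _ _ (Finset.mem_range.2 hr)).symm
  rw [h, h own, Function.update_self, Finset.sum_congr rfl fun r' hr' => by
    rw [Function.update_of_ne (Finset.ne_of_mem_erase hr')]]
  ring

/-- The slot whose owner takes an item at time `t`. -/
noncomputable def slotAt (m : ℕ) (chores : Prop) (t : ℕ) : ℕ :=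
  open Classical in if chores then m - 1 - t else t

/-- The sign of the utilities. -/
noncomputable def signOf (chores : Prop) : ℝ := open Classical in if chores then -1 else 1

theorem sum_slotAt {chores : Prop} (F : ℕ → ℝ) :
    ∑ t ∈ Finset.range m, F (slotAt m chores t) = ∑ t ∈ Finset.range m, F t := by
  unfold slotAt
  split_ifs
  · exact Finset.sum_range_reflect F m
  · rfl

/-- At time t at most t items are gone. For goods, t + 1 items are as large as slot t. For chores, t
+ 1 items are as small in absolute value as slot m - 1 - t, which is why the slots are served
backwards. -/
theorem exists_good_item {w v : ℕ → ℝ} {chores : Prop} (hw : ListsByRank v m w)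
    (hv : ∀ r < m, 0 ≤ signOf chores * v r) {X : Finset ℕ} {t : ℕ} (ht : t < m)
    (hX : X.card ≤ t) : ∃ r < m, r ∉ X ∧ signOf chores * w (slotAt m chores t) ≤ v r := by
  unfold signOf at hv ⊢
  unfold slotAt
  split_ifs at hv ⊢
  · obtain ⟨r, hr, hrX, h⟩ := hw.exists_small (s := m - 1 - t) (X := X) (by omega)
    have := hv r hr
    rw [abs_of_nonpos (by linarith)] at h
    exact ⟨r, hr, hrX, by linarith⟩
  · obtain ⟨r, hr, hrX, h⟩ := hw.exists_large ht hX
    have := hv r hr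
    rw [abs_of_nonneg (by linarith)] at h
    exact ⟨r, hr, hrX, by linarith⟩

/-- At each turn the item taken is at least as good for the owner as the slot. Summed over the slots
of an agent, the items are worth at least the slots, with the sign of the utilities. -/
theorem term_pick {W : ℕ → ℕ → ℝ} (hmN : m ≤ N) (hs : Layout n m s)
    (hV : ∀ k < n, ∀ r < m, s.realArr 0 (k * m + r) = V k r)
    (hW : ∀ k < n, ListsByRank (V k) m (W k))
    (hsign : ∀ k < n, ∀ r < m, 0 ≤ signOf (0 < s.var 2) * V k r)
    (h1 : ∀ t, s.intArr 1 t < n) (h5 : s.intArr 5 = fun _ => 0) :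
    Term N .pick s fun s' => Frame 3 {0, 5} ∅ s s' ∧ (∀ r < m, s'.intArr 0 r < n) ∧
      ∀ k < n, signOf (0 < s.var 2) * ∑ t ∈ Finset.range m with s.intArr 1 t = k, W k t ≤
        value m V (s'.intArr 0) k := by
  set ch : Prop := 0 < s.var 2 with hch
  refine .forLoop m hmN (fun i s' => Frame 3 {0, 5} ∅ s s' ∧
    ((Finset.range m).filter fun r => s'.intArr 5 r ≠ 0).card = i ∧
    (∀ r < m, s'.intArr 5 r ≠ 0 → s'.intArr 0 r < n) ∧
    ∀ k < n, ∑ t ∈ Finset.range i,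
        (if s.intArr 1 (slotAt m ch t) = k then signOf ch * W k (slotAt m ch t) else 0) ≤
      ∑ r ∈ Finset.range m with s'.intArr 5 r ≠ 0, if s'.intArr 0 r = k then V k r else 0)
    ?_ ?_ ?_ ?_
  · exact ⟨(Frame.refl _ _ _ _).setVar, by simp [h5], by simp [h5], by simp [h5]⟩
  · rintro i s' - ⟨hF, -⟩ -
    exact (hs.of_frame hF).items
  · rintro i s' hi ⟨hF, hcard, hown, hval⟩ hx
    have hs' := hs.of_frame hF
    have v2 := hF.var 2 (by decide)
    have key : Term N .pickOne (s'.setVar 4 (slotAt m ch i)) fun s'' => s''.var 3 = i ∧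
        Frame 3 {0, 5} ∅ s (s''.setVar 3 (i + 1)) ∧
        ((Finset.range m).filter fun r => (s''.setVar 3 (i + 1)).intArr 5 r ≠ 0).card = i + 1 ∧
        (∀ r < m, (s''.setVar 3 (i + 1)).intArr 5 r ≠ 0 →
          (s''.setVar 3 (i + 1)).intArr 0 r < n) ∧
        ∀ k < n, ∑ t ∈ Finset.range (i + 1),
          (if s.intArr 1 (slotAt m ch t) = k then signOf ch * W k (slotAt m ch t) else 0) ≤
          ∑ r ∈ Finset.range m with (s''.setVar 3 (i + 1)).intArr 5 r ≠ 0,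
            if (s''.setVar 3 (i + 1)).intArr 0 r = k then V k r else 0 := by
      set j := s.intArr 1 (slotAt m ch i) with hj
      have hjn : j < n := h1 _
      have hF₁ : Frame 3 {0, 5} ∅ s (s'.setVar 4 (slotAt m ch i)) := hF.setVar
      obtain ⟨r₀, hr₀, hr₀X, hr₀V⟩ := exists_good_item (hW j hjn) (hsign j hjn) hi hcard.le
      simp only [Finset.mem_filter, Finset.mem_range, hr₀, true_and, ne_eq, not_not] at hr₀X
      refine (term_pickOne (V := V) hmN (hs.of_frame hF₁) (t := slotAt m ch i) (i := j) (by simp)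
        (by simp [hF.int 1 (by decide), hj]) hjn
        (by simpa [hF.real 0 (by decide)] using hV j hjn) ⟨r₀, hr₀, by simpa using hr₀X⟩).mono ?_
      rintro s'' ⟨hF₂, r, hr, hr5, hbest, e0, e5⟩
      simp only [setVar_intArr] at hr5 hbest e0 e5
      have hset : ((Finset.range m).filter fun r' => s''.intArr 5 r' ≠ 0) =
          insert r ((Finset.range m).filter fun r' => s'.intArr 5 r' ≠ 0) := by
        ext r'
        simp only [e5, Finset.mem_filter, Finset.mem_range, Finset.mem_insert,
          Function.update_apply]
        rcases eq_or_ne r' r with rfl | hne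
        · simp [hr]
        · simp [hne]
      have hnot : r ∉ ((Finset.range m).filter fun r' => s'.intArr 5 r' ≠ 0) := by simp [hr5]
      refine ⟨?_, (hF₁.trans hF₂).setVar, ?_, ?_, fun k hk => ?_⟩
      · rw [hF₂.var 3 (by decide)]; simpa using hx
      · change ((Finset.range m).filter fun r' => s''.intArr 5 r' ≠ 0).card = i + 1
        rw [hset, Finset.card_insert_of_notMem hnot, hcard]
      · intro r' hr' h
        simp only [setVar_intArr, e0, e5, Function.update_apply] at h ⊢
        split_ifs with hrr
        · exact hjn
        · rw [if_neg hrr] at h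
          exact hown r' hr' h
      · change _ ≤ ∑ r ∈ Finset.range m with s''.intArr 5 r ≠ 0,
          if s''.intArr 0 r = k then V k r else 0
        rw [hset, Finset.sum_insert hnot, Finset.sum_range_succ, add_comm]
        refine add_le_add ?_ ((hval k hk).trans (le_of_eq (Finset.sum_congr rfl fun r' hr' => ?_)))
        · rw [e0, Function.update_self, ← hj]
          split_ifs with h
          · subst h
            exact hr₀V.trans (hbest r₀ hr₀ hr₀X)
          · exact le_rfl
        · rw [e0, Function.update_of_ne]
          rintro rfl
          exact hnot hr'
    refine .seq (.ite (fun hb => .setVar ?_) fun hb => .setVar ?_)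
    all_goals
      simp only [Test.Holds, IntExpr.eval, v2] at hb
      rw [← hch] at hb
    · simpa [IntExpr.eval, hs'.items, hx, slotAt, hb] using key
    · simpa [IntExpr.eval, hx, slotAt, hb] using key
  · rintro s' ⟨hF, hcard, hown, hval⟩ -
    have hall : ((Finset.range m).filter fun r => s'.intArr 5 r ≠ 0) = Finset.range m :=
      Finset.eq_of_subset_of_card_le (Finset.filter_subset _ _) (by rw [hcard, Finset.card_range])
    have hall' : ∀ r < m, s'.intArr 5 r ≠ 0 := fun r hr => by
      rw [← Finset.mem_range, ← hall] at hr
      exact (Finset.mem_filter.1 hr).2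
    refine ⟨hF, fun r hr => hown r hr (hall' r hr), fun k hk => ?_⟩
    have := hval k hk
    rw [hall, sum_slotAt fun t => if s.intArr 1 t = k then signOf ch * W k t else 0] at this
    rwa [Finset.mul_sum, Finset.sum_filter]

end

/-! ### Exchanging items along cycles -/

namespace Program

/-- The position of the entry of the owner of item `x` and item `y`. -/
def ownIndex (x y : ℕ) : IntExpr := .add (.get 8 (.get 0 (.var x))) (.var y)

/-- Item `10` is not reached, item `11` is reached, and the owner of item `10` weakly prefers
item `11`. -/
def canExtend : Test :=
  .and (.intLt (.get 6 (.var 10)) (.const 1)) (.and (.intLt (.const 0) (.get 6 (.var 11)))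
    (.not (.realLt (.get 0 (ownIndex 10 11)) (.get 0 (ownIndex 10 10)))))

/-- Look for an item `11` by which the search can be extended to item `10`. -/
def findArcFrom : Program :=
  .forLoop 11 1 (.ite canExtend
    (.seq (.setVar 7 (.const 1)) (.seq (.setVar 8 (.var 10)) (.setVar 9 (.var 11)))) .skip)

/-- Look for an item to which the search can be extended. -/
def findArc : Program := .seq (.setVar 7 (.const 0)) (.forLoop 10 1 findArcFrom)

/-- Find the items from which item `4` can be reached. -/
def reach : Program :=
  .seq (.forLoop 5 1 (.setInt 6 (.var 5) (.const 0)))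
    (.seq (.setInt 6 (.var 4) (.const 1)) (.seq (.setVar 5 (.const 1)) (.seq (.setVar 7 (.const 1))
      (.loop (.intLt (.const 0) (.var 7)) (.seq findArc (.ite (.intLt (.const 0) (.var 7))
        (.seq (.setVar 5 (.add (.var 5) (.const 1)))
          (.seq (.setInt 6 (.var 8) (.var 5)) (.setInt 7 (.var 8) (.var 9)))) .skip))))))

/-- Item `x` is reached, and the owner of item `4` strictly prefers it. -/
def closes (x : ℕ) : Test :=
  .and (.intLt (.const 0) (.get 6 (.var x))) (.realLt (.get 0 (ownIndex 4 4)) (.get 0 (ownIndex 4 x)))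

/-- Exchange the items along the path from item `5` to item `4`. -/
def rotate : Program :=
  .seq (.setVar 6 (.var 5)) (.loop (.not (.and (.not (.intLt (.var 6) (.var 4)))
      (.not (.intLt (.var 4) (.var 6)))))
    (.seq (.setVar 7 (.get 0 (.var 4))) (.seq (.setInt 0 (.var 4) (.get 0 (.var 6)))
      (.seq (.setInt 0 (.var 6) (.var 7)) (.setVar 6 (.get 7 (.var 6)))))))

/-- Exchange the items along a cycle through item `4`, if possible. -/
def tryItem : Program :=
  .seq reach (.seq (findBest 5 1 (.and (.not (closes 5)) (closes 6)))
    (.ite (closes 5) (.seq rotate (.setVar 3 (.const 1))) .skip))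

/-- Exchange items along cycles as long as possible. -/
def improve : Program :=
  .seq (.setVar 3 (.const 1)) (.loop (.intLt (.const 0) (.var 3))
    (.seq (.setVar 3 (.const 0)) (.forLoop 4 1 (.ite (.intLt (.var 3) (.const 1)) tryItem .skip))))

end Program

section
variable {N n m : ℕ} {s : Memory} {V : ℕ → ℕ → ℝ}

/-- The owner of item `r` weakly prefers item `r'`. -/
def Arc (V : ℕ → ℕ → ℝ) (own : ℕ → ℕ) (r r' : ℕ) : Prop := V (own r) r ≤ V (own r) r'

/-- The memory holds the utilities `V` and a valid assignment of the items. -/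
structure Assigned (n m : ℕ) (V : ℕ → ℕ → ℝ) (s : Memory) : Prop extends Layout n m s where
  utilities : ∀ k < n, ∀ r < m, s.realArr 0 (k * m + r) = V k r
  owner : ∀ r < m, s.intArr 0 r < n

theorem Assigned.of_frame {c : ℕ} {I R : Finset ℕ} {s s' : Memory} (h : Assigned n m V s)
    (h' : Frame c I R s s') (hc : 2 ≤ c := by decide) (hI : 8 ∉ I := by decide)
    (hI' : 0 ∉ I := by decide) (hR : 0 ∉ R := by decide) : Assigned n m V s' where
  toLayout := h.toLayout.of_frame h' hc hI
  utilities := by rw [h'.real 0 hR]; exact h.utilities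
  owner := by rw [h'.int 0 hI']; exact h.owner

theorem Assigned.eval_ownIndex (hs : Assigned n m V s) {x y : ℕ} (hx : s.var x < m)
    (hy : s.var y < m) :
    s.realArr 0 ((Program.ownIndex x y).eval s) = V (s.intArr 0 (s.var x)) (s.var y) := by
  have h := hs.owner _ hx
  rw [← hs.utilities _ h _ hy]
  simp [Program.ownIndex, IntExpr.eval, hs.offset _ h.le]

/-- The search can be extended from `b` to `a`. -/
def Extends (V : ℕ → ℕ → ℝ) (own seen : ℕ → ℕ) (a b : ℕ) : Prop :=
  seen a = 0 ∧ seen b ≠ 0 ∧ Arc V own a b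

/-- Among the pairs in `P`, the pair `(a, b)` is an extension, if there is one. -/
def FoundArc (m : ℕ) (V : ℕ → ℕ → ℝ) (own seen : ℕ → ℕ) (P : ℕ → ℕ → Prop) (f a b : ℕ) : Prop :=
  (f = 0 → ∀ r r', P r r' → r < m → r' < m → ¬ Extends V own seen r r') ∧
    (f ≠ 0 → a < m ∧ b < m ∧ Extends V own seen a b)

theorem term_findArcFrom (hmN : m ≤ N) (hs : Assigned n m V s) {r : ℕ} (h10 : s.var 10 = r)
    (hr : r < m)
    (hf : FoundArc m V (s.intArr 0) (s.intArr 6) (Earlier r 0) (s.var 7) (s.var 8) (s.var 9)) :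
    Term N .findArcFrom s fun s' => Frame 7 ∅ ∅ s s' ∧ s'.var 10 = r ∧
      FoundArc m V (s.intArr 0) (s.intArr 6) (Earlier (r + 1) 0)
        (s'.var 7) (s'.var 8) (s'.var 9) := by
  refine .forLoop m hmN (fun i s' => Frame 7 ∅ ∅ s s' ∧ s'.var 10 = r ∧
      FoundArc m V (s.intArr 0) (s.intArr 6) (Earlier r i)
        (s'.var 7) (s'.var 8) (s'.var 9)) ?_ ?_ ?_ ?_
  · exact ⟨(Frame.refl _ _ _ _).setVar, by simpa using h10, by simpa using hf⟩
  · rintro i s' - ⟨hF, -⟩ -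
    exact (hs.of_frame hF).items
  · rintro i s' hi ⟨hF, h10', hI⟩ hx
    have hs' := hs.of_frame hF
    have hb' : Program.canExtend.Holds s' ↔ Extends V (s.intArr 0) (s.intArr 6) r i := by
      simp only [Program.canExtend, Test.Holds, RealExpr.eval,
        hs'.eval_ownIndex (x := 10) (y := 11) (by omega) (by omega),
        hs'.eval_ownIndex (x := 10) (y := 10) (by omega) (by omega), IntExpr.eval, hx, h10',
        hF.int 0 (by decide), hF.int 6 (by decide), Extends, Arc, not_lt, Nat.lt_one_iff,
        Nat.pos_iff_ne_zero]
    refine .ite (fun hb => .seq (.setVar (.seq (.setVar (.setVar ⟨?_, ?_, ?_, ?_, ?_⟩)))))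
      fun hb => .skip ⟨hx, hF.setVar, by simpa using h10', ?_, ?_⟩
    · simpa using hx
    · exact (((hF.setVar).setVar).setVar).setVar
    · simpa using h10'
    · simp [IntExpr.eval]
    · intro _
      simpa [IntExpr.eval, hx, h10'] using ⟨hr, hi, hb'.1 hb⟩
    · simp only [setVar_var, show (7 : ℕ) ≠ 11 by decide, if_false]
      rintro h7 a b (hab | ⟨rfl, hab⟩)
      · exact hI.1 h7 a b (.inl hab)
      · rcases Nat.lt_succ_iff_lt_or_eq.1 hab with hab | rfl
        · exact hI.1 h7 _ b (.inr ⟨rfl, hab⟩)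
        · exact fun _ _ h => hb (hb'.2 h)
    · simpa using hI.2
  · rintro s' ⟨hF, h10', hI⟩ -
    refine ⟨hF, h10', fun h7 a b hab ha hbm => hI.1 h7 a b ?_ ha hbm, hI.2⟩
    rcases hab with hab | ⟨-, hab⟩
    · rcases Nat.lt_succ_iff_lt_or_eq.1 hab with hab | hab
      · exact .inl hab
      · exact .inr ⟨hab, hbm⟩
    · exact absurd hab (Nat.not_lt_zero _)

theorem term_findArc (hmN : m ≤ N) (hs : Assigned n m V s) :
    Term N .findArc s fun s' => Frame 7 ∅ ∅ s s' ∧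
      FoundArc m V (s.intArr 0) (s.intArr 6) (fun _ _ => True)
        (s'.var 7) (s'.var 8) (s'.var 9) := by
  refine .seq (.setVar (.forLoop m hmN (fun i s' => Frame 7 ∅ ∅ s s' ∧
      FoundArc m V (s.intArr 0) (s.intArr 6) (Earlier i 0)
        (s'.var 7) (s'.var 8) (s'.var 9)) ?_ ?_ ?_ ?_))
  · refine ⟨((Frame.refl _ _ _ _).setVar).setVar, fun _ a b hab => ?_, fun h => ?_⟩
    · rcases hab with h | ⟨-, h⟩ <;> exact absurd h (Nat.not_lt_zero _)
    · simp [IntExpr.eval] at h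
  · rintro i s' - ⟨hF, -⟩ -
    exact (hs.of_frame hF).items
  · rintro i s' hi ⟨hF, hI⟩ hx
    refine (term_findArcFrom hmN (hs.of_frame hF) hx hi (by
      rwa [hF.int 0 (by decide), hF.int 6 (by decide)])).mono ?_
    rintro s'' ⟨hF', h10, h⟩
    rw [hF.int 0 (by decide), hF.int 6 (by decide)] at h
    exact ⟨h10, (hF.trans hF').setVar, by simpa using h⟩
  · rintro s' ⟨hF, hI⟩ -
    exact ⟨hF, fun h7 a b _ ha => hI.1 h7 a b (.inl ha) ha, hI.2⟩

/-- `seen` marks items from which `r₀` can be reached, `next` leads from them towards `r₀`, and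
the marks decrease. -/
structure Search (m : ℕ) (V : ℕ → ℕ → ℝ) (own seen next : ℕ → ℕ) (r₀ : ℕ) : Prop where
  root : seen r₀ = 1
  next : ∀ r < m, seen r ≠ 0 → r ≠ r₀ →
    next r < m ∧ seen (next r) ≠ 0 ∧ seen (next r) < seen r ∧ Arc V own r (next r)
  le : ∀ r < m, seen r ≤ m

/-- The search goes from r₀ against the arcs. Variable 5 counts the marked items and serves as the
mark of the newest one, so marks decrease along `next`. Each round marks a new item or ends the
search, so there are at most m rounds. -/
theorem term_reach (hmN : m ≤ N) (hs : Assigned n m V s) {r₀ : ℕ} (h4 : s.var 4 = r₀)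
    (hr₀ : r₀ < m) :
    Term N .reach s fun s' => Frame 5 {6, 7} ∅ s s' ∧
      Search m V (s.intArr 0) (s'.intArr 6) (s'.intArr 7) r₀ ∧
      ∀ a < m, ∀ b < m, ¬ Extends V (s.intArr 0) (s'.intArr 6) a b := by
  have hclear : Term N (.forLoop 5 1 (.setInt 6 (.var 5) (.const 0))) s fun s' =>
      Frame 5 {6, 7} ∅ s s' ∧ ∀ r < m, s'.intArr 6 r = 0 := by
    refine .forLoop m hmN (fun i s' => Frame 5 {6, 7} ∅ s s' ∧ ∀ r < i, s'.intArr 6 r = 0)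
      ?_ ?_ ?_ ?_
    · exact ⟨(Frame.refl _ _ _ _).setVar, by simp⟩
    · rintro i s' - ⟨hF, -⟩ -
      exact (hs.of_frame hF).items
    · rintro i s' hi ⟨hF, hI⟩ hx
      refine .setInt ⟨by simpa using hx, (hF.setInt).setVar, fun r hr => ?_⟩
      simp only [setVar_intArr, setInt_intArr, if_true, IntExpr.eval, hx, Function.update_apply]
      split_ifs with h
      · rfl
      · exact hI r (by omega)
    · rintro s' ⟨hF, hI⟩ -
      exact ⟨hF, hI⟩
  refine .seq (hclear.mono ?_)
  rintro s₁ ⟨hF₁, h0⟩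
  refine .seq (.setInt (.seq (.setVar (.seq (.setVar (.loop (fun i s' => Frame 5 {6, 7} ∅ s s' ∧
    (s'.var 7 ≠ 0 → s'.var 5 = i + 1) ∧
    s'.var 5 = ((Finset.range m).filter fun r => s'.intArr 6 r ≠ 0).card ∧
    (∀ r < m, s'.intArr 6 r ≤ s'.var 5) ∧
    Search m V (s.intArr 0) (s'.intArr 6) (s'.intArr 7) r₀ ∧
    (s'.var 7 = 0 → ∀ a < m, ∀ b < m, ¬ Extends V (s.intArr 0) (s'.intArr 6) a b))
    ?_ ?_ ?_))))))
  · have h4' := (hF₁.var 4 (by decide)).trans h4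
    have e : ((Finset.range m).filter fun r => Function.update (s₁.intArr 6) r₀ 1 r ≠ 0) = {r₀} := by
      ext r
      simp only [Finset.mem_filter, Finset.mem_range, Finset.mem_singleton,
        Function.update_apply]
      constructor
      · rintro ⟨hr, h⟩
        by_contra hne
        rw [if_neg hne] at h
        exact h (h0 r hr)
      · rintro rfl
        simp [hr₀]
    refine ⟨((hF₁.setInt).setVar).setVar, ?_, ?_, ?_, ⟨?_, ?_, ?_⟩, ?_⟩
    · simp [IntExpr.eval]
    · simp only [IntExpr.eval, h4', setVar_intArr, setInt_intArr, if_true, setVar_var]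
      rw [e]; simp
    · intro r hr
      simp only [IntExpr.eval, h4', setVar_intArr, setInt_intArr, if_true, setVar_var,
        Function.update_apply, h0 r hr]
      split_ifs <;> simp
    · simp [IntExpr.eval, h4']
    · intro r hr h hne
      simp [IntExpr.eval, h4', hne, h0 r hr] at h
    · intro r hr
      simp only [IntExpr.eval, h4', setVar_intArr, setInt_intArr, if_true,
        Function.update_apply, h0 r hr]
      split_ifs <;> omega
    · simp [IntExpr.eval]
  · rintro i s' ⟨hF, h7, hcard, hle, hS, -⟩ hb
    simp only [Test.Holds, IntExpr.eval] at hb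
    have h5 := h7 hb.ne'
    have hcm : s'.var 5 ≤ m := by
      rw [hcard]
      exact (Finset.card_filter_le _ _).trans (Finset.card_range m).le
    refine ⟨by omega, .seq ((term_findArc hmN (hs.of_frame hF)).mono ?_)⟩
    rintro s'' ⟨hF', hno, hyes⟩
    have hF'' := hF.trans hF'
    have i0 : s'.intArr 0 = s.intArr 0 := hF.int 0 (by decide)
    have i6 : s''.intArr 6 = s'.intArr 6 := hF'.int 6 (by decide)
    have i7 : s''.intArr 7 = s'.intArr 7 := hF'.int 7 (by decide)
    have x5 : s''.var 5 = s'.var 5 := hF'.var 5 (by decide)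
    rw [i0] at hno hyes
    refine .ite (fun hb => ?_) fun hb => .skip ?_
    · simp only [Test.Holds, IntExpr.eval] at hb
      obtain ⟨ha, hb', ha0, hb0, harc⟩ := hyes hb.ne'
      set a := s''.var 8
      set b := s''.var 9
      have hset : ((Finset.range m).filter fun r =>
          Function.update (s'.intArr 6) a (s'.var 5 + 1) r ≠ 0) =
          insert a ((Finset.range m).filter fun r => s'.intArr 6 r ≠ 0) := by
        ext r
        simp only [Finset.mem_filter, Finset.mem_range, Finset.mem_insert,
          Function.update_apply]
        rcases eq_or_ne r a with rfl | hne
        · simp [ha]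
        · simp [hne]
      have hnot : a ∉ ((Finset.range m).filter fun r => s'.intArr 6 r ≠ 0) := by simp [ha0]
      have hcard' : s'.var 5 + 1 = ((Finset.range m).filter fun r =>
          Function.update (s'.intArr 6) a (s'.var 5 + 1) r ≠ 0).card := by
        rw [hset, Finset.card_insert_of_notMem hnot, hcard]
      have hcm' : s'.var 5 + 1 ≤ m := by
        rw [hcard']
        exact (Finset.card_filter_le _ _).trans (Finset.card_range m).le
      have har₀ : a ≠ r₀ := by
        rintro h
        rw [h, hS.root] at ha0
        exact one_ne_zero ha0
      refine .seq (.setVar (.seq (.setInt (.setInt ?_))))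
      have j6 : ((((s''.setVar 5 (((IntExpr.var 5).add (.const 1)).eval s'')).setInt 6 a
          (s'.var 5 + 1))).setInt 7 a b).intArr 6 =
          Function.update (s'.intArr 6) a (s'.var 5 + 1) := by simp [i6]
      have j7 : ((((s''.setVar 5 (((IntExpr.var 5).add (.const 1)).eval s'')).setInt 6 a
          (s'.var 5 + 1))).setInt 7 a b).intArr 7 =
          Function.update (s'.intArr 7) a b := by simp [i7]
      have j5 : ((((s''.setVar 5 (((IntExpr.var 5).add (.const 1)).eval s'')).setInt 6 a
          (s'.var 5 + 1))).setInt 7 a b).var 5 = s'.var 5 + 1 := by simp [IntExpr.eval, x5]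
      simp only [IntExpr.eval, setVar_var, setInt_var, x5, show (8 : ℕ) ≠ 5 by decide,
        show (9 : ℕ) ≠ 5 by decide, if_true, if_false] at j5 j6 j7 ⊢
      refine ⟨((hF''.setVar).setInt).setInt, ?_, ?_, ?_, ⟨?_, ?_, ?_⟩, ?_⟩
      · intro _; rw [h5]
      · rw [j6]; exact hcard'
      · intro r hr
        rw [j6, Function.update_apply]
        split_ifs
        · exact le_rfl
        · exact (hle r hr).trans (Nat.le_succ _)
      · rw [j6, Function.update_of_ne har₀.symm, hS.root]
      · intro r hr hr0 hne
        rw [j6] at hr0 ⊢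
        rw [j7]
        rcases eq_or_ne r a with rfl | hra
        · have hba : b ≠ a := fun h => hb0 (h ▸ ha0)
          rw [Function.update_self, Function.update_self, Function.update_of_ne hba]
          exact ⟨hb', hb0, Nat.lt_succ_of_le (hle b hb'), harc⟩
        · rw [Function.update_of_ne hra] at hr0 ⊢
          obtain ⟨k1, k2, k3, k4⟩ := hS.next r hr hr0 hne
          have hna : s'.intArr 7 r ≠ a := fun h => k2 (h ▸ ha0)
          rw [Function.update_of_ne hra, Function.update_of_ne hna]
          exact ⟨k1, k2, k3, k4⟩
      · intro r hr
        rw [j6, Function.update_apply]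
        split_ifs
        · exact hcm'
        · exact hS.le r hr
      · intro h
        exact absurd h (by simpa using hb.ne')
    · simp only [Test.Holds, IntExpr.eval, not_lt, Nat.le_zero] at hb
      rw [i6, i7, x5]
      exact ⟨hF'', fun h => absurd hb h, hcard, hle, hS,
        fun _ a ha b hb' => hno hb a b trivial ha hb'⟩
  · rintro i s' ⟨hF, -, -, -, hS, hno⟩ hb
    simp only [Test.Holds, IntExpr.eval, not_lt, Nat.le_zero] at hb
    exact ⟨hF, hS, hno hb⟩

/-- `f` orders the items for each agent like the utilities. -/
structure Compatible (n m : ℕ) (V f : ℕ → ℕ → ℝ) : Prop where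
  mono : ∀ i < n, ∀ r < m, ∀ r' < m, V i r ≤ V i r' → f i r ≤ f i r'
  strict : ∀ i < n, ∀ r < m, ∀ r' < m, V i r < V i r' → f i r < f i r'

/-- All agents are at least as well off with `own'` as with `own`, and some agent is better off,
whenever values are compatible with the utilities. -/
def Improves (n m : ℕ) (V : ℕ → ℕ → ℝ) (own own' : ℕ → ℕ) : Prop :=
  ∃ h < n, ∀ f, Compatible n m V f →
    (∀ k < n, value m f own k ≤ value m f own' k) ∧ value m f own h < value m f own' h

/-- Item r₀ serves as a token: its present owner is still to receive the current item c in exchange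
for it. The invariant credits this owner with f k c - f k r₀. A swap of r₀ and c pays the credit
out, and the former owner of c becomes the creditor, for the next item, which is at least as good as
c. The credit vanishes when the path ends in r₀. Decreasing marks ensure that items further along
the path still have their original owners. -/
theorem term_rotate (hmN : m ≤ N) (hs : Assigned n m V s) {r₀ r₁ : ℕ} (h4 : s.var 4 = r₀)
    (hr₀ : r₀ < m) (h5 : s.var 5 = r₁) (hr₁ : r₁ < m)
    (hS : Search m V (s.intArr 0) (s.intArr 6) (s.intArr 7) r₀) (hr₁' : s.intArr 6 r₁ ≠ 0)
    (hlt : V (s.intArr 0 r₀) r₀ < V (s.intArr 0 r₀) r₁) :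
    Term N .rotate s fun s' => Frame 5 {0} ∅ s s' ∧ (∀ r < m, s'.intArr 0 r < n) ∧
      Improves n m V (s.intArr 0) (s'.intArr 0) := by
  set own := s.intArr 0 with hown
  refine .seq (.setVar (.loop (fun i s' => Frame 5 {0} ∅ s s' ∧ s'.var 6 < m ∧
    s.intArr 6 (s'.var 6) ≠ 0 ∧ s.intArr 6 (s'.var 6) + i ≤ m ∧
    (∀ r < m, s'.intArr 0 r < n) ∧
    (∀ r < m, s.intArr 6 r ≤ s.intArr 6 (s'.var 6) → r ≠ r₀ → s'.intArr 0 r = own r) ∧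
    ∀ f, Compatible n m V f → (∀ k < n, value m f own k ≤ value m f (s'.intArr 0) k +
        if s'.intArr 0 r₀ = k then f k (s'.var 6) - f k r₀ else 0) ∧
      value m f own (own r₀) < value m f (s'.intArr 0) (own r₀) +
        if s'.intArr 0 r₀ = own r₀ then f (own r₀) (s'.var 6) - f (own r₀) r₀ else 0) ?_ ?_ ?_))
  · simp only [IntExpr.eval, h5, setVar_var, setVar_intArr, if_true]
    refine ⟨(Frame.refl _ _ _ _).setVar, hr₁, hr₁', hS.le r₁ hr₁, hs.owner, fun _ _ _ _ => rfl,
      fun f hf => ?_⟩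
    have := hf.strict _ (hs.owner r₀ hr₀) r₀ hr₀ r₁ hr₁ hlt
    rw [← hown] at this ⊢
    refine ⟨fun k hk => ?_, ?_⟩
    · split_ifs with h
      · subst h; linarith
      · simp
    · rw [if_pos rfl]; linarith
  · rintro i s' ⟨hF, hc, hc0, hci, ho, hsame, hval⟩ hb
    set c := s'.var 6 with hcdef
    have h4' := (hF.var 4 (by decide)).trans h4
    have hne : c ≠ r₀ := by
      simp only [Test.Holds, IntExpr.eval, h4', ← hcdef] at hb
      omega
    obtain ⟨k1, k2, k3, k4⟩ := hS.next c hc hc0 hne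
    have hoc := hsame c hc le_rfl hne
    refine ⟨by omega, .seq (.setVar (.seq (.setInt (.seq (.setInt (.setVar ?_))))))⟩
    simp only [IntExpr.eval, setVar_var, setInt_var, setInt_intArr, setVar_intArr, h4', ← hcdef,
      if_true, show (4 : ℕ) ≠ 7 by decide, show (6 : ℕ) ≠ 7 by decide, if_false,
      hF.int 7 (by decide), show (7 : ℕ) ≠ 0 by decide]
    have hF' : Frame 5 {0} ∅ s ((((s'.setVar 7 (s'.intArr 0 r₀)).setInt 0 r₀ (s'.intArr 0 c)).setInt
      0 c (s'.intArr 0 r₀)).setVar 6 (s.intArr 7 c)) := (((hF.setVar).setInt).setInt).setVar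
    refine ⟨hF', k1, k2, by omega, fun r hr => ?_, fun r hr hrc hrr => ?_, fun f hf => ?_⟩
    · simp only [Function.update_apply]
      split_ifs
      · exact ho r₀ hr₀
      · exact ho c hc
      · exact ho r hr
    · have hrc' : r ≠ c := by rintro rfl; omega
      rw [Function.update_of_ne hrc', Function.update_of_ne hrr]
      exact hsame r hr (by omega) hrr
    · have key : ∀ k < n, value m f (s'.intArr 0) k +
          (if s'.intArr 0 r₀ = k then f k c - f k r₀ else 0) ≤
          value m f (Function.update (Function.update (s'.intArr 0) r₀ (s'.intArr 0 c)) c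
            (s'.intArr 0 r₀)) k + if Function.update (Function.update (s'.intArr 0) r₀
            (s'.intArr 0 c)) c (s'.intArr 0 r₀) r₀ = k then f k (s.intArr 7 c) - f k r₀ else 0 := by
        intro k hk
        rw [value_update hc, value_update hr₀, Function.update_of_ne hne,
          Function.update_of_ne hne.symm, Function.update_self, hoc]
        have h2 := hf.mono _ (hs.owner c hc) c hc _ k1 k4
        rw [← hown] at h2
        by_cases e1 : s'.intArr 0 r₀ = k <;> by_cases e2 : own c = k <;> simp only [e1, e2, if_true,
          if_false] at h2 ⊢ <;> linarith
      exact ⟨fun k hk => ((hval f hf).1 k hk).trans (key k hk),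
        (hval f hf).2.trans_le (key _ (hs.owner r₀ hr₀))⟩
  · rintro i s' ⟨hF, -, -, -, ho, -, hval⟩ hb
    have h4' := (hF.var 4 (by decide)).trans h4
    have he : s'.var 6 = r₀ := by
      simp only [Test.Holds, IntExpr.eval, h4'] at hb
      omega
    refine ⟨hF, ho, own r₀, hs.owner r₀ hr₀, fun f hf => ?_⟩
    simpa [he] using hval f hf

/-- No cycle with a strict arc starts at `r₀`, by the witness of the items that reach `r₀`. -/
def NoCycleAt (m : ℕ) (V : ℕ → ℕ → ℝ) (own : ℕ → ℕ) (r₀ : ℕ) : Prop :=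
  ∃ T : ℕ → Prop, T r₀ ∧ (∀ a < m, ∀ b < m, T b → Arc V own a b → T a) ∧
    ∀ r < m, V (own r₀) r₀ < V (own r₀) r → ¬ T r

/-- A strict cycle through r₀ that begins with a strict arc consists of an item strictly preferred
by the owner of r₀ and a path from it back to r₀. If no marked item is strictly preferred, the marks
are the witness for `NoCycleAt`. -/
theorem term_tryItem (hmN : m ≤ N) (hs : Assigned n m V s) {r₀ : ℕ} (h4 : s.var 4 = r₀)
    (hr₀ : r₀ < m) (h3 : s.var 3 = 0) :
    Term N .tryItem s fun s' => Frame 3 {0, 6, 7} ∅ s s' ∧ s'.var 4 = r₀ ∧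
      Assigned n m V s' ∧
      (s'.var 3 = 0 → s'.intArr 0 = s.intArr 0 ∧ NoCycleAt m V (s.intArr 0) r₀) ∧
      (s'.var 3 ≠ 0 → Improves n m V (s.intArr 0) (s'.intArr 0)) := by
  refine .seq ((term_reach hmN hs h4 hr₀).mono ?_)
  rintro s₁ ⟨hF₁, hS, hclosed⟩
  have hs₁ := hs.of_frame hF₁
  have i0 : s₁.intArr 0 = s.intArr 0 := hF₁.int 0 (by decide)
  set P : ℕ → Prop := fun r => s₁.intArr 6 r ≠ 0 ∧ V (s.intArr 0 r₀) r₀ < V (s.intArr 0 r₀) r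
    with hP
  have hcl : ∀ s', Frame 5 ∅ ∅ s₁ s' → ∀ x, s'.var x < m →
      ((Program.closes x).Holds s' ↔ P (s'.var x)) := by
    intro s' hF x hx
    have hs' := hs₁.of_frame hF
    have h4' : s'.var 4 = r₀ := by
      rw [hF.var 4 (by decide), hF₁.var 4 (by decide), h4]
    simp only [Program.closes, Test.Holds, RealExpr.eval,
        hs'.eval_ownIndex (x := 4) (y := x) (by omega) hx,
        hs'.eval_ownIndex (x := 4) (y := 4) (by omega) (by omega), IntExpr.eval, h4', hP,
        hF.int 0 (by decide), hF.int 6 (by decide), i0, Nat.pos_iff_ne_zero]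
  classical
  refine .seq ((term_findBest (fun r => if P r then 1 else 0) hmN (by omega) (by decide)
    hs₁.items fun s' hF hx hx' => ?_).mono ?_)
  · rw [Test.Holds, Test.Holds, hcl s' hF 5 hx, hcl s' hF 6 hx']
    by_cases h5 : P (s'.var 5) <;> by_cases h6 : P (s'.var 6) <;> simp [h5, h6]
  rintro s₂ ⟨hF₂, h5, hbest⟩
  have hs₂ := hs₁.of_frame hF₂
  have hF : Frame 3 {0, 6, 7} ∅ s s₂ := ((Frame.refl 3 {0, 6, 7} ∅ s).trans hF₁).trans hF₂
  have h4₂ : s₂.var 4 = r₀ := by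
    rw [hF₂.var 4 (by decide), hF₁.var 4 (by decide), h4]
  have h3₂ : s₂.var 3 = 0 := by
    rw [hF₂.var 3 (by decide), hF₁.var 3 (by decide), h3]
  have j0 : s₂.intArr 0 = s.intArr 0 := (hF₂.int 0 (by decide)).trans i0
  refine .ite (fun hb => .seq ?_) fun hb => .skip ?_
  · obtain ⟨p1, p2⟩ := (hcl s₂ hF₂ 5 h5).1 hb
    refine (term_rotate hmN hs₂ h4₂ hr₀ rfl h5 (by
      rwa [j0, hF₂.int 6 (by decide), hF₂.int 7 (by decide)])
      (by rwa [hF₂.int 6 (by decide)]) (by rwa [j0])).mono ?_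
    rintro s₃ ⟨hF₃, ho, himp⟩
    rw [j0] at himp
    have hs₃ : Assigned n m V s₃ :=
      ⟨hs₂.toLayout.of_frame hF₃, by rw [hF₃.real 0 (by decide)]; exact hs₂.utilities, ho⟩
    refine .setVar ⟨(hF.trans hF₃).setVar, ?_, ⟨?_, ?_, ?_⟩, ?_, fun _ => ?_⟩
    · simp [hF₃.var 4 (by decide), h4₂]
    · exact hs₃.toLayout.of_frame ((Frame.refl 3 ∅ ∅ _).setVar)
    · exact hs₃.utilities
    · exact ho
    · simp [IntExpr.eval]
    · exact himp
  · have hnP : ∀ r < m, ¬ P r := fun r hr hr' => by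
      have := hbest r hr
      rw [hcl s₂ hF₂ 5 h5] at hb
      simp [hr', hb] at this
    refine ⟨hF, h4₂, hs₂, fun _ => ⟨j0, fun r => s₁.intArr 6 r ≠ 0, by simp [hS.root],
      fun a ha b hb' h1 h2 => ?_, fun r hr h1 h2 => hnP r hr ⟨h2, h1⟩⟩, fun h => absurd h3₂ h⟩
    by_contra h0
    exact hclosed a ha b hb' ⟨h0, h1, h2⟩

/-- The number of items that are worse than `r`. -/
noncomputable def worse (m : ℕ) (V : ℕ → ℕ → ℝ) (k r : ℕ) : ℕ :=
  open Classical in ((Finset.range m).filter fun r' => V k r' < V k r).card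

/-- Replacing utilities by numbers of worse items keeps all comparisons and makes the gain of an
exchange at least 1, whatever the size of the real utilities. -/
theorem compatible_worse : Compatible n m V fun k r => (worse m V k r : ℝ) where
  mono i _ r _ r' _ h := by
    refine Nat.cast_le.2 (Finset.card_le_card fun x hx => ?_)
    simp only [Finset.mem_filter] at hx ⊢
    exact ⟨hx.1, hx.2.trans_le h⟩
  strict i _ r hr r' _ h := by
    refine Nat.cast_lt.2 (Finset.card_lt_card ⟨fun x hx => ?_, fun hsub => ?_⟩)
    · simp only [Finset.mem_filter] at hx ⊢
      exact ⟨hx.1, hx.2.trans h⟩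
    · have := hsub (Finset.mem_filter.2 ⟨Finset.mem_range.2 hr, h⟩)
      exact (Finset.mem_filter.1 this).2.false

theorem compatible_self : Compatible n m V V :=
  ⟨fun _ _ _ _ _ _ h => h, fun _ _ _ _ _ _ h => h⟩

/-- The number of pairs of items such that the owner of the first one prefers it to the
second one. -/
noncomputable def potential (m : ℕ) (V : ℕ → ℕ → ℝ) (own : ℕ → ℕ) : ℕ :=
  ∑ r ∈ Finset.range m, worse m V (own r) r

theorem potential_le (own : ℕ → ℕ) : potential m V own ≤ m * m := by
  refine (Finset.sum_le_card_nsmul _ _ m fun r _ => ?_).trans (by simp)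
  exact (Finset.card_filter_le _ _).trans (Finset.card_range m).le

theorem potential_eq {own : ℕ → ℕ} (ho : ∀ r < m, own r < n) :
    (potential m V own : ℝ) =
      ∑ k ∈ Finset.range n, value m (fun k r => (worse m V k r : ℝ)) own k := by
  unfold value potential
  rw [Finset.sum_comm, Nat.cast_sum]
  refine Finset.sum_congr rfl fun r hr => ?_
  rw [Finset.sum_ite_eq, if_pos (Finset.mem_range.2 (ho r (Finset.mem_range.1 hr)))]

theorem Improves.potential_lt {own own' : ℕ → ℕ} (h : Improves n m V own own')
    (ho : ∀ r < m, own r < n) (ho' : ∀ r < m, own' r < n) :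
    potential m V own < potential m V own' := by
  obtain ⟨i, hi, h⟩ := h
  obtain ⟨h1, h2⟩ := h _ compatible_worse
  rw [← Nat.cast_lt (α := ℝ), potential_eq ho, potential_eq ho']
  exact Finset.sum_lt_sum (fun k hk => h1 k (Finset.mem_range.1 hk)) ⟨i, Finset.mem_range.2 hi, h2⟩

/-- Every round but the last one raises the potential by at least 1, so there are at most m * m + 1
rounds. Values never decrease. A round without an exchange has checked all items against the same
assignment. -/
theorem term_improve (hmN : m * m + m + 1 ≤ N) (hs : Assigned n m V s) :
    Term N .improve s fun s' => (∀ r < m, s'.intArr 0 r < n) ∧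
      (∀ k < n, value m V (s.intArr 0) k ≤ value m V (s'.intArr 0) k) ∧
      ∀ r < m, NoCycleAt m V (s'.intArr 0) r := by
  refine .seq (.setVar (.loop (fun i s' => Assigned n m V s' ∧
    (∀ k < n, value m V (s.intArr 0) k ≤ value m V (s'.intArr 0) k) ∧
    (s'.var 3 ≠ 0 → i ≤ potential m V (s'.intArr 0)) ∧
    (s'.var 3 = 0 → ∀ r < m, NoCycleAt m V (s'.intArr 0) r)) ?_ ?_ ?_))
  · exact ⟨hs.of_frame ((Frame.refl 3 ∅ ∅ s).setVar), fun _ _ => le_rfl, by simp,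
      by simp [IntExpr.eval]⟩
  · rintro i s₁ ⟨hs₁, hval, hi, -⟩ hb
    simp only [Test.Holds, IntExpr.eval] at hb
    replace hi := hi hb.ne'
    have := potential_le (m := m) (V := V) (s₁.intArr 0)
    refine ⟨by omega, .seq (.setVar (.forLoop m (by omega) (fun j s' => Assigned n m V s' ∧
      (s'.var 3 = 0 → s'.intArr 0 = s₁.intArr 0 ∧ ∀ r < j, NoCycleAt m V (s₁.intArr 0) r) ∧
      (s'.var 3 ≠ 0 → Improves n m V (s₁.intArr 0) (s'.intArr 0))) ?_ ?_ ?_ ?_))⟩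
    · refine ⟨hs₁.of_frame (((Frame.refl 3 ∅ ∅ s₁).setVar).setVar), fun _ => ⟨rfl, by simp⟩, ?_⟩
      simp [IntExpr.eval]
    · rintro j s' - ⟨hs', -⟩ -
      exact hs'.items
    · rintro j s' hj ⟨hs', h0, h1⟩ hx
      have fin : ∀ s'', Assigned n m V s'' → Assigned n m V (s''.setVar 4 (j + 1)) :=
        fun s'' h => h.of_frame ((Frame.refl 3 ∅ ∅ s'').setVar)
      refine .ite (fun hb' => ?_) fun hb' => .skip ⟨hx, fin _ hs', fun h => ?_, ?_⟩
      · simp only [Test.Holds, IntExpr.eval, Nat.lt_one_iff] at hb'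
        obtain ⟨e, h0⟩ := h0 hb'
        refine (term_tryItem (by omega) hs' hx hj hb').mono ?_
        rintro s'' ⟨-, h4, hs'', k0, k1⟩
        rw [e] at k0 k1
        refine ⟨h4, fin _ hs'', fun h => ?_, by simpa using k1⟩
        obtain ⟨e1, e2⟩ := k0 (by simpa using h)
        refine ⟨e1, fun r hr => ?_⟩
        rcases Nat.lt_succ_iff_lt_or_eq.1 hr with hr | rfl
        · exact h0 r hr
        · exact e2
      · simp only [Test.Holds, IntExpr.eval, Nat.lt_one_iff] at hb'
        exact absurd (by simpa using h) hb'
      · simpa using h1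
    · rintro s' ⟨hs', h0, h1⟩ -
      by_cases h3 : s'.var 3 = 0
      · obtain ⟨e, h0⟩ := h0 h3
        exact ⟨hs', by rwa [e], fun h => absurd h3 h, fun _ => by rwa [e]⟩
      · have himp := h1 h3
        have hlt := himp.potential_lt hs₁.owner hs'.owner
        obtain ⟨h, -, himp⟩ := himp
        exact ⟨hs', fun k hk => (hval k hk).trans ((himp V compatible_self).1 k hk),
          fun _ => by omega, fun h => absurd h h3⟩
  · rintro i s' ⟨hs', hval, -, h0⟩ hb
    simp only [Test.Holds, IntExpr.eval, not_lt, Nat.le_zero] at hb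
    exact ⟨hs'.owner, hval, h0 hb⟩

end

/-! ### The algorithm -/

/-- Distribute slots among the agents such that every agent gets its maximin share, let the agents
pick items for their slots, and exchange items along cycles. -/
def Program.allocate : Program :=
  .seq offsets (.seq absolutes (.seq kind (.seq sortAll (.seq thresholds
    (.seq stages (.seq pick improve))))))

section
variable {N n m : ℕ} {v : Fin n → Fin m → ℝ}

theorem inputMemory_realArr (i : Fin n) (r : Fin m) :
    (inputMemory v).realArr 0 (i * m + r) = v i r := by
  have h : (i : ℕ) * m + r < n * m := index_lt i.2 r.2
  have e : finProdFinEquiv.symm ⟨(i : ℕ) * m + r, h⟩ = (i, r) := by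
    rw [Equiv.symm_apply_eq]
    ext
    simp [finProdFinEquiv]
    ring
  simp only [inputMemory, true_and, h, dif_pos, e]

theorem ne_zero_of_cases (hs : IsGoods v ∨ IsChores v)
    (hv : WeaklyLexicographicInstance v ∨ FactoredBivaluedInstance v) (i : Fin n) (r : Fin m) :
    v i r ≠ 0 := by
  rcases hv with hv | ⟨a, b, hab, -, hv⟩
  · exact abs_pos.1 ((hv i).sum_lt (hs.imp (fun h => h i) fun h => h i) r).1
  · rcases hab with hab | hab <;> rcases hv i r with h | h <;> rw [h] <;>
      first | exact hab.1.ne' | exact hab.1.ne | exact (hab.1.trans hab.2).ne' |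
        exact (hab.2.trans hab.1).ne

theorem tractable_of_cases (hs : IsGoods v ∨ IsChores v)
    (hv : WeaklyLexicographicInstance v ∨ FactoredBivaluedInstance v) (i : Fin n) {w : ℕ → ℝ}
    (h : IsSorting (v i) w) : Tractable w m := by
  rcases hv with hv | ⟨a, b, hab, ⟨q, hq⟩, hv⟩
  · exact h.tractable_of_lex (hv i) (hs.imp (fun h => h i) fun h => h i)
  · exact h.tractable_of_two_valued hab hq (hv i)

theorem maximinShare_le_of_isThreshold (hn : 1 ≤ n) {u : Fin m → ℝ} {w : ℕ → ℝ} {μ : ℝ} {ch : Prop}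
    (h : IsSorting u w) (ht : Tractable w m) (hu : ∀ r, 0 ≤ signOf ch * u r)
    (hμ : IsThreshold n m w ch μ) : maximinShare n u ≤ signOf ch * μ := by
  obtain ⟨f, hf, hμ, -⟩ := hμ
  unfold signOf at hu ⊢
  split_ifs at hu ⊢
  · rw [neg_one_mul]
    exact h.maximinShare_le_of_chores ht (fun r => by linarith [hu r]) hn hf hμ
  · rw [one_mul]
    exact h.maximinShare_le_of_goods ht (fun r => by linarith [hu r]) hn hf hμ

theorem Accepts.signOf_mul_le {ch : Prop} {thr : ℕ → ℝ} {k : ℕ} {x : ℝ} (h : Accepts ch thr k x) :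
    signOf ch * thr k ≤ signOf ch * x := by
  unfold signOf
  split_ifs with hch
  · linarith [h.1 hch]
  · linarith [h.2 hch]

theorem bundleValue_bundles {V : ℕ → ℕ → ℝ} (hV : ∀ (i : Fin n) (r : Fin m), V i r = v i r)
    {own : ℕ → ℕ} {own' : Fin m → Fin n} (h : ∀ r, (own' r : ℕ) = own r) (i : Fin n) :
    bundleValue (v i) (bundles own' i) = value m V own i := by
  unfold bundleValue bundles value
  rw [Finset.sum_filter, ← Fin.sum_univ_eq_sum_range fun r => if own r = i then V i r else 0]
  refine Finset.sum_congr rfl fun r _ => ?_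
  rw [← h r, hV]
  simp only [Fin.ext_iff]

theorem noStrictCycle_of_noCycleAt {V : ℕ → ℕ → ℝ}
    (hV : ∀ (i : Fin n) (r : Fin m), V i r = v i r) {own : ℕ → ℕ} {own' : Fin m → Fin n}
    (h : ∀ r, (own' r : ℕ) = own r) (hno : ∀ r < m, NoCycleAt m V own r) :
    NoStrictCycle v own' := by
  intro r₀ r₁ hlt hreach
  obtain ⟨T, h1, h2, h3⟩ := hno r₀ r₀.2
  refine h3 r₁ r₁.2 (by rw [← h, hV, hV]; exact hlt) ?_
  clear hlt
  induction hreach using Relation.ReflTransGen.head_induction_on with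
  | refl => exact h1
  | @head a b hab _ ih => exact h2 a a.2 b b.2 ih (by rw [Arc, ← h, hV, hV]; exact hab)

theorem term_allocate (hn : 1 ≤ n) (hN : n * m + n + m * m + m + 1 ≤ N)
    (hs : IsGoods v ∨ IsChores v)
    (hv : WeaklyLexicographicInstance v ∨ FactoredBivaluedInstance v) :
    Term N .allocate (inputMemory v) fun s' => ∃ own : Fin m → Fin n,
      (∀ r, (own r : ℕ) = s'.intArr 0 r) ∧ NoStrictCycle v own ∧ IsMMS v (bundles own) := by
  have hnN : n ≤ N := by omega
  have hmN : m ≤ N := by omega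
  set s₀ := inputMemory v with hs₀
  set V : ℕ → ℕ → ℝ := fun k r => s₀.realArr 0 (k * m + r) with hVdef
  have hV : ∀ (i : Fin n) (r : Fin m), V i r = v i r := inputMemory_realArr
  refine .seq ((term_offsets hnN (by simp [hs₀, inputMemory])
    (by simp [hs₀, inputMemory] : s₀.var 1 = m)).mono ?_)
  rintro s₁ ⟨hF₁, hL₁⟩
  refine .seq ((term_absolutes (by omega) hL₁).mono ?_)
  rintro s₂ ⟨hF₂, habs⟩
  have hF₂' : Frame 2 {8} {5} s₀ s₂ := ((Frame.refl _ _ _ _).trans hF₁).trans hF₂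
  have hL₂ := hL₁.of_frame hF₂
  refine .seq (term_kind.mono ?_)
  rintro s₃ ⟨hF₃, hkind⟩
  have hL₃ := hL₂.of_frame hF₃
  set ch : Prop := 0 < s₃.var 2 with hch
  -- The sign of a single utility determines the kind of the instance, as no utility is zero.
  -- Without items there is nothing to show, whatever entry 0 was read as.
  have hsign : ∀ (i : Fin n) (r : Fin m), 0 ≤ signOf ch * v i r := by
    intro i r
    have h00 : s₂.realArr 0 0 = v ⟨0, hn⟩ ⟨0, by have := r.2; omega⟩ := by
      rw [hF₂'.real 0 (by decide), ← hV]; simp [hVdef]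
    have hne := ne_zero_of_cases hs hv ⟨0, hn⟩ ⟨0, by have := r.2; omega⟩
    rw [h00] at hkind
    unfold signOf
    rcases hkind with ⟨h2, hneg⟩ | ⟨h2, hpos⟩
    · rw [if_pos (by omega)]
      rcases hs with hs | hs
      · exact absurd (hs _ _) (not_le.2 hneg)
      · linarith [hs i r]
    · rw [if_neg (by omega)]
      rcases hs with hs | hs
      · linarith [hs i r]
      · exact absurd (le_antisymm (hs _ _) hpos) hne
  refine .seq ((term_sortAll (V := V) hnN hmN hL₃ fun k hk r hr => ?_).mono ?_)
  · rw [hF₃.real 5 (by decide), habs _ (index_lt hk hr), hF₁.real 0 (by decide)]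
  rintro s₄ ⟨hF₄, hsort⟩
  have hL₄ := hL₃.of_frame hF₄
  set W : ℕ → ℕ → ℝ := fun k r => s₄.realArr 1 (k * m + r) with hW
  have hsort' : ∀ i : Fin n, IsSorting (v i) (W i) := fun i => by
    have := (hsort i i.2).isSorting
    simpa only [hV] using this
  have htr : ∀ i : Fin n, Tractable (W i) m := fun i => tractable_of_cases hs hv i (hsort' i)
  refine .seq ((term_thresholds (W := W) hnN hmN hL₄ fun _ _ _ _ => rfl).mono ?_)
  rintro s₅ ⟨hF₅, hthr⟩
  have hL₅ := hL₄.of_frame hF₅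
  have c4 : s₄.var 2 = s₃.var 2 := hF₄.var 2 (by decide)
  have c5 : s₅.var 2 = s₃.var 2 := (hF₅.var 2 (by decide)).trans c4
  rw [c4, ← hch] at hthr
  have hex : ∀ k, ∃ Inv, k < n →
      StageInvariant m (W k) ch (s₅.realArr 3 k) Inv ∧ Inv (Finset.range m) n := fun k => by
    by_cases hk : k < n
    · obtain ⟨Inv, h⟩ := (hthr k hk).exists_stageInvariant (htr ⟨k, hk⟩)
      exact ⟨Inv, fun _ => h⟩
    · exact ⟨fun _ _ => True, fun h => absurd h hk⟩
  choose Inv hInv using hex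
  have hF₅' : Frame 2 {8} {1, 2, 3, 5} s₀ s₅ :=
    ((((Frame.refl 2 {8} {1, 2, 3, 5} _).trans hF₂').trans hF₃).trans hF₄).trans hF₅
  have hzero : ∀ a, a ∉ ({8} : Finset ℕ) → s₅.intArr a = fun _ => 0 := fun a ha => by
    rw [hF₅'.int a ha]; rfl
  refine .seq ((term_stages (W := W) (Inv := Inv) hnN hmN hn hL₅ (by
    rw [hF₅.real 1 (by decide)]; exact fun _ _ _ _ => rfl)
    (fun k hk => (htr ⟨k, hk⟩).nonneg) (by rw [c5]; exact fun k hk => (hInv k hk).1)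
    (fun k hk => (hInv k hk).2) (hzero 1 (by decide)) (hzero 2 (by decide))
    (hzero 3 (by decide))).mono ?_)
  rintro s₆ ⟨hF₆, hπ, hacc⟩
  have hL₆ := hL₅.of_frame hF₆
  have c6 : s₆.var 2 = s₃.var 2 := (hF₆.var 2 (by decide)).trans c5
  rw [c5, ← hch] at hacc
  have r6 : s₆.realArr 0 = s₀.realArr 0 := by
    rw [hF₆.real 0 (by decide), hF₅'.real 0 (by decide)]
  refine .seq ((term_pick (V := V) (W := W) hmN hL₆ (by rw [r6]; exact fun _ _ _ _ => rfl) hsort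
    (fun k hk r hr => by
      rw [c6, ← hch]
      have := hsign ⟨k, hk⟩ ⟨r, hr⟩
      rwa [← hV] at this) hπ (by rw [hF₆.int 5 (by decide)]; exact hzero 5 (by decide))).mono ?_)
  rintro s₇ ⟨hF₇, hown, hval⟩
  rw [c6, ← hch] at hval
  refine (term_improve (V := V) (by omega) ⟨hL₆.of_frame hF₇, by
    rw [hF₇.real 0 (by decide), r6]; exact fun _ _ _ _ => rfl, hown⟩).mono ?_
  rintro s₈ ⟨hown', hval', hno⟩
  have ho : ∀ r : Fin m, ((⟨s₈.intArr 0 r, hown' r r.2⟩ : Fin n) : ℕ) = s₈.intArr 0 r :=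
    fun _ => rfl
  refine ⟨fun r => ⟨s₈.intArr 0 r, hown' r r.2⟩, ho, noStrictCycle_of_noCycleAt hV ho hno,
    fun i => ?_⟩
  rw [bundleValue_bundles hV ho]
  -- The chain of values: maximin share, signed threshold, signed slots, picked items, items after
  -- the exchanges.
  exact (maximinShare_le_of_isThreshold hn (hsort' i) (htr i) (hsign i) (hthr i i.2)).trans
    ((hacc i i.2).signOf_mul_le.trans ((hval i i.2).trans (hval' i i.2)))

end

end FairDivision

theorem mainTheorem3 :
    ∃ (prog : FairDivision.Program) (p : Polynomial ℕ),
      ∀ (n m : ℕ) (v : Fin n → Fin m → ℝ), 1 ≤ n →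
        (FairDivision.IsGoods v ∨ FairDivision.IsChores v) →
        (FairDivision.WeaklyLexicographicInstance v ∨ FairDivision.FactoredBivaluedInstance v) →
        ∃ x : Fin n → Finset (Fin m),
          FairDivision.IsAllocation x ∧ FairDivision.IsMMS v x ∧
          FairDivision.IsParetoOptimal v x ∧
          ∃ (s : FairDivision.Memory) (t : ℕ),
            FairDivision.Exec prog (FairDivision.inputMemory v) s t ∧
            t ≤ p.eval (n + m) ∧ FairDivision.OutputsAllocation s x := by
  -- The number (n + m + 1) ^ 2 bounds the iterations of each run of a loop, and it is the value of
  -- (X + 1) ^ 2 at n + m.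
  refine ⟨.allocate, (FairDivision.stat .allocate).comp ((Polynomial.X + 1) ^ 2), ?_⟩
  intro n m v hn hs hv
  obtain ⟨s, t, hexec, ht, own, ho, hcycle, hmms⟩ :=
    FairDivision.term_allocate (N := (n + m + 1) ^ 2) hn (by ring_nf; nlinarith) hs hv
  refine ⟨FairDivision.bundles own, FairDivision.isAllocation_bundles own, hmms,
    hcycle.isParetoOptimal hs hv, s, t, hexec, ?_, fun i r => ?_⟩
  · simpa [Polynomial.eval_comp] using ht
  · rw [← ho r]
    simp [FairDivision.bundles, Fin.ext_iff]
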